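/- Conventions. A generalized permutation is a pair of nonempty words (a top and a bottom line) in which every occurring symbol occurs exactly twice in total. It is cylindrical if the first symbol of one line is the last symbol of the other line, and the set of symbols of neither line is a proper subset of that of the other. Let $\pi=\begin{pmatrix}\alpha_0,\alpha_1,\dots,\alpha_r\\ \alpha_{r+1},\dots,\alpha_s,\alpha_0\end{pmatrix}$ be cylindrical. A suspension over $\pi$ is obtained as follows. Choose vectors $\vec v_\alpha\in\mathbb C$ for the symbols $\alpha$, with $\operatorname{Im}\vec v_{\alpha_0}>0$ and $\vec v_\alpha$ real and positive for $\alpha\ne\alpha_0$, such that the two broken lines starting at $0$ with edges $\vec v_{\alpha_0},\vec v_{\alpha_1},\dots,\vec v_{\alpha_r}$ and $\vec v_{\alpha_{r+1}},\dots,\vec v_{\alpha_s},\vec v_{\alpha_0}$ have the same endpoint. In the parallelogram bounded by these two broken lines, identify any two edges carrying the same symbol, by a parallel translation if they lie on different broken lines and by a central symmetry if they lie on the same one; the quadratic differential $(dz)^2$ induces a meromorphic quadratic differential on the resulting compact Riemann surface. For $d_1,\dots,d_n\ge 1$ and $p\ge 0$, $\mathcal Q(d_1,\dots,d_n,-1^p)$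 denotes the stratum of meromorphic quadratic differentials on compact connected Riemann surfaces that are not global squares of holomorphic $1$-forms and that have exactly $n$ zeroes, of degrees $d_1,\dots,d_n$, and exactly $p$ poles, all simple. We say that $\pi$ represents $\mathcal Q(d_1,\dots,d_n,-1^p)$ if suspensions over $\pi$ exist and every suspension over $\pi$ belongs to this stratum and has a zero of degree $d_1$ at the point represented by $0$ (the left endpoint of the two broken lines). Proposition. (a) The generalized permutation $$\begin{pmatrix}0,6,1,5,6,4,3\\ 1,2,3,4,2,5,0\end{pmatrix}$$ is cylindrical and represents the stratum $\mathcal Q(1,1,1,1)$. The generalized permutations obtained from it by erasing (in both lines) the symbols $\{1\}$ and $\{1,3\}$ are cylindrical and represent the strata $\mathcal Q(2,1,1)$ and $\mathcal Q(2,2)$, respectively. (b) Let $n\ge 1$ and let $d_1,\dots,d_n,p$ be strictly positive integers with $d_1+\dots+d_n=p+4$. The generalized permutation obtained by erasing, for every $j=1,\dots,n$, the $d_j-1$ symbols $$d_1+\dots+d_{j-1}+1,\ \dots,\ d_1+\dots+d_j-1$$ in the generalized permutation $$\begin{pmatrix}0,\ 2p+6,\ 1,\ 2p+5,\ 2p+6,\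 p+4,\ p+3\\ 1,\dots,p+4,\ \ p+2,p+5,p+5,\ \ p+1,p+6,p+6,\ \dots,\ 3,2p+4,2p+4,\ \ 2,2p+5,0\end{pmatrix}$$ (the bottom line is $1,\dots,p+4$, followed by the blocks $p+2-k,\,p+5+k,\,p+5+k$ for $k=0,\dots,p-1$, followed by $2,2p+5,0$) is cylindrical and represents the stratum $\mathcal Q(d_1,\dots,d_n,-1^p)$. -/

import Mathlib

open scoped Topology Manifold ContDiff

/-! ## Quadratic differentials on Riemann surfaces and their strata -/

/-- A meromorphic quadratic differential `q` on a Riemann surface `S`: in every chart `e` of the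
atlas, `q = coeff e z * (dz)²` with `coeff e` meromorphic, and the coefficients transform by
`a(z) = b(φ z) * (φ' z)²` under a change of coordinate `φ` (away from isolated points). -/
structure MeromorphicQuadraticDifferential (S : Type) [TopologicalSpace S]
    [ChartedSpace ℂ S] where
  coeff : OpenPartialHomeomorph S ℂ → ℂ → ℂ
  meromorphicOn : ∀ e ∈ atlas ℂ S, MeromorphicOn (coeff e) e.target
  transform : ∀ e ∈ atlas ℂ S, ∀ e' ∈ atlas ℂ S, ∀ z ∈ (e.symm.trans e').source,
    ∀ᶠ w in 𝓝[≠] z, coeff e w = coeff e' (e' (e.symm w)) * deriv (e' ∘ e.symm) w ^ 2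

/-- A holomorphic 1-form (an Abelian differential) on a Riemann surface `S`. -/
structure AbelianDifferential (S : Type) [TopologicalSpace S] [ChartedSpace ℂ S] where
  coeff : OpenPartialHomeomorph S ℂ → ℂ → ℂ
  holomorphicOn : ∀ e ∈ atlas ℂ S, DifferentiableOn ℂ (coeff e) e.target
  transform : ∀ e ∈ atlas ℂ S, ∀ e' ∈ atlas ℂ S, ∀ z ∈ (e.symm.trans e').source,
    coeff e z = coeff e' (e' (e.symm z)) * deriv (e' ∘ e.symm) z

namespace MeromorphicQuadraticDifferential

variable {S : Type} [TopologicalSpace S] [ChartedSpace ℂ S]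

/-- The order of `q` at a point: `d > 0` for a zero of degree `d`, `-1` for a simple pole,
`0` for a regular point (and `⊤` where `q` vanishes identically). -/
noncomputable def order (q : MeromorphicQuadraticDifferential S) (x : S) : WithTop ℤ :=
  meromorphicOrderAt (q.coeff (chartAt ℂ x)) (chartAt ℂ x x)

/-- `q` is the global square of an Abelian differential. -/
def IsGlobalSquare (q : MeromorphicQuadraticDifferential S) : Prop :=
  ∃ η : AbelianDifferential S, ∀ e ∈ atlas ℂ S, ∀ z ∈ e.target,
    ∀ᶠ w in 𝓝[≠] z, q.coeff e w = η.coeff e w ^ 2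

end MeromorphicQuadraticDifferential

/-- A compact connected Riemann surface endowed with a meromorphic quadratic differential. -/
structure QuadraticSurface where
  carrier : Type
  [topologicalSpace : TopologicalSpace carrier]
  [chartedSpace : ChartedSpace ℂ carrier]
  [isManifold : IsManifold 𝓘(ℂ) ω carrier]
  [t2Space : T2Space carrier]
  [compactSpace : CompactSpace carrier]
  [connectedSpace : ConnectedSpace carrier]
  differential : MeromorphicQuadraticDifferential carrier

attribute [instance] QuadraticSurface.topologicalSpace QuadraticSurface.chartedSpace
  QuadraticSurface.isManifold QuadraticSurface.t2Space QuadraticSurface.compactSpace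
  QuadraticSurface.connectedSpace

/-- The stratum `Q(d₁, …, dₙ, -1ᵖ)`: quadratic differentials which are not global squares of
Abelian differentials, with exactly `n` zeroes, of degrees `d₁, …, dₙ`, and exactly `p` poles,
all of them simple. (For `dₖ ≥ 1`.) -/
def Stratum {n : ℕ} (d : Fin n → ℕ) (p : ℕ) : Set QuadraticSurface :=
  {X | ¬ X.differential.IsGlobalSquare ∧
    ∃ sing : Fin n ⊕ Fin p → X.carrier, Function.Injective sing ∧
      (∀ k, X.differential.order (sing (Sum.inl k)) = ((d k : ℤ) : WithTop ℤ)) ∧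
      (∀ j, X.differential.order (sing (Sum.inr j)) = ((-1 : ℤ) : WithTop ℤ)) ∧
      ∀ x, x ∉ Set.range sing → X.differential.order x = 0}

/-! ## Generalized permutations -/

/-- A pair of words ("lines") in the alphabet `ℕ`. -/
structure TwoLines where
  top : List ℕ
  bot : List ℕ

namespace TwoLines

/-- Both lines are nonempty and every symbol that occurs does so exactly twice in total. -/
def IsGeneralizedPermutation (π : TwoLines) : Prop :=
  π.top ≠ [] ∧ π.bot ≠ [] ∧ ∀ k ∈ π.top ++ π.bot, (π.top ++ π.bot).count k = 2

/-- A generalized permutation is cylindrical if the first symbol of one line is the last symbol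
of the other, and neither line's set of symbols is a proper subset of that of the other. -/
def IsCylindrical (π : TwoLines) : Prop :=
  π.IsGeneralizedPermutation ∧
  (π.top.head? = π.bot.getLast? ∨ π.bot.head? = π.top.getLast?) ∧
  ¬ π.top.toFinset ⊂ π.bot.toFinset ∧ ¬ π.bot.toFinset ⊂ π.top.toFinset

/-- Erase the symbols of `E` in both lines. -/
def erase (π : TwoLines) (E : Finset ℕ) : TwoLines where
  top := π.top.filter (· ∉ E)
  bot := π.bot.filter (· ∉ E)

/-- The data of a Jenkins–Strebel suspension with a single cylinder over a generalized
permutation with top line `a, α₁, …, αᵣ` and bottom line `αᵣ₊₁, …, αₛ, a`: a vector `ζ k` for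
every symbol `k`, where `ζ a` points upwards, all other vectors are horizontal of positive
length, and the two broken lines with these edges, starting at `0`, have the same endpoint. -/
structure IsSuspensionDatum (π : TwoLines) (a : ℕ) (ζ : ℕ → ℂ) : Prop where
  head_top : π.top.head? = some a
  last_bot : π.bot.getLast? = some a
  im_pos : 0 < (ζ a).im
  horizontal : ∀ k ∈ π.top ++ π.bot, k ≠ a → 0 < (ζ k).re ∧ (ζ k).im = 0
  closing : (π.top.map ζ).sum = (π.bot.map ζ).sum

/-- The `i`-th vertex of the broken line with edge vectors `ζ l₀, ζ l₁, …` starting at `0`. -/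
noncomputable def vertex (l : List ℕ) (ζ : ℕ → ℂ) (i : ℕ) : ℂ := ((l.take i).map ζ).sum

/-- The closed parallelogram bounded by the two broken lines of a suspension datum; its sides
at the origin are `ζ a` and the horizontal vector `ζ αᵣ₊₁ + … + ζ αₛ`. -/
noncomputable def pattern (π : TwoLines) (a : ℕ) (ζ : ℕ → ℂ) : Set ℂ :=
  {z | ∃ s ∈ Set.Icc (0 : ℝ) 1, ∃ t ∈ Set.Icc (0 : ℝ) 1,
    z = (s : ℂ) * ζ a + (t : ℂ) * ((π.bot.map ζ).sum - ζ a)}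

/-- Elementary identifications of boundary points: two edges carrying the same symbol are
identified by a parallel translation if they lie on different broken lines, and by a central
symmetry (rotation by `π`) if they lie on the same broken line. -/
inductive Glued (π : TwoLines) (ζ : ℕ → ℂ) : ℂ → ℂ → Prop
  | translation (i j k : ℕ) (hi : π.top[i]? = some k) (hj : π.bot[j]? = some k)
      (t : ℝ) (ht : t ∈ Set.Icc (0 : ℝ) 1) :
      Glued π ζ (vertex π.top ζ i + t * ζ k) (vertex π.bot ζ j + t * ζ k)
  | symmetryTop (i j k : ℕ) (hij : i ≠ j) (hi : π.top[i]? = some k) (hj : π.top[j]? = some k)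
      (t : ℝ) (ht : t ∈ Set.Icc (0 : ℝ) 1) :
      Glued π ζ (vertex π.top ζ i + t * ζ k) (vertex π.top ζ j + (1 - t) * ζ k)
  | symmetryBot (i j k : ℕ) (hij : i ≠ j) (hi : π.bot[i]? = some k) (hj : π.bot[j]? = some k)
      (t : ℝ) (ht : t ∈ Set.Icc (0 : ℝ) 1) :
      Glued π ζ (vertex π.bot ζ i + t * ζ k) (vertex π.bot ζ j + (1 - t) * ζ k)

/-- The map `f` (only its values on the parallelogram matter) exhibits the quadratic surface `X`
as obtained from the parallelogram by identifying edges with the same symbol, endowed with the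
quadratic differential induced by `(dz)²`. (As the parallelogram is compact and `X` is Hausdorff,
`f` is a quotient map; the complex structure and the differential of `X` are determined by
their restriction to the image of the interior.) -/
structure IsGluing (π : TwoLines) (a : ℕ) (ζ : ℕ → ℂ) (X : QuadraticSurface)
    (f : ℂ → X.carrier) : Prop where
  continuousOn : ContinuousOn f (π.pattern a ζ)
  surjOn : Set.SurjOn f (π.pattern a ζ) Set.univ
  fiber : ∀ z ∈ π.pattern a ζ, ∀ w ∈ π.pattern a ζ,
    f z = f w ↔ Relation.EqvGen (Glued π ζ) z w
  pullback : ∀ z ∈ interior (π.pattern a ζ), ∀ e ∈ atlas ℂ X.carrier, f z ∈ e.source →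
    X.differential.coeff e (e (f z)) * deriv (fun w => e (f w)) z ^ 2 = 1

/-- The cylindrical generalized permutation `π`, whose top line starts and whose bottom line ends
with the same symbol, represents the stratum `Q(d₁, …, dₙ, -1ᵖ)`: suspensions over `π` exist, and
for each of them the resulting surface lies in the stratum and has a zero of degree `d₁` at
the left endpoint `0` of the diagonal of the parallelogram. -/
def Represents (π : TwoLines) {n : ℕ} (d : Fin (n + 1) → ℕ) (p : ℕ) : Prop :=
  π.IsCylindrical ∧ (∃ a ζ, π.IsSuspensionDatum a ζ) ∧
  ∀ a ζ, π.IsSuspensionDatum a ζ →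
    ∃ X ∈ Stratum d p, ∃ f : ℂ → X.carrier, π.IsGluing a ζ X f ∧
      X.differential.order (f 0) = ((d 0 : ℤ) : WithTop ℤ)

end TwoLines

/-! ## The generalized permutations in genus two -/

/-- The generalized permutation `(0,6,1,5,6,4,3 / 1,2,3,4,2,5,0)`. -/
def genusTwoHolomorphic : TwoLines where
  top := [0, 6, 1, 5, 6, 4, 3]
  bot := [1, 2, 3, 4, 2, 5, 0]

/-- The generalized permutation with top line `0, 2p+6, 1, 2p+5, 2p+6, p+4, p+3` and bottom line
`1, …, p+4, p+2, p+5, p+5, p+1, p+6, p+6, …, 3, 2p+4, 2p+4, 2, 2p+5, 0`. -/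
def genusTwoFamily (p : ℕ) : TwoLines where
  top := [0, 2 * p + 6, 1, 2 * p + 5, 2 * p + 6, p + 4, p + 3]
  bot := List.range' 1 (p + 4) ++
    (List.range p).flatMap (fun k => [p + 2 - k, p + 5 + k, p + 5 + k]) ++ [2, 2 * p + 5, 0]

/-- The erased symbols: the union over `j` of the `d_j - 1` consecutive symbols
`d₁ + … + d_{j-1} + 1, …, d₁ + … + d_j - 1`. -/
def erasedSymbols {n : ℕ} (d : Fin n → ℕ) : Finset ℕ :=
  Finset.univ.biUnion fun j =>
    Finset.Ioo (∑ i ∈ Finset.Iio j, d i) (∑ i ∈ Finset.Iic j, d i)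

/-! A suspension over `π` is a flat cylinder of height `(ζ a).im`: the two sides labelled `a` close
up the parallelogram, and the two boundary circles are cut into edges glued in pairs. The upper
circle is viewed after a half-turn (`emb`), so that the cylinder lies above both circles. In these
coordinates a translation between the circles and a central symmetry of one circle take the same
form, the orientation-reversing gluing of an edge with its `twin`.

Around a boundary point the half-discs follow each other according to `next`; at initial points of
edges this is `succ ∘ twin`. If the cycle has length `m`, the map `w ↦ w ^ (2 / m)` opens each
half-disc to a sector of angle `2π / m`, the `m` sectors fill a disc with coordinate `u`, and `(dw)²
= (m² / 4) u ^ (m - 2) (du)²`. The point therefore has order `m - 2` (`exists_boundary_star`). Such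
charts are compatible, by the identity theorem across edges and by removable singularities at
centres. If two twins lie on the same circle, the differential is not a square: a root would be `dz`
or `-dz` on the whole open cylinder, and a gluing by a half-turn changes its sign
(`not_isGlobalSquare`). Thus `TwoLines.Tagging.represents` reduces the statement to the cycles of
`succ ∘ twin`.

For `genusTwoFamily p` with nothing erased, these cycles are `fst i → mid i → snd (i - 1) → fst i`
for `1 ≤ i ≤ p + 4`, giving `p + 4` simple zeroes, and the fixed points `pole i`, giving `p` simple
poles. Erasing a symbol `i ≤ p + 3` removes `fst i` and `snd i` and merges the cycles of `i` and `i
+ 1`. A block of `d j` consecutive indices thus yields one cycle made of `d j` edges `mid`, one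
`fst` and one `snd`, hence a zero of degree `d j`. The first surviving bottom edge belongs to the
first block, which puts that zero at the origin. Cylindricity and the existence of suspensions
follow from the presence, on each line, of a symbol that occurs twice there. The family at `p = 0`
is `genusTwoHolomorphic`. -/

/-! ### The root that opens a half-disc to a sector. -/

/-- The branch of `w ↦ w ^ (2 / m)` on the closed upper half-plane, cut along the negative
imaginary axis. -/
noncomputable def sectorRoot (m : ℕ) (w : ℂ) : ℂ :=
  Complex.exp (Real.pi * Complex.I / m) * (-Complex.I * w) ^ ((2 : ℂ) / m)

namespace sectorRoot

variable {m : ℕ}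

theorem pow_eq (hm : 0 < m) (w : ℂ) : sectorRoot m w ^ m = w ^ 2 := by
  have hm' : (m : ℂ) ≠ 0 := by exact_mod_cast hm.ne'
  rw [sectorRoot, mul_pow, ← Complex.exp_nat_mul, ← Complex.cpow_nat_mul,
    mul_div_cancel₀ _ hm', mul_div_cancel₀ _ hm', Complex.exp_pi_mul_I]
  have : (-Complex.I * w) ^ (2 : ℂ) = (-Complex.I * w) ^ (2 : ℕ) := by
    rw [← Complex.cpow_natCast]; norm_num
  rw [this, mul_pow, neg_sq, Complex.I_sq]
  ring

theorem norm_pow (hm : 0 < m) (w : ℂ) : ‖sectorRoot m w‖ ^ m = ‖w‖ ^ 2 := by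
  rw [← _root_.norm_pow, pow_eq hm, _root_.norm_pow]

theorem zero (hm : 0 < m) : sectorRoot m 0 = 0 := by
  have := pow_eq hm 0
  simpa [hm.ne'] using this

theorem eq_zero_iff (hm : 0 < m) {w : ℂ} : sectorRoot m w = 0 ↔ w = 0 := by
  constructor
  · intro h
    have := pow_eq hm w
    rw [h, zero_pow hm.ne'] at this
    simpa using this.symm
  · rintro rfl; exact zero hm

/-- The factor `-I` turns the closed upper half-plane into the closed right half-plane, away from
the cut of the principal logarithm. -/
theorem mem_slitPlane {w : ℂ} (h0 : w ≠ 0) (h : 0 ≤ w.im) :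
    -Complex.I * w ∈ Complex.slitPlane := by
  rw [Complex.mem_slitPlane_iff]
  simp only [Complex.mul_re, Complex.mul_im, Complex.neg_re, Complex.neg_im, Complex.I_re,
    Complex.I_im]
  rcases h.lt_or_eq with h | h
  · left; linarith
  · right
    intro h'
    apply h0
    apply Complex.ext
    · simpa using h'
    · simp [← h]

theorem analyticAt {w : ℂ} (h0 : w ≠ 0) (h : 0 ≤ w.im) :
    AnalyticAt ℂ (sectorRoot m) w := by
  unfold sectorRoot
  have := mem_slitPlane h0 h
  have h1 : AnalyticAt ℂ (fun w => -Complex.I * w) w := by fun_prop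
  exact analyticAt_const.mul (h1.cpow analyticAt_const this)

theorem deriv_mul (hm : 0 < m) {w : ℂ} (h0 : w ≠ 0) (h : 0 ≤ w.im) :
    m * sectorRoot m w ^ (m - 1) * deriv (sectorRoot m) w = 2 * w := by
  have hd := (analyticAt (m := m) h0 h).differentiableAt.hasDerivAt.pow m
  have : (sectorRoot m ^ m) = fun w : ℂ => w ^ 2 := by
    funext w; simp [pow_eq hm]
  rw [this] at hd
  have := hd.unique (hasDerivAt_pow 2 w)
  simpa using this

theorem deriv_ne_zero (hm : 0 < m) {w : ℂ} (h0 : w ≠ 0) (h : 0 ≤ w.im) :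
    deriv (sectorRoot m) w ≠ 0 := by
  intro h'
  have := deriv_mul hm h0 h
  rw [h'] at this
  simp at this
  exact h0 (by simpa using this)

/-- Only `w = 0` is not covered by analyticity; there `‖sectorRoot m w‖` is the `m`-th root of `‖w‖
^ 2` and tends to `0`. -/
theorem continuousAt (hm : 0 < m) {w : ℂ} (h : 0 ≤ w.im) :
    ContinuousAt (sectorRoot m) w := by
  by_cases h0 : w = 0
  · subst h0
    rw [ContinuousAt, zero hm, tendsto_zero_iff_norm_tendsto_zero]
    have h1 : ∀ w : ℂ, ‖sectorRoot m w‖ = (‖w‖ ^ 2) ^ ((m : ℝ)⁻¹) := by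
      intro w
      rw [← norm_pow hm, Real.pow_rpow_inv_natCast (norm_nonneg _) hm.ne']
    simp_rw [h1]
    have : ContinuousAt (fun w : ℂ => (‖w‖ ^ 2) ^ ((m : ℝ)⁻¹)) 0 := by
      apply ContinuousAt.rpow_const (by fun_prop)
      right; positivity
    have h2 := this.tendsto
    simpa [Real.zero_rpow (inv_ne_zero (by exact_mod_cast hm.ne' : (m:ℝ) ≠ 0))] using h2
  · exact (analyticAt h0 h).continuousAt

/-- The logarithms of `-I * -w` and `-I * w` differ by `π * I`, which the exponent `2 / m` turns
into the sector angle `2π / m`. This is what makes the edges of adjacent sectors fit. -/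
theorem neg {w : ℂ} (hw : 0 < w.re) :
    sectorRoot m (-w) = Complex.exp (2 * Real.pi * Complex.I / m) * sectorRoot m w := by
  have hw0 : w ≠ 0 := by rintro rfl; simp at hw
  have ha := Complex.abs_arg_lt_pi_div_two_iff.2 (Or.inl hw)
  rw [abs_lt] at ha
  have hpi := Real.pi_pos
  have e1 : Complex.log (-Complex.I * -w) = Complex.log w + Real.pi / 2 * Complex.I := by
    have : -Complex.I * -w = w * Complex.I := by ring
    rw [this, Complex.log_mul hw0 Complex.I_ne_zero, Complex.log_I]
    rw [Complex.arg_I]; constructor <;> linarith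
  have e2 : Complex.log (-Complex.I * w) = Complex.log w - Real.pi / 2 * Complex.I := by
    have : -Complex.I * w = w * (-Complex.I) := by ring
    rw [this, Complex.log_mul hw0 (neg_ne_zero.2 Complex.I_ne_zero), Complex.log_neg_I]
    · ring
    rw [Complex.arg_neg_I]; constructor <;> linarith
  unfold sectorRoot
  have hI : -Complex.I ≠ 0 := neg_ne_zero.2 Complex.I_ne_zero
  rw [Complex.cpow_def_of_ne_zero (mul_ne_zero hI (neg_ne_zero.2 hw0)),
    Complex.cpow_def_of_ne_zero (mul_ne_zero hI hw0), e1, e2, ← Complex.exp_add, ← Complex.exp_add,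
    ← Complex.exp_add]
  congr 1
  ring

end sectorRoot

/-! ### Homeomorphisms induced by maps on a compact set. -/

/-- A map which is constant on the fibres of `Ψ` descends to a continuous function. -/
theorem continuousOn_of_factor {Y M Z : Type*} [TopologicalSpace Y] [TopologicalSpace M]
    [TopologicalSpace Z] [T2Space M] {K : Set Y} (hK : IsCompact K) {Φ : Y → Z} {Ψ : Y → M}
    (hΦ : ContinuousOn Φ K) (hΨ : ContinuousOn Ψ K) {φ : M → Z}
    (h : ∀ y ∈ K, φ (Ψ y) = Φ y) : ContinuousOn φ (Ψ '' K) := by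
  rw [continuousOn_iff_isClosed]
  intro C hC
  obtain ⟨D, hD, hDe⟩ := (continuousOn_iff_isClosed.1 hΦ) C hC
  refine ⟨Ψ '' (D ∩ K), ?_, ?_⟩
  -- `Ψ` is a closed map on `K`: closed subsets of `K` are compact, and compact subsets of a
  -- Hausdorff space are closed.
  · apply IsCompact.isClosed
    exact (hK.inter_left hD).image_of_continuousOn (hΨ.mono Set.inter_subset_right)
  · rw [← hDe]
    ext x
    constructor
    · rintro ⟨hx, y, hy, rfl⟩
      refine ⟨⟨y, ⟨?_, hy⟩, rfl⟩, ⟨y, hy, rfl⟩⟩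
      simpa [h y hy] using hx
    · rintro ⟨⟨y, ⟨hy, hyK⟩, rfl⟩, _⟩
      refine ⟨?_, y, hyK, rfl⟩
      simpa [h y hyK] using hy

/-- Two maps on a compact set with the same fibres induce an open partial homeomorphism between
their images. -/
theorem exists_openPartialHomeomorph {Y M Z : Type*} [TopologicalSpace Y] [TopologicalSpace M]
    [TopologicalSpace Z] [T2Space M] [T2Space Z] [Nonempty Y] {K : Set Y} (hK : IsCompact K)
    {Φ : Y → Z} {Ψ : Y → M}
    (hΦ : ContinuousOn Φ K) (hΨ : ContinuousOn Ψ K)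
    (h : ∀ y ∈ K, ∀ y' ∈ K, Ψ y = Ψ y' ↔ Φ y = Φ y') {O : Set Z} (hO : IsOpen O)
    (hOK : O ⊆ Φ '' K) (hU : IsOpen (Ψ '' (K ∩ Φ ⁻¹' O))) :
    ∃ e : OpenPartialHomeomorph M Z, e.source = Ψ '' (K ∩ Φ ⁻¹' O) ∧ e.target = O ∧
      ∀ y ∈ K, Φ y ∈ O → e (Ψ y) = Φ y := by
  classical
  -- Since the fibres agree, choosing a preimage under one map and applying the other does not
  -- depend on the choice.
  have hφ : ∀ y ∈ K, (Φ ∘ Function.invFunOn Ψ K) (Ψ y) = Φ y := by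
    intro y hy
    have h1 := Function.invFunOn_mem (f := Ψ) ⟨y, hy, rfl⟩
    have h2 := Function.invFunOn_eq (f := Ψ) ⟨y, hy, rfl⟩
    exact (h _ h1 _ hy).1 h2
  have hψ : ∀ y ∈ K, (Ψ ∘ Function.invFunOn Φ K) (Φ y) = Ψ y := by
    intro y hy
    have h1 := Function.invFunOn_mem (f := Φ) ⟨y, hy, rfl⟩
    have h2 := Function.invFunOn_eq (f := Φ) ⟨y, hy, rfl⟩
    exact (h _ h1 _ hy).2 h2
  refine ⟨{ toFun := Φ ∘ Function.invFunOn Ψ K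
            invFun := Ψ ∘ Function.invFunOn Φ K
            source := Ψ '' (K ∩ Φ ⁻¹' O)
            target := O
            map_source' := ?_
            map_target' := ?_
            left_inv' := ?_
            right_inv' := ?_
            open_source := hU
            open_target := hO
            continuousOn_toFun := ?_
            continuousOn_invFun := ?_ }, rfl, rfl, fun y hy _ => hφ y hy⟩
  · rintro _ ⟨y, ⟨hy, hyO⟩, rfl⟩
    rw [hφ y hy]; exact hyO
  · intro u hu
    obtain ⟨y, hy, rfl⟩ := hOK hu
    exact ⟨y, ⟨hy, hu⟩, (hψ y hy).symm⟩
  · rintro _ ⟨y, ⟨hy, hyO⟩, rfl⟩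
    rw [hφ y hy, hψ y hy]
  · intro u hu
    obtain ⟨y, hy, rfl⟩ := hOK hu
    rw [hψ y hy, hφ y hy]
  · exact (continuousOn_of_factor hK hΦ hΨ hφ).mono (Set.image_mono Set.inter_subset_left)
  · exact (continuousOn_of_factor hK hΨ hΦ hψ).mono hOK

/-! ### The cylinder with glued boundary and its quotient surface. -/

/-- A closed horizontal cylinder of circumference `L`, whose universal cover is the strip
`0 ≤ im z ≤ im c`, together with a subdivision of its two boundary circles into oriented edges and
an orientation reversing pairing `twin` of these edges. Side `false` is the lower boundary, side
`true` the upper one, which is parametrized from right to left starting at `c`. -/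
structure GluedCylinder where
  E : Type
  [fintypeE : Fintype E]
  side : E → Bool
  start : E → ℝ
  len : E → ℝ
  twin : E → E
  succ : Equiv.Perm E
  L : ℝ
  c : ℂ
  L_pos : 0 < L
  c_pos : 0 < c.im
  len_pos : ∀ e, 0 < len e
  twin_twin : ∀ e, twin (twin e) = e
  twin_ne : ∀ e, twin e ≠ e
  len_twin : ∀ e, len (twin e) = len e
  side_succ : ∀ e, side (succ e) = side e
  start_succ : ∀ e, ∃ n : ℤ, start (succ e) = start e + len e + n * L
  -- Together with `unique`: modulo `L`, the half-open edges tile each boundary circle.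
  cover : ∀ s x, ∃ e, ∃ n : ℤ, side e = s ∧ start e ≤ x + n * L ∧ x + n * L < start e + len e
  unique : ∀ e e' x, ∀ n n' : ℤ, side e = side e' →
    start e ≤ x + n * L → x + n * L < start e + len e →
    start e' ≤ x + n' * L → x + n' * L < start e' + len e' → e = e' ∧ n = n'

attribute [instance] GluedCylinder.fintypeE

namespace GluedCylinder

variable (G : GluedCylinder)

/-- A boundary point, as a point of the half-open edge containing it. -/
@[ext] structure Bd where
  edge : G.E
  pos : ℝ
  nonneg : 0 ≤ pos
  lt : pos < G.len edge

/-- The universal cover of the closed cylinder. -/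
def strip : Set ℂ := {z | 0 ≤ z.im ∧ z.im ≤ G.c.im}

/-- The half-plane coordinate at the lower (`s = false`) or upper (`s = true`) boundary. -/
def emb (s : Bool) (v : ℂ) : ℂ := if s then G.c - v else v

/-- Retraction of the plane to the strip. -/
noncomputable def clamp (z : ℂ) : ℂ := ⟨z.re, max 0 (min z.im G.c.im)⟩

variable {G}

@[simp] theorem emb_emb (s : Bool) (v : ℂ) : G.emb s (G.emb s v) = v := by
  cases s <;> simp [emb]

theorem emb_injective (s : Bool) : Function.Injective (G.emb s) :=
  Function.LeftInverse.injective (emb_emb s)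

theorem emb_mem_strip {s : Bool} {v : ℂ} : G.emb s v ∈ G.strip ↔ v ∈ G.strip := by
  cases s
  · simp [emb]
  · simp only [emb, strip, Set.mem_ofPred_eq, if_true, Complex.sub_im]
    constructor <;> rintro ⟨h1, h2⟩ <;> constructor <;> linarith

theorem emb_add (s : Bool) (v w : ℂ) : G.emb s (v + w) = G.emb s v + (if s then -w else w) := by
  cases s <;> simp [emb]; ring

theorem continuous_emb (s : Bool) : Continuous (G.emb s) := by
  have : G.emb s = fun v => if s then G.c - v else v := rfl
  rw [this]
  cases s <;> simp <;> fun_prop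

theorem clamp_of_mem {z : ℂ} (h : z ∈ G.strip) : G.clamp z = z := by
  apply Complex.ext
  · rfl
  · simp [clamp, min_eq_left h.2, max_eq_right h.1]

theorem clamp_mem (z : ℂ) : G.clamp z ∈ G.strip := by
  refine ⟨le_max_left _ _, max_le G.c_pos.le (min_le_right _ _)⟩

theorem continuous_clamp : Continuous G.clamp := by
  have : G.clamp = fun z => ((z.re : ℝ) : ℂ) + ((max 0 (min z.im G.c.im) : ℝ) : ℂ) * Complex.I := by
    funext z
    apply Complex.ext <;> simp [clamp]
  rw [this]
  exact (Complex.continuous_ofReal.comp Complex.continuous_re).add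
    ((Complex.continuous_ofReal.comp (continuous_const.max
      (Complex.continuous_im.min continuous_const))).mul continuous_const)

theorem isClosed_strip : IsClosed G.strip :=
  (isClosed_le continuous_const Complex.continuous_im).inter
    (isClosed_le Complex.continuous_im continuous_const)

theorem strip_add_int {z : ℂ} (n : ℤ) : z + n * G.L ∈ G.strip ↔ z ∈ G.strip := by
  simp [strip]

namespace Bd

/-- The coordinate of a boundary point along its boundary component. -/
def loc (b : G.Bd) : ℝ := G.start b.edge + b.pos

/-- The boundary component of a boundary point. -/
def side (b : G.Bd) : Bool := G.side b.edge

/-- The distance to the end of the edge. -/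
def room (b : G.Bd) : ℝ := G.len b.edge - b.pos

theorem room_pos (b : G.Bd) : 0 < b.room := sub_pos.2 b.lt

/-- The boundary point following `b` in the cyclic order around its image in the glued surface:
the right germ at `b` is glued to the left germ at `b.next`. -/
noncomputable def next (b : G.Bd) : G.Bd :=
  if h : b.pos = 0 then ⟨G.succ (G.twin b.edge), 0, le_rfl, G.len_pos _⟩
  else ⟨G.twin b.edge, G.len b.edge - b.pos, sub_nonneg.2 b.lt.le, by
    rw [G.len_twin]; have := lt_of_le_of_ne b.nonneg (Ne.symm h); linarith⟩

/-- Translation to the right inside an edge. -/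
def right (b : G.Bd) (t : ℝ) (ht : 0 ≤ t) (ht' : t < b.room) : G.Bd :=
  ⟨b.edge, b.pos + t, add_nonneg b.nonneg ht, by unfold room at ht'; linarith⟩

/-- The initial point of an edge. -/
def vertex (e : G.E) : G.Bd := ⟨e, 0, le_rfl, G.len_pos _⟩

theorem next_vertex (e : G.E) : (vertex e : G.Bd).next = vertex (G.succ (G.twin e)) := by
  simp [next, vertex]

theorem eq_vertex {b : G.Bd} (h : b.pos = 0) : b = vertex b.edge := by
  ext
  · rfl
  · exact h

theorem next_of_pos_ne {b : G.Bd} (h : b.pos ≠ 0) :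
    (b.next.edge = G.twin b.edge) ∧ b.next.pos = G.len b.edge - b.pos := by
  simp [next, h]

theorem next_pos_ne {b : G.Bd} (h : b.pos ≠ 0) : b.next.pos ≠ 0 := by
  rw [(next_of_pos_ne h).2]
  have := b.lt
  intro h'; linarith

theorem next_next {b : G.Bd} (h : b.pos ≠ 0) : b.next.next = b := by
  have h1 := next_of_pos_ne h
  have h2 := next_of_pos_ne (next_pos_ne h)
  apply Bd.ext
  · rw [h2.1, h1.1, G.twin_twin]
  · rw [h2.2, h1.2, h1.1, G.len_twin]; ring

theorem next_ne {b : G.Bd} (h : b.pos ≠ 0) : b.next ≠ b := fun h' =>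
  G.twin_ne b.edge (by rw [← (next_of_pos_ne h).1, h'])

theorem iterate_vertex (e : G.E) (k : ℕ) :
    next^[k] (vertex e : G.Bd) = vertex ((fun e => G.succ (G.twin e))^[k] e) := by
  induction k with
  | zero => rfl
  | succ k ih => rw [Function.iterate_succ_apply', ih, next_vertex, Function.iterate_succ_apply']

theorem vertex_injective : Function.Injective (vertex : G.E → G.Bd) := fun e e' h => by
  have := congrArg Bd.edge h; exact this

theorem minimalPeriod_vertex (e : G.E) :
    Function.minimalPeriod next (vertex e : G.Bd) =
      Function.minimalPeriod (fun e => G.succ (G.twin e)) e := by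
  apply Nat.dvd_antisymm
  · apply Function.IsPeriodicPt.minimalPeriod_dvd
    have := Function.isPeriodicPt_minimalPeriod (fun e => G.succ (G.twin e)) e
    rw [Function.IsPeriodicPt, Function.IsFixedPt] at this ⊢
    rw [iterate_vertex, this]
  · apply Function.IsPeriodicPt.minimalPeriod_dvd
    have := Function.isPeriodicPt_minimalPeriod next (vertex e : G.Bd)
    rw [Function.IsPeriodicPt, Function.IsFixedPt] at this ⊢
    rw [iterate_vertex] at this
    exact vertex_injective this

/-- Two half-discs meet at an interior point of an edge, so the total angle is `2π` and the point
will be regular. -/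
theorem minimalPeriod_of_pos_ne {b : G.Bd} (h : b.pos ≠ 0) : Function.minimalPeriod next b = 2 := by
  have h2 : Function.IsPeriodicPt next 2 b := next_next h
  have := h2.minimalPeriod_dvd
  rcases (Nat.dvd_prime Nat.prime_two).1 this with h1 | h1
  · exact absurd (Function.minimalPeriod_eq_one_iff_isFixedPt.1 h1) (next_ne h)
  · exact h1

/-- On vertices `next` is the injective self-map `succ ∘ twin` of a finite set; elsewhere it is an
involution. -/
theorem mem_periodicPts (b : G.Bd) : b ∈ Function.periodicPts (next (G := G)) := by
  by_cases h : b.pos = 0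
  · rw [eq_vertex h, ← Function.minimalPeriod_pos_iff_mem_periodicPts, minimalPeriod_vertex,
      Function.minimalPeriod_pos_iff_mem_periodicPts]
    apply Function.Injective.mem_periodicPts
    intro x y hxy
    have := G.succ.injective hxy
    rw [← G.twin_twin x, this, G.twin_twin]
  · exact ⟨2, by norm_num, next_next h⟩

theorem minimalPeriod_pos (b : G.Bd) : 0 < Function.minimalPeriod next b :=
  Function.minimalPeriod_pos_iff_mem_periodicPts.2 b.mem_periodicPts

theorem exists_iterate_symm {b b' : G.Bd} {k : ℕ} (h : next^[k] b = b') :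
    ∃ k', next^[k'] b' = b := by
  subst h
  set m := Function.minimalPeriod next b
  have hm : 0 < m := b.minimalPeriod_pos
  refine ⟨k * m - k, ?_⟩
  rw [← Function.iterate_add_apply, Nat.sub_add_cancel (Nat.le_mul_of_pos_right _ hm)]
  exact (Function.isPeriodicPt_minimalPeriod next b).const_mul k

theorem iterate_pos_eq_zero {b : G.Bd} (k : ℕ) : (next^[k] b).pos = 0 ↔ b.pos = 0 := by
  have key : ∀ (b : G.Bd) (k : ℕ), b.pos = 0 → (next^[k] b).pos = 0 := by
    intro b k h
    rw [eq_vertex h, iterate_vertex]; rfl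
  constructor
  · intro h
    obtain ⟨k', hk'⟩ := exists_iterate_symm (rfl : next^[k] b = _)
    have := key _ k' h
    rwa [hk'] at this
  · exact key b k

theorem side_next (b : G.Bd) : b.next.side = G.side (G.twin b.edge) := by
  unfold next side
  split_ifs
  · simp [G.side_succ]
  · rfl

theorem loc_next (b : G.Bd) :
    ∃ n : ℤ, b.next.loc = G.start (G.twin b.edge) + G.len b.edge - b.pos + n * G.L := by
  unfold next loc
  split_ifs with h
  · obtain ⟨n, hn⟩ := G.start_succ (G.twin b.edge)
    refine ⟨n, ?_⟩
    simp only [hn, h, G.len_twin]; ring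
  · exact ⟨0, by simp; ring⟩

variable (G) in
/-- `z` is one of the points of the boundary of the strip lying over `b`. -/
def Lift (b : G.Bd) (z : ℂ) : Prop := ∃ n : ℤ, z = G.emb b.side ((b.loc + n * G.L : ℝ) : ℂ)

theorem lift_self (b : G.Bd) : Lift G b (G.emb b.side (b.loc : ℂ)) := ⟨0, by simp⟩

theorem Lift.im {b : G.Bd} {z : ℂ} (h : Lift G b z) : z.im = if b.side then G.c.im else 0 := by
  obtain ⟨n, rfl⟩ := h
  cases b.side <;> simp [emb]

theorem Lift.mem_strip {b : G.Bd} {z : ℂ} (h : Lift G b z) : z ∈ G.strip := by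
  have := h.im
  have hc := G.c_pos
  cases hb : b.side <;> simp [hb] at this <;> constructor <;> linarith

theorem Lift.add {b : G.Bd} {z : ℂ} (h : Lift G b z) (n : ℤ) : Lift G b (z + n * G.L) := by
  obtain ⟨k, rfl⟩ := h
  cases hb : b.side
  · refine ⟨k + n, ?_⟩
    simp [emb, hb]; ring
  · refine ⟨k - n, ?_⟩
    simp [emb, hb]; ring

theorem Lift.exists_add {b : G.Bd} {z z' : ℂ} (h : Lift G b z) (h' : Lift G b z') :
    ∃ n : ℤ, z' = z + n * G.L := by
  obtain ⟨k, rfl⟩ := h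
  obtain ⟨k', rfl⟩ := h'
  cases hb : b.side
  · refine ⟨k' - k, ?_⟩
    simp [emb]; ring
  · refine ⟨k - k', ?_⟩
    simp [emb]; ring

/-- The height of `z` determines the side, because `0 < G.c.im`; the tiling by half-open edges then
determines the edge and the position. -/
theorem Lift.eq {b b' : G.Bd} {z : ℂ} (h : Lift G b z) (h' : Lift G b' z) : b = b' := by
  have hs : b.side = b'.side := by
    have h1 := h.im
    rw [h'.im] at h1
    have hc := G.c_pos
    cases hb : b.side <;> cases hb' : b'.side <;> simp [hb, hb'] at h1 <;> first | rfl | linarith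
  obtain ⟨k, rfl⟩ := h
  obtain ⟨k', h'⟩ := h'
  rw [hs] at h'
  have h2 : b.loc + k * G.L = b'.loc + k' * G.L := by
    exact_mod_cast emb_injective _ h'
  unfold loc at h2
  have := G.unique b.edge b'.edge (b.loc + k * G.L) (-k) (-k') hs
    (by simp [loc, b.nonneg]) (by simp [loc, b.lt])
    (by simp only [loc]; rw [h2]; push_cast; linarith [b'.nonneg])
    (by simp only [loc]; rw [h2]; push_cast; linarith [b'.lt])
  obtain ⟨he, hk⟩ := this
  have hk : k = k' := by simpa using hk
  apply Bd.ext he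
  rw [he, hk] at h2
  linarith

theorem exists_lift_emb (s : Bool) (x : ℝ) : ∃ b : G.Bd, b.side = s ∧ Lift G b (G.emb s (x : ℂ)) := by
  obtain ⟨e, n, hs, h1, h2⟩ := G.cover s x
  refine ⟨⟨e, x + n * G.L - G.start e, by linarith, by linarith⟩, hs, -n, ?_⟩
  simp [side, loc, hs]

theorem exists_lift {z : ℂ} (h : z.im = 0 ∨ z.im = G.c.im) : ∃ b : G.Bd, Lift G b z := by
  rcases h with h | h
  · obtain ⟨b, hs, hb⟩ := exists_lift_emb (G := G) false z.re
    refine ⟨b, ?_⟩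
    convert hb
    apply Complex.ext <;> simp [emb, h]
  · obtain ⟨b, hs, hb⟩ := exists_lift_emb (G := G) true (G.c.re - z.re)
    refine ⟨b, ?_⟩
    convert hb
    apply Complex.ext <;> simp [emb, h]

end Bd

open Bd

variable (G) in
/-- The identifications of points of the strip. -/
def Rel (z z' : ℂ) : Prop :=
  (∃ n : ℤ, z' = z + n * G.L) ∨ ∃ (b : G.Bd) (k : ℕ), Lift G b z ∧ Lift G (next^[k] b) z'

/-- Symmetry comes from the periodicity of `next`. Transitivity comes from `Lift.eq`: a point lies
over a single boundary point, so two orbit segments meeting there can be concatenated. -/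
theorem rel_equivalence : Equivalence (Rel G) where
  refl z := Or.inl ⟨0, by simp⟩
  symm := by
    rintro z z' (⟨n, rfl⟩ | ⟨b, k, h, h'⟩)
    · exact Or.inl ⟨-n, by simp⟩
    · obtain ⟨k', hk'⟩ := exists_iterate_symm (rfl : next^[k] b = _)
      exact Or.inr ⟨_, k', h', by rwa [hk']⟩
  trans := by
    rintro z z' z'' (⟨n, rfl⟩ | ⟨b, k, h, h'⟩) (⟨n', rfl⟩ | ⟨b', k', h2, h2'⟩)
    · exact Or.inl ⟨n + n', by push_cast; ring⟩
    · refine Or.inr ⟨b', k', ?_, h2'⟩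
      have := h2.add (-n)
      simpa using this
    · exact Or.inr ⟨b, k, h, h'.add n'⟩
    · refine Or.inr ⟨b, k' + k, h, ?_⟩
      rw [Function.iterate_add_apply, h'.eq h2]
      exact h2'

variable (G) in
/-- The identifications, extended to the plane by means of the retraction to the strip. -/
def setoid : Setoid ℂ where
  r z z' := Rel G (G.clamp z) (G.clamp z')
  iseqv := ⟨fun _ => rel_equivalence.refl _, fun h => rel_equivalence.symm h,
    fun h h' => rel_equivalence.trans h h'⟩

variable (G) in
/-- The glued surface. -/
def Surface : Type := Quotient G.setoid

instance : TopologicalSpace G.Surface := inferInstanceAs (TopologicalSpace (Quotient G.setoid))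

variable (G) in
/-- The projection of the plane to the glued surface. -/
def proj (z : ℂ) : G.Surface := Quotient.mk G.setoid z

theorem continuous_proj : Continuous G.proj := continuous_quot_mk

theorem isQuotientMap_proj : Topology.IsQuotientMap G.proj := isQuotientMap_quot_mk

theorem proj_clamp (z : ℂ) : G.proj (G.clamp z) = G.proj z := by
  apply Quotient.sound
  show Rel G _ _
  rw [clamp_of_mem (clamp_mem z)]
  exact rel_equivalence.refl _

theorem exists_proj (q : G.Surface) : ∃ z ∈ G.strip, G.proj z = q := by
  obtain ⟨z, rfl⟩ := Quotient.exists_rep q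
  exact ⟨G.clamp z, clamp_mem z, proj_clamp z⟩

theorem proj_eq_iff {z z' : ℂ} (h : z ∈ G.strip) (h' : z' ∈ G.strip) :
    G.proj z = G.proj z' ↔ Rel G z z' := by
  have : G.proj z = G.proj z' ↔ Rel G (G.clamp z) (G.clamp z') := Quotient.eq (r := G.setoid)
  rw [this, clamp_of_mem h, clamp_of_mem h']

theorem proj_add_int (z : ℂ) (n : ℤ) : G.proj (z + n * G.L) = G.proj z := by
  rw [← proj_clamp, ← proj_clamp z]
  have : G.clamp (z + n * G.L) = G.clamp z + n * G.L := by
    apply Complex.ext <;> simp [clamp]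
  rw [this]
  exact ((proj_eq_iff (clamp_mem z) ((strip_add_int n).2 (clamp_mem z))).2 (Or.inl ⟨n, rfl⟩)).symm

/-- The quotient is taken of the whole plane, but `clamp` is a continuous retraction that does not
change the class, so openness can be tested on the strip. -/
theorem isOpen_of_strip {V : Set G.Surface} {O : Set ℂ} (hO : IsOpen O)
    (h : ∀ z ∈ G.strip, G.proj z ∈ V ↔ z ∈ O) : IsOpen V := by
  rw [← isQuotientMap_proj.isOpen_preimage]
  have : G.proj ⁻¹' V = G.clamp ⁻¹' O := by
    ext z
    rw [Set.mem_preimage, Set.mem_preimage, ← h _ (clamp_mem z), proj_clamp]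
  rw [this]
  exact hO.preimage continuous_clamp

/-- The interior of the strip. -/
def interiorStrip (G : GluedCylinder) : Set ℂ := {z | 0 < z.im ∧ z.im < G.c.im}

theorem interiorStrip_subset : G.interiorStrip ⊆ G.strip := fun _ h => ⟨h.1.le, h.2.le⟩

theorem isOpen_interiorStrip : IsOpen G.interiorStrip :=
  (isOpen_lt continuous_const Complex.continuous_im).inter
    (isOpen_lt Complex.continuous_im continuous_const)

theorem Bd.Lift.notMem_interior {b : G.Bd} {z : ℂ} (h : Lift G b z) : z ∉ G.interiorStrip := by
  intro h'
  have := h.im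
  cases hb : b.side <;> simp [hb] at this
  · exact h'.1.ne' this
  · exact h'.2.ne this

theorem exists_lift_of_notMem {z : ℂ} (h : z ∈ G.strip) (h' : z ∉ G.interiorStrip) :
    ∃ b : G.Bd, Lift G b z := by
  apply exists_lift
  by_contra! hc
  exact h' ⟨lt_of_le_of_ne h.1 (Ne.symm hc.1), lt_of_le_of_ne h.2 hc.2⟩

theorem rel_of_interior {z z' : ℂ} (h : z ∈ G.interiorStrip) (hr : Rel G z z') :
    ∃ n : ℤ, z' = z + n * G.L := by
  rcases hr with hr | ⟨b, k, hb, _⟩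
  · exact hr
  · exact absurd h hb.notMem_interior

theorem rel_of_lift {b : G.Bd} {z z' : ℂ} (h : Lift G b z) (hr : Rel G z z') :
    ∃ k, Lift G (next^[k] b) z' := by
  rcases hr with ⟨n, rfl⟩ | ⟨b', k, hb, hb'⟩
  · exact ⟨0, h.add n⟩
  · exact ⟨k, by rwa [h.eq hb]⟩

end GluedCylinder

/-! ### Star-shaped neighbourhoods, separation and charts. -/

theorem exists_pos_le_of_finite {ι : Type*} [Finite ι] {f : ι → ℝ} (hf : ∀ i, 0 < f i) :
    ∃ ε > 0, ∀ i, ε ≤ f i := by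
  have h1 : ∀ᶠ ε in 𝓝[>] (0 : ℝ), ∀ i, ε ≤ f i :=
    Filter.eventually_all.2 fun i => eventually_nhdsWithin_of_eventually_nhds
      (eventually_le_nhds (hf i))
  obtain ⟨ε, h, h'⟩ := (h1.and self_mem_nhdsWithin).exists
  exact ⟨ε, h', h⟩

/-- The lattice of integer multiples of `L` is closed, being the set where `exp (2π I z / L)` equals
`1`. -/
theorem exists_pos_le_norm_sub_int_mul {L : ℝ} (hL : 0 < L) {z : ℂ} (h : ∀ n : ℤ, z ≠ n * L) :
    ∃ ε > 0, ∀ n : ℤ, ε ≤ ‖z - n * L‖ := by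
  have hLc : (L : ℂ) ≠ 0 := by exact_mod_cast hL.ne'
  have hpi : (2 * Real.pi * Complex.I : ℂ) ≠ 0 := by simp [Real.pi_ne_zero]
  set f : ℂ → ℂ := fun z => Complex.exp (z / L * (2 * Real.pi * Complex.I)) with hf
  have hc : IsClosed {z : ℂ | f z = 1} := isClosed_eq (by fun_prop) continuous_const
  have hz : z ∈ {z : ℂ | f z = 1}ᶜ := by
    intro hz
    obtain ⟨n, hn⟩ := Complex.exp_eq_one_iff.1 (show f z = 1 from hz)
    have := mul_right_cancel₀ hpi hn
    rw [div_eq_iff hLc] at this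
    exact h n this
  obtain ⟨ε, hε, hb⟩ := Metric.isOpen_iff.1 hc.isOpen_compl z hz
  refine ⟨ε, hε, fun n => ?_⟩
  by_contra! hlt
  have : ((n : ℂ) * L) ∈ Metric.ball z ε := by
    rw [Metric.mem_ball, dist_comm, dist_eq_norm]; exact hlt
  apply hb this
  show Complex.exp _ = 1
  rw [mul_div_cancel_right₀ _ hLc, Complex.exp_eq_one_iff]
  exact ⟨n, rfl⟩

namespace GluedCylinder

variable (G : GluedCylinder)

/-- A star-shaped neighbourhood of a point of the glued surface: the union of finitely many
discs or half-discs, with a coordinate function. -/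
structure Star where
  m : ℕ
  s : Fin m → Bool
  x : Fin m → ℂ
  rot : Fin m → ℂ
  ρ : ℝ
  R : ℝ
  g : ℂ → ℂ
  coef : ℂ → ℂ
  base : Fin m
  ord : ℤ
  ρ_pos : 0 < ρ
  center_mem : ∀ j, x j ∈ G.strip
  center_proj : ∀ j, G.proj (G.emb (s j) (x j)) = G.proj (G.emb (s base) (x base))
  -- Saturation: a point of the strip glued to a point of a piece is, up to a period, in a piece at
  -- the same distance from its centre. This yields openness of the smaller stars.
  sat : ∀ j w, ‖w‖ ≤ ρ → x j + w ∈ G.strip → ∀ z ∈ G.strip,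
    G.proj z = G.proj (G.emb (s j) (x j + w)) →
    ∃ k w', ∃ n : ℤ, x k + w' ∈ G.strip ∧ ‖w'‖ = ‖w‖ ∧ z = G.emb (s k) (x k + w') + n * G.L
  -- The coordinate `rot j * g w` separates exactly the points of the surface.
  key : ∀ j w k w', ‖w‖ ≤ ρ → x j + w ∈ G.strip → ‖w'‖ ≤ ρ → x k + w' ∈ G.strip →
    (G.proj (G.emb (s j) (x j + w)) = G.proj (G.emb (s k) (x k + w')) ↔
      rot j * g w = rot k * g w')
  g_cont : ∀ j w, ‖w‖ ≤ ρ → x j + w ∈ G.strip → ContinuousAt g w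
  g_norm : ∀ j w, ‖w‖ ≤ ρ → x j + w ∈ G.strip → (‖rot j * g w‖ < R ↔ ‖w‖ < ρ)
  g_zero : g 0 = 0
  surj : ∀ u, ‖u‖ < R → ∃ j w, ‖w‖ ≤ ρ ∧ x j + w ∈ G.strip ∧ rot j * g w = u
  rot_ne : ∀ j, rot j ≠ 0
  analytic : ∀ j w, ‖w‖ ≤ ρ → x j + w ∈ G.strip → (w ≠ 0 ∨ x j + w ∈ G.interiorStrip) →
    AnalyticAt ℂ g w ∧ deriv g w ≠ 0
  coef_eq : ∀ j w, ‖w‖ ≤ ρ → x j + w ∈ G.interiorStrip →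
    coef (rot j * g w) * (rot j * deriv g w) ^ 2 = 1
  coef_mero : ∀ u, MeromorphicAt coef u
  coef_ord : meromorphicOrderAt coef 0 = (ord : WithTop ℤ)
  -- Only the centre of a star can be a vertex.
  nonvertex : ∀ j w, ‖w‖ ≤ ρ → x j + w ∈ G.strip → w ≠ 0 → ∀ b : G.Bd,
    b.Lift G (G.emb (s j) (x j + w)) → b.pos ≠ 0

namespace Star

variable {G} (S : G.Star)

/-- The centre of a star. -/
def center : G.Surface := G.proj (G.emb (S.s S.base) (S.x S.base))

/-- The star of radius `ε`. -/
def nb (ε : ℝ) : Set G.Surface :=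
  {q | ∃ j w, ‖w‖ < ε ∧ S.x j + w ∈ G.strip ∧ G.proj (G.emb (S.s j) (S.x j + w)) = q}

theorem norm_emb_sub (s : Bool) (x w : ℂ) : ‖G.emb s (x + w) - G.emb s x‖ = ‖w‖ := by
  rw [emb_add]
  cases s <;> simp

/-- Inside the strip, the preimage of a star is the union of the discs of radius `ε` about all
translates of its corner points; openness is then immediate. -/
theorem proj_mem_nb {ε : ℝ} (hε : ε ≤ S.ρ) {z : ℂ} (hz : z ∈ G.strip) :
    G.proj z ∈ S.nb ε ↔ ∃ j, ∃ n : ℤ, ‖z - (G.emb (S.s j) (S.x j) + n * G.L)‖ < ε := by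
  constructor
  · rintro ⟨j, w, hw, hw', h⟩
    obtain ⟨k, w', n, h1, h2, rfl⟩ := S.sat j w (hw.le.trans hε) hw' z hz h.symm
    refine ⟨k, n, ?_⟩
    rw [add_sub_add_right_eq_sub, norm_emb_sub, h2]
    exact hw
  · rintro ⟨j, n, h⟩
    have e : S.x j + (G.emb (S.s j) (z - n * G.L) - S.x j) = G.emb (S.s j) (z - n * G.L) := by ring
    refine ⟨j, G.emb (S.s j) (z - n * G.L) - S.x j, ?_, ?_, ?_⟩
    · rw [← norm_emb_sub (G := G) (S.s j) (S.x j), e, emb_emb]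
      convert h using 2
      ring
    · rw [e, emb_mem_strip]
      have := (strip_add_int (G := G) (z := z) (-n)).2 hz
      simpa [sub_eq_add_neg] using this
    · rw [e, emb_emb]
      have := proj_add_int (G := G) z (-n)
      simpa [sub_eq_add_neg] using this

theorem isOpen_nb {ε : ℝ} (hε : ε ≤ S.ρ) : IsOpen (S.nb ε) := by
  refine isOpen_of_strip (O := {z | ∃ j, ∃ n : ℤ, ‖z - (G.emb (S.s j) (S.x j) + n * G.L)‖ < ε}) ?_
    fun z hz => S.proj_mem_nb hε hz
  simp only [Set.ofPred_exists]
  exact isOpen_iUnion fun j => isOpen_iUnion fun n => isOpen_lt (by fun_prop) continuous_const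

theorem center_mem_nb {ε : ℝ} (hε : 0 < ε) : S.center ∈ S.nb ε :=
  ⟨S.base, 0, by simpa using hε, by simpa using S.center_mem _, by simp [center]⟩

end Star

variable {G}

/-- Two distinct points have finitely many corners modulo `L`, and none of one coincides with one of
the other. The distances between them have a positive lower bound `ε`, and stars of radius at most
`ε / 2` are disjoint. -/
theorem t2Space_of_star (h : ∀ q : G.Surface, ∃ S : G.Star, S.center = q) :
    T2Space G.Surface := by
  refine ⟨fun q q' hq => ?_⟩
  obtain ⟨S, rfl⟩ := h q
  obtain ⟨S', rfl⟩ := h q'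
  have h1 : ∀ jk : Fin S.m × Fin S'.m, ∃ ε > 0, ∀ n : ℤ,
      ε ≤ ‖G.emb (S.s jk.1) (S.x jk.1) - G.emb (S'.s jk.2) (S'.x jk.2) - n * G.L‖ := by
    rintro ⟨j, k⟩
    apply exists_pos_le_norm_sub_int_mul G.L_pos
    intro n hn
    apply hq
    unfold Star.center
    rw [← S.center_proj j, ← S'.center_proj k, ← proj_add_int (G.emb (S'.s k) (S'.x k)) n]
    congr 1
    rw [← hn]; ring
  choose f hf hf' using h1
  obtain ⟨ε, hε, hεf⟩ := exists_pos_le_of_finite hf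
  set δ := min (min S.ρ S'.ρ) (ε / 2) with hδ
  have hδ0 : 0 < δ := lt_min (lt_min S.ρ_pos S'.ρ_pos) (half_pos hε)
  have hδS : δ ≤ S.ρ := (min_le_left _ _).trans (min_le_left _ _)
  have hδS' : δ ≤ S'.ρ := (min_le_left _ _).trans (min_le_right _ _)
  have hδε : δ ≤ ε / 2 := min_le_right _ _
  refine ⟨S.nb δ, S'.nb δ, S.isOpen_nb hδS, S'.isOpen_nb hδS', S.center_mem_nb hδ0,
    S'.center_mem_nb hδ0, Set.disjoint_left.2 fun p hp hp' => ?_⟩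
  obtain ⟨z, hz, rfl⟩ := exists_proj p
  obtain ⟨j, n, hn⟩ := (S.proj_mem_nb hδS hz).1 hp
  obtain ⟨k, n', hn'⟩ := (S'.proj_mem_nb hδS' hz).1 hp'
  have h2 := (hεf (j, k)).trans (hf' (j, k) (n' - n))
  have h3 : G.emb (S.s j) (S.x j) - G.emb (S'.s k) (S'.x k) - ((n' - n : ℤ) : ℂ) * G.L =
      (z - (G.emb (S'.s k) (S'.x k) + n' * G.L)) - (z - (G.emb (S.s j) (S.x j) + n * G.L)) := by
    push_cast; ring
  simp only at h2
  rw [h3] at h2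
  have h4 := norm_sub_le (z - (G.emb (S'.s k) (S'.x k) + n' * G.L))
    (z - (G.emb (S.s j) (S.x j) + n * G.L))
  linarith

namespace Star

variable (S : G.Star)

/-- The disjoint union `K` of the closed pieces is compact, and by `key` the projection and the
coordinate have the same fibres on it. -/
theorem exists_chart [T2Space G.Surface] : ∃ e : OpenPartialHomeomorph G.Surface ℂ,
    e.source = S.nb S.ρ ∧ e.target = Metric.ball 0 S.R ∧
    ∀ j w, ‖w‖ < S.ρ → S.x j + w ∈ G.strip →
      e (G.proj (G.emb (S.s j) (S.x j + w))) = S.rot j * S.g w := by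
  set K : Set (Fin S.m × ℂ) := {y | ‖y.2‖ ≤ S.ρ ∧ S.x y.1 + y.2 ∈ G.strip} with hK
  set Φ : Fin S.m × ℂ → ℂ := fun y => S.rot y.1 * S.g y.2 with hΦ
  set Ψ : Fin S.m × ℂ → G.Surface := fun y => G.proj (G.emb (S.s y.1) (S.x y.1 + y.2)) with hΨ
  have hfst : ∀ f : Fin S.m → ℂ, Continuous fun y : Fin S.m × ℂ => f y.1 := fun f =>
    (continuous_of_discreteTopology (f := f)).comp continuous_fst
  have hKc : IsCompact K := by
    have h1 : IsCompact ((Set.univ : Set (Fin S.m)) ×ˢ Metric.closedBall (0 : ℂ) S.ρ) :=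
      isCompact_univ.prod (isCompact_closedBall _ _)
    have h2 : IsClosed {y : Fin S.m × ℂ | S.x y.1 + y.2 ∈ G.strip} :=
      isClosed_strip.preimage ((hfst S.x).add continuous_snd)
    convert h1.inter_right h2 using 1
    ext y
    simp [hK]
  have hΦc : ContinuousOn Φ K := by
    intro y hy
    apply ContinuousAt.continuousWithinAt
    exact (hfst S.rot).continuousAt.mul
      (ContinuousAt.comp (S.g_cont y.1 y.2 hy.1 hy.2) continuousAt_snd)
  have hΨc : Continuous Ψ := by
    apply continuous_proj.comp
    rw [continuous_iff_continuousAt]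
    rintro ⟨j, w⟩
    have : (fun y : Fin S.m × ℂ => G.emb (S.s y.1) (S.x y.1 + y.2)) =ᶠ[𝓝 (j, w)]
        fun y => G.emb (S.s j) (S.x j + y.2) := by
      have : ∀ᶠ y : Fin S.m × ℂ in 𝓝 (j, w), y.1 = j := by
        have h : Filter.Tendsto Prod.fst (𝓝 (j, w)) (𝓝 j) := continuousAt_fst
        rw [nhds_discrete (Fin S.m)] at h
        exact h.eventually (p := fun i => i = j) (Filter.eventually_pure.2 rfl)
      filter_upwards [this] with y hy
      rw [hy]
    refine ContinuousAt.congr ?_ this.symm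
    exact ((continuous_emb _).comp (continuous_const.add continuous_snd)).continuousAt
  have himg : Ψ '' (K ∩ Φ ⁻¹' Metric.ball 0 S.R) = S.nb S.ρ := by
    ext q
    constructor
    · rintro ⟨⟨j, w⟩, ⟨hw, hw'⟩, rfl⟩
      refine ⟨j, w, ?_, hw.2, rfl⟩
      rw [← S.g_norm j w hw.1 hw.2]
      simpa [hΦ] using hw'
    · rintro ⟨j, w, hw, hw', rfl⟩
      refine ⟨(j, w), ⟨⟨hw.le, hw'⟩, ?_⟩, rfl⟩
      have := (S.g_norm j w hw.le hw').2 hw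
      simpa [hΦ] using this
  have : Nonempty (Fin S.m × ℂ) := ⟨(S.base, 0)⟩
  obtain ⟨e, h1, h2, h3⟩ := exists_openPartialHomeomorph hKc hΦc hΨc.continuousOn
    (fun y hy y' hy' => S.key _ _ _ _ hy.1 hy.2 hy'.1 hy'.2) (Metric.isOpen_ball : IsOpen (Metric.ball (0 : ℂ) S.R))
    (by
      intro u hu
      obtain ⟨j, w, hw, hw', rfl⟩ := S.surj u (by simpa using hu)
      exact ⟨(j, w), ⟨hw, hw'⟩, rfl⟩)
    (by rw [himg]; exact S.isOpen_nb le_rfl)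
  refine ⟨e, by rw [h1, himg], h2, fun j w hw hw' => h3 (j, w) ⟨hw.le, hw'⟩ ?_⟩
  simpa [hΦ] using (S.g_norm j w hw.le hw').2 hw

variable [T2Space G.Surface]

/-- The chart of a star. -/
noncomputable def chart : OpenPartialHomeomorph G.Surface ℂ := S.exists_chart.choose

theorem chart_source : S.chart.source = S.nb S.ρ := S.exists_chart.choose_spec.1

theorem chart_proj {j : Fin S.m} {w : ℂ} (hw : ‖w‖ < S.ρ) (h : S.x j + w ∈ G.strip) :
    S.chart (G.proj (G.emb (S.s j) (S.x j + w))) = S.rot j * S.g w :=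
  S.exists_chart.choose_spec.2.2 j w hw h

theorem center_mem_source : S.center ∈ S.chart.source := by
  rw [chart_source]; exact S.center_mem_nb S.ρ_pos

theorem chart_center : S.chart S.center = 0 := by
  have := S.chart_proj (j := S.base) (w := 0) (by simpa using S.ρ_pos)
    (by simpa using S.center_mem _)
  simpa [S.g_zero, center] using this

theorem chart_symm_zero : S.chart.symm 0 = S.center := by
  rw [← S.chart_center, S.chart.left_inv S.center_mem_source]

theorem exists_coord {z : ℂ} (hz : z ∈ G.strip) (hs : G.proj z ∈ S.chart.source) :
    ∃ j, ∃ n : ℤ, ‖G.emb (S.s j) (z - n * G.L) - S.x j‖ < S.ρ ∧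
      G.emb (S.s j) (z - n * G.L) ∈ G.strip ∧
      S.chart (G.proj z) = S.rot j * S.g (G.emb (S.s j) (z - n * G.L) - S.x j) := by
  rw [chart_source, proj_mem_nb S le_rfl hz] at hs
  obtain ⟨j, n, h⟩ := hs
  have e : S.x j + (G.emb (S.s j) (z - n * G.L) - S.x j) = G.emb (S.s j) (z - n * G.L) := by ring
  have h1 : ‖G.emb (S.s j) (z - n * G.L) - S.x j‖ < S.ρ := by
    rw [← norm_emb_sub (G := G) (S.s j) (S.x j), e, emb_emb]
    convert h using 2
    ring
  have h2 : G.emb (S.s j) (z - n * G.L) ∈ G.strip := by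
    rw [emb_mem_strip]
    have := (strip_add_int (G := G) (z := z) (-n)).2 hz
    simpa [sub_eq_add_neg] using this
  refine ⟨j, n, h1, h2, ?_⟩
  rw [← S.chart_proj h1 (by rwa [e]), e, emb_emb]
  congr 1
  have := proj_add_int (G := G) z (-n)
  simpa [sub_eq_add_neg] using this.symm

/-- In the strip, the chart of a star extends analytically across the boundary. -/
theorem exists_analytic {z : ℂ} (hz : z ∈ G.strip) (hs : G.proj z ∈ S.chart.source)
    (h0 : S.chart (G.proj z) ≠ 0 ∨ z ∈ G.interiorStrip) :
    ∃ k : ℂ → ℂ, AnalyticAt ℂ k z ∧ deriv k z ≠ 0 ∧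
      (∀ᶠ z' in 𝓝 z, z' ∈ G.strip → S.chart (G.proj z') = k z') ∧
      (z ∈ G.interiorStrip → S.coef (S.chart (G.proj z)) * deriv k z ^ 2 = 1) := by
  obtain ⟨j, n, h1, h2, h3⟩ := S.exists_coord hz hs
  set A : ℂ → ℂ := fun z => G.emb (S.s j) (z - n * G.L) - S.x j with hA
  have e : ∀ z, S.x j + A z = G.emb (S.s j) (z - n * G.L) := fun z => by simp [hA]
  -- The passage to the half-plane coordinate has derivative `1` or `-1`; the quadratic differential
  -- does not see the sign.
  have hA' : ∃ σ : ℂ, σ ^ 2 = 1 ∧ ∀ z, HasDerivAt A σ z := by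
    cases hsj : S.s j
    · refine ⟨1, by norm_num, fun z => ?_⟩
      simp only [hA, hsj, emb]
      simpa using ((hasDerivAt_id z).sub_const (n * G.L : ℂ)).sub_const (S.x j)
    · refine ⟨-1, by norm_num, fun z => ?_⟩
      simp only [hA, hsj, emb]
      simpa using (((hasDerivAt_id z).sub_const (n * G.L : ℂ)).const_sub G.c).sub_const (S.x j)
  obtain ⟨σ, hσ, hAd⟩ := hA'
  have hAdiff : Differentiable ℂ A := fun z => (hAd z).differentiableAt
  have hint : z ∈ G.interiorStrip → S.x j + A z ∈ G.interiorStrip := by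
    intro hzi
    rw [e]
    cases S.s j
    · simpa [emb, interiorStrip] using hzi
    · simp only [emb, interiorStrip, if_true, Set.mem_ofPred_eq] at hzi ⊢
      simp; constructor <;> linarith [hzi.1, hzi.2]
  have hcond : A z ≠ 0 ∨ S.x j + A z ∈ G.interiorStrip := by
    rcases h0 with h0 | h0
    · left
      intro h
      apply h0
      rw [h3]
      change S.rot j * S.g (A z) = 0
      rw [h, S.g_zero, mul_zero]
    · exact Or.inr (hint h0)
  obtain ⟨ha, hd⟩ := S.analytic j (A z) h1.le (by rw [e]; exact h2) hcond
  have hk : HasDerivAt (fun z => S.rot j * S.g (A z)) (S.rot j * (deriv S.g (A z) * σ)) z :=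
    (HasDerivAt.comp z ha.differentiableAt.hasDerivAt (hAd z)).const_mul _
  have hσ0 : σ ≠ 0 := by rintro rfl; norm_num at hσ
  refine ⟨fun z => S.rot j * S.g (A z), ?_, ?_, ?_, ?_⟩
  · exact analyticAt_const.mul (ha.comp (hAdiff.analyticAt z))
  · rw [hk.deriv]
    exact mul_ne_zero (S.rot_ne j) (mul_ne_zero hd hσ0)
  · have : ∀ᶠ z' in 𝓝 z, ‖A z'‖ < S.ρ :=
      (hAdiff.continuous.norm.continuousAt).eventually (gt_mem_nhds h1)
    filter_upwards [this] with z' hz' hz's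
    have h2' : G.emb (S.s j) (z' - n * G.L) ∈ G.strip := by
      rw [emb_mem_strip]
      have := (strip_add_int (G := G) (z := z') (-n)).2 hz's
      simpa [sub_eq_add_neg] using this
    rw [← S.chart_proj hz' (by rwa [e]), e, emb_emb]
    congr 1
    have := proj_add_int (G := G) z' (-n)
    simpa [sub_eq_add_neg] using this.symm
  · intro hzi
    have := S.coef_eq j (A z) h1.le (hint hzi)
    rw [hk.deriv, h3]
    change S.coef (S.rot j * S.g (A z)) * _ = 1
    rw [← this]
    linear_combination S.coef (S.rot j * S.g (A z)) * (S.rot j * deriv S.g (A z)) ^ 2 * hσ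

theorem chart_vertex {b : G.Bd} {z : ℂ} (hb : b.Lift G z) (h0 : b.pos = 0)
    (hs : G.proj z ∈ S.chart.source) : S.chart (G.proj z) = 0 := by
  obtain ⟨j, n, h1, h2, h3⟩ := S.exists_coord hb.mem_strip hs
  have e : S.x j + (G.emb (S.s j) (z - n * G.L) - S.x j) = G.emb (S.s j) (z - n * G.L) := by ring
  by_cases hw : G.emb (S.s j) (z - n * G.L) - S.x j = 0
  · rw [h3, hw, S.g_zero, mul_zero]
  · refine absurd h0 (S.nonvertex j _ h1.le (by rwa [e]) hw b ?_)
    rw [e, emb_emb]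
    have := hb.add (-n)
    simpa [sub_eq_add_neg] using this

end Star

end GluedCylinder

/-! ### Construction of a star at every point. -/

theorem meromorphicOrderAt_const_mul_zpow {a : ℂ} (ha : a ≠ 0) (n : ℤ) :
    meromorphicOrderAt (fun u : ℂ => a * u ^ n) 0 = (n : WithTop ℤ) := by
  have hm : MeromorphicAt (fun u : ℂ => a * u ^ n) 0 :=
    (MeromorphicAt.const a 0).mul ((MeromorphicAt.id 0).zpow n)
  rw [meromorphicOrderAt_eq_int_iff hm]
  refine ⟨fun _ => a, analyticAt_const, ha, Filter.Eventually.of_forall fun u => ?_⟩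
  simp [mul_comm]

namespace GluedCylinder

variable {G : GluedCylinder}

open Bd

/-- The radius is less than the distance to both boundary lines and less than half the
circumference, so the disc embeds in the surface; its coordinate is `w` and its coefficient is `1`.
-/
theorem exists_interior_star {z₀ : ℂ} (hz : z₀ ∈ G.interiorStrip) :
    ∃ S : G.Star, S.center = G.proj z₀ ∧ S.ord = 0 := by
  have hL := G.L_pos
  obtain ⟨ρ, hρ, h1, h2, h3⟩ : ∃ ρ > 0, ρ < z₀.im ∧ ρ < G.c.im - z₀.im ∧ 2 * ρ < G.L := by
    have hz1 := hz.1
    have hz2 := sub_pos.2 hz.2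
    refine ⟨min (min z₀.im (G.c.im - z₀.im)) G.L / 3, ?_, ?_, ?_, ?_⟩
    · have := lt_min (lt_min hz1 hz2) hL
      linarith
    · have : min (min z₀.im (G.c.im - z₀.im)) G.L ≤ z₀.im :=
        (min_le_left _ _).trans (min_le_left _ _)
      linarith
    · have : min (min z₀.im (G.c.im - z₀.im)) G.L ≤ G.c.im - z₀.im :=
        (min_le_left _ _).trans (min_le_right _ _)
      linarith
    · have : min (min z₀.im (G.c.im - z₀.im)) G.L ≤ G.L := min_le_right _ _
      linarith
  have hint : ∀ w : ℂ, ‖w‖ ≤ ρ → z₀ + w ∈ G.interiorStrip := by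
    intro w hw
    have := abs_le.1 ((Complex.abs_im_le_norm w).trans hw)
    constructor <;> simp only [Complex.add_im] <;> linarith [this.1, this.2]
  have hstrip : ∀ w : ℂ, ‖w‖ ≤ ρ → z₀ + w ∈ G.strip := fun w hw => interiorStrip_subset (hint w hw)
  refine ⟨{
    m := 1
    s := fun _ => false
    x := fun _ => z₀
    rot := fun _ => 1
    ρ := ρ
    R := ρ
    g := fun w => w
    coef := fun u => 1 * u ^ (0 : ℤ)
    base := 0
    ord := 0
    ρ_pos := hρ
    center_mem := fun _ => interiorStrip_subset hz
    center_proj := fun _ => rfl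
    sat := ?_
    key := ?_
    g_cont := fun _ _ _ _ => continuousAt_id
    g_norm := fun _ _ _ _ => by simp
    g_zero := rfl
    surj := fun u hu => ⟨0, u, hu.le, hstrip u hu.le, one_mul u⟩
    rot_ne := fun _ => one_ne_zero
    analytic := fun _ _ _ _ _ => ⟨analyticAt_id, by simp⟩
    coef_eq := fun _ _ _ _ => by simp
    coef_mero := fun u => (MeromorphicAt.const 1 u).mul ((MeromorphicAt.id u).zpow 0)
    coef_ord := meromorphicOrderAt_const_mul_zpow one_ne_zero 0
    nonvertex := fun _ w hw _ _ b hb => absurd (hint w hw) hb.notMem_interior }, rfl, rfl⟩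
  · intro _ w hw _ z hzs h
    obtain ⟨n, hn⟩ := rel_of_interior (hint w hw) ((proj_eq_iff (hstrip w hw) hzs).1 h.symm)
    exact ⟨0, w, n, hstrip w hw, rfl, hn⟩
  · intro _ w _ w' hw _ hw' _
    simp only [emb, one_mul, Bool.false_eq_true, if_false]
    refine ⟨fun h => ?_, fun h => by rw [h]⟩
    obtain ⟨n, hn⟩ := rel_of_interior (hint w hw) ((proj_eq_iff (hstrip w hw) (hstrip w' hw')).1 h)
    have h4 : w' - w = n * G.L := by linear_combination hn
    have h5 : ‖w' - w‖ ≤ 2 * ρ := (norm_sub_le _ _).trans (by linarith)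
    rw [h4, norm_mul, Complex.norm_intCast, Complex.norm_real, Real.norm_of_nonneg hL.le] at h5
    have h6 : |(n : ℝ)| < 1 := by
      by_contra! hc
      nlinarith
    have h7 : n = 0 := by
      have : |n| < 1 := by exact_mod_cast h6
      exact Int.abs_lt_one_iff.1 this
    rw [h7] at h4
    simp at h4
    exact (sub_eq_zero.1 h4).symm

namespace Bd

theorem lift_right (c : G.Bd) {t : ℝ} (ht : 0 ≤ t) (ht' : t < c.room) :
    Lift G (c.right t ht ht') (G.emb c.side ((c.loc : ℂ) + t)) := by
  refine ⟨0, ?_⟩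
  simp [right, loc, Bd.side]
  congr 1; ring

theorem right_pos_ne (c : G.Bd) {t : ℝ} (ht : 0 < t) (ht' : t < c.room) :
    (c.right t ht.le ht').pos ≠ 0 := by
  have := c.nonneg
  simp only [right]
  linarith

/-- This is the geometric content of `next`: the point at distance `t` to the right of `c` is glued
to the point at distance `t` to the left of `c.next`. -/
theorem lift_left (c : G.Bd) {t : ℝ} (ht : 0 < t) (ht' : t < c.room) :
    Lift G (c.right t ht.le ht').next (G.emb c.next.side ((c.next.loc : ℂ) - t)) := by
  obtain ⟨n, hn⟩ := c.loc_next
  have h1 := next_of_pos_ne (c.right_pos_ne ht ht')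
  refine ⟨n, ?_⟩
  have hs : (c.right t ht.le ht').next.side = c.next.side := by
    rw [side_next, side_next]; rfl
  rw [hs, hn]
  unfold loc
  rw [h1.1, h1.2]
  congr 1
  simp only [right]
  push_cast; ring

end Bd

section boundary

variable (b : G.Bd) (ρ : ℝ)

/-- The `j`-th corner at a boundary point. -/
noncomputable def corner (j : ℕ) : G.Bd := next^[j] b

theorem corner_succ (j : ℕ) : corner b (j + 1) = (corner b j).next :=
  Function.iterate_succ_apply' _ _ _

theorem corner_add (j i : ℕ) : next^[i] (corner b j) = corner b (j + i) := by
  rw [corner, corner, ← Function.iterate_add_apply, add_comm]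

theorem corner_mod (j : ℕ) : corner b (j % Function.minimalPeriod next b) = corner b j :=
  Function.iterate_mod_minimalPeriod_eq

theorem corner_eq_iff (j k : ℕ) :
    corner b j = corner b k ↔ j ≡ k [MOD Function.minimalPeriod next b] := by
  have hm := b.minimalPeriod_pos
  rw [← corner_mod b j, ← corner_mod b k, corner, corner,
    Function.iterate_eq_iterate_iff_of_lt_minimalPeriod (Nat.mod_lt _ hm) (Nat.mod_lt _ hm)]
  rfl

theorem corner_pos_eq_zero (j : ℕ) : (corner b j).pos = 0 ↔ b.pos = 0 := iterate_pos_eq_zero j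

/-- Vertices have position `0`, so the edge determines them. Otherwise the orbit consists of `b` and
`b.next`, which lie on the distinct edges `b.edge` and its twin. -/
theorem corner_eq_of_edge_eq (j k : ℕ) (h : (corner b j).edge = (corner b k).edge) :
    corner b j = corner b k := by
  by_cases hb : b.pos = 0
  · exact Bd.ext h (((corner_pos_eq_zero b j).2 hb).trans ((corner_pos_eq_zero b k).2 hb).symm)
  · have key : ∀ j, corner b j = b ∨ corner b j = b.next := by
      intro j
      induction j with
      | zero => exact Or.inl rfl
      | succ j ih =>
        rw [corner_succ]
        rcases ih with ih | ih <;> rw [ih]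
        · exact Or.inr rfl
        · exact Or.inl (next_next hb)
    have h1 := (next_of_pos_ne hb).1
    have h2 := G.twin_ne b.edge
    rcases key j with hj | hj <;> rcases key k with hk | hk <;> rw [hj, hk] at h ⊢
    · exact absurd (h.trans h1).symm h2
    · exact absurd (h1.symm.trans h) h2

variable {b ρ}

/-- Moving the left one of the two corners to the right by at most `2 * ρ` does not leave its edge;
the other corner thus lies on that edge, and corners are determined by their edges. -/
theorem corner_separated (hρ : ∀ j, 2 * ρ < (corner b j).room) {j k : ℕ} {d : ℝ} {n : ℤ}
    (hs : (corner b j).side = (corner b k).side)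
    (h : (corner b k).loc + n * G.L = (corner b j).loc + d) (hd : |d| ≤ 2 * ρ) :
    corner b j = corner b k ∧ d = 0 := by
  have key : ∀ (j k : ℕ) (d : ℝ) (n : ℤ), (corner b j).side = (corner b k).side →
      (corner b k).loc + n * G.L = (corner b j).loc + d → 0 ≤ d → d ≤ 2 * ρ →
      corner b j = corner b k ∧ d = 0 := by
    intro j k d n hs h h0 hd
    have h1 := lift_right (corner b j) h0 (hd.trans_lt (hρ j))
    have h2 : Lift G (corner b k) (G.emb (corner b j).side (((corner b j).loc : ℂ) + d)) := by
      refine ⟨n, ?_⟩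
      rw [hs, h]; push_cast; rfl
    have h3 := h1.eq h2
    have h4 := corner_eq_of_edge_eq b j k (by rw [← h3]; rfl)
    refine ⟨h4, ?_⟩
    have := congrArg Bd.pos h3
    rw [← h4] at this
    simpa [right] using this
  rcases le_total 0 d with h0 | h0
  · exact key j k d n hs h h0 ((le_abs_self d).trans hd)
  · have := key k j (-d) (-n) hs.symm (by push_cast; linarith) (by linarith)
      ((neg_le_abs d).trans hd)
    exact ⟨this.1.symm, by linarith [this.2]⟩

theorem loc_add_mem_strip (hρ' : 2 * ρ < G.c.im) {j : ℕ} {w : ℂ} (hw : ‖w‖ ≤ ρ) :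
    ((corner b j).loc : ℂ) + w ∈ G.strip ↔ 0 ≤ w.im := by
  have := abs_le.1 ((Complex.abs_im_le_norm w).trans hw)
  have h0 := (norm_nonneg w).trans hw
  simp only [strip, Set.mem_ofPred_eq, Complex.add_im, Complex.ofReal_im, zero_add]
  exact ⟨fun h => h.1, fun h => ⟨h, by linarith [this.2]⟩⟩

theorem loc_add_mem_interior (hρ' : 2 * ρ < G.c.im) {j : ℕ} {w : ℂ} (hw : ‖w‖ ≤ ρ) :
    ((corner b j).loc : ℂ) + w ∈ G.interiorStrip ↔ 0 < w.im := by
  have := abs_le.1 ((Complex.abs_im_le_norm w).trans hw)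
  have h0 := (norm_nonneg w).trans hw
  simp only [interiorStrip, Set.mem_ofPred_eq, Complex.add_im, Complex.ofReal_im, zero_add]
  exact ⟨fun h => h.1, fun h => ⟨h, by linarith [this.2]⟩⟩

/-- Half-discs at distinct corners are disjoint even modulo `L`. The bound `2 * ρ < G.c.im`
separates the two boundary circles, and `corner_separated` separates corners on the same one. -/
theorem emb_corner_eq (hρ : ∀ j, 2 * ρ < (corner b j).room) (hρ' : 2 * ρ < G.c.im) {j k : ℕ}
    {w w' : ℂ} (hw : ‖w‖ ≤ ρ) (hw' : ‖w'‖ ≤ ρ) (n : ℤ)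
    (h : G.emb (corner b j).side ((corner b j).loc + w) =
      G.emb (corner b k).side ((corner b k).loc + w') + n * G.L) :
    corner b j = corner b k ∧ w = w' := by
  have h1 := abs_le.1 ((Complex.abs_im_le_norm w).trans hw)
  have h2 := abs_le.1 ((Complex.abs_im_le_norm w').trans hw')
  have hs : (corner b j).side = (corner b k).side := by
    have := congrArg Complex.im h
    cases hj : (corner b j).side <;> cases hk : (corner b k).side <;>
      simp [hj, hk, emb] at this ⊢ <;> linarith [h1.1, h1.2, h2.1, h2.2]
  obtain ⟨n', hn'⟩ : ∃ n' : ℤ, ((corner b j).loc : ℂ) + w = (corner b k).loc + w' + n' * G.L := by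
    rw [hs] at h
    cases hk : (corner b k).side
    · exact ⟨n, by simpa [hk, emb] using h⟩
    · refine ⟨-n, ?_⟩
      simp only [hk, emb, if_true] at h
      push_cast
      linear_combination -h
  have him : w.im = w'.im := by simpa using congrArg Complex.im hn'
  have hre : (corner b j).loc + w.re = (corner b k).loc + w'.re + n' * G.L := by
    simpa using congrArg Complex.re hn'
  have hd : |w.re - w'.re| ≤ 2 * ρ := by
    have := Complex.abs_re_le_norm (w - w')
    have h3 := norm_sub_le w w'
    simp only [Complex.sub_re] at this
    linarith
  obtain ⟨h4, h5⟩ := corner_separated (n := n') (d := w.re - w'.re) hρ hs (by linarith) hd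
  exact ⟨h4, Complex.ext (sub_eq_zero.1 h5) him⟩

variable (b) in
/-- The identifications between the half-discs at the corners of a boundary point. -/
def CornerRel (j : ℕ) (w : ℂ) (k : ℕ) (w' : ℂ) : Prop :=
  (corner b j = corner b k ∧ w = w') ∨ (w = 0 ∧ w' = 0) ∨
  (∃ t : ℝ, 0 < t ∧ w = t ∧ w' = -t ∧ corner b k = corner b (j + 1)) ∨
  (∃ t : ℝ, 0 < t ∧ w = -t ∧ w' = t ∧ corner b j = corner b (k + 1))

theorem eq_real_cases {w : ℂ} (h : w.im = 0) (h0 : w ≠ 0) :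
    (∃ t : ℝ, 0 < t ∧ w = t) ∨ ∃ t : ℝ, 0 < t ∧ w = -t := by
  have hw : w = (w.re : ℂ) := Complex.ext (by simp) (by simp [h])
  rcases lt_trichotomy w.re 0 with h1 | h1 | h1
  · exact Or.inr ⟨-w.re, by linarith, by rw [Complex.ofReal_neg, neg_neg]; exact hw⟩
  · exact absurd (by rw [hw, h1]; simp) h0
  · exact Or.inl ⟨w.re, h1, hw⟩

theorem corner_pred (j : ℕ) : ∃ i, corner b j = corner b (i + 1) := by
  have hm := b.minimalPeriod_pos
  refine ⟨j + Function.minimalPeriod next b - 1, ?_⟩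
  rw [Nat.sub_add_cancel (by omega), corner_eq_iff]
  simp [Nat.ModEq]

theorem iterate_of_pos_ne {c : G.Bd} (h : c.pos ≠ 0) (i : ℕ) : next^[i] c = c ∨ next^[i] c = c.next := by
  induction i with
  | zero => exact Or.inl rfl
  | succ j ih =>
    rw [Function.iterate_succ_apply']
    rcases ih with ih | ih <;> rw [ih]
    · exact Or.inr rfl
    · exact Or.inl (next_next h)

theorem corner_lift_right (hρ : ∀ j, 2 * ρ < (corner b j).room) {t : ℝ} (ht : 0 < t)
    (htρ : t ≤ ρ) (j : ℕ) : ∃ c : G.Bd, c.pos ≠ 0 ∧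
      Lift G c (G.emb (corner b j).side ((corner b j).loc + t)) ∧
      Lift G c.next (G.emb (corner b (j + 1)).side ((corner b (j + 1)).loc - t)) := by
  have h : t < (corner b j).room := by linarith [hρ j]
  refine ⟨_, right_pos_ne _ ht h, lift_right _ ht.le h, ?_⟩
  rw [corner_succ]
  exact lift_left _ ht h

/-- There are four kinds of points in a half-disc: interior points, glued only to their translates;
the centre, glued to all the corners; and the points of the right and of the left radius, glued to
one point on the next and on the preceding corner respectively. -/
theorem corner_sat (hρ : ∀ j, 2 * ρ < (corner b j).room) (hρ' : 2 * ρ < G.c.im) {j : ℕ} {w : ℂ}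
    (hw : ‖w‖ ≤ ρ) (hw0 : 0 ≤ w.im) {z : ℂ} (hz : z ∈ G.strip)
    (h : G.proj z = G.proj (G.emb (corner b j).side ((corner b j).loc + w))) :
    ∃ k w', ∃ n : ℤ, CornerRel b j w k w' ∧ 0 ≤ w'.im ∧ ‖w'‖ = ‖w‖ ∧
      z = G.emb (corner b k).side ((corner b k).loc + w') + n * G.L := by
  have hr := (proj_eq_iff (emb_mem_strip.2 ((loc_add_mem_strip hρ' hw).2 hw0)) hz).1 h.symm
  rcases hw0.lt_or_eq with hpos | hzero
  · have hi : G.emb (corner b j).side ((corner b j).loc + w) ∈ G.interiorStrip := by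
      have := (loc_add_mem_interior (b := b) (j := j) hρ' hw).2 hpos
      cases (corner b j).side
      · simpa [emb] using this
      · simp only [interiorStrip, Set.mem_ofPred_eq, emb, if_true, Complex.sub_im] at this ⊢
        constructor <;> linarith [this.1, this.2]
    obtain ⟨n, hn⟩ := rel_of_interior hi hr
    exact ⟨j, w, n, Or.inl ⟨rfl, rfl⟩, hw0, rfl, hn⟩
  by_cases h0 : w = 0
  · subst h0
    have hl : Lift G (corner b j) (G.emb (corner b j).side ((corner b j).loc + 0)) := by
      rw [add_zero]; exact lift_self _
    obtain ⟨i, hi⟩ := rel_of_lift hl hr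
    rw [corner_add] at hi
    obtain ⟨n, hn⟩ := (lift_self _).exists_add hi
    exact ⟨j + i, 0, n, Or.inr (Or.inl ⟨rfl, rfl⟩), hw0, rfl, by rw [hn, add_zero]⟩
  rcases eq_real_cases hzero.symm h0 with ⟨t, ht, rfl⟩ | ⟨t, ht, rfl⟩
  · have htρ : t ≤ ρ := by simpa [abs_of_pos ht] using hw
    obtain ⟨c, hc, hc1, hc2⟩ := corner_lift_right hρ ht htρ j
    obtain ⟨i, hi⟩ := rel_of_lift hc1 hr
    rcases iterate_of_pos_ne hc i with h' | h' <;> rw [h'] at hi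
    · obtain ⟨n, hn⟩ := hc1.exists_add hi
      exact ⟨j, t, n, Or.inl ⟨rfl, rfl⟩, hw0, rfl, hn⟩
    · obtain ⟨n, hn⟩ := hc2.exists_add hi
      exact ⟨j + 1, -t, n, Or.inr (Or.inr (Or.inl ⟨t, ht, rfl, rfl, rfl⟩)), by simp, by simp,
        by rw [hn, sub_eq_add_neg]⟩
  · have htρ : t ≤ ρ := by simpa [abs_of_pos ht] using hw
    -- A point of the left radius at a corner is the `next` of a point of the right radius at the
    -- preceding corner.
    obtain ⟨k, hk⟩ := corner_pred (b := b) j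
    obtain ⟨c, hc, hc1, hc2⟩ := corner_lift_right hρ ht htρ k
    have hc2' := hc2
    rw [← hk, sub_eq_add_neg] at hc2
    obtain ⟨i, hi⟩ := rel_of_lift hc2 hr
    have hcn : c.next.next = c := next_next hc
    rcases iterate_of_pos_ne (next_pos_ne hc) i with h' | h' <;> rw [h'] at hi
    · obtain ⟨n, hn⟩ := hc2.exists_add hi
      exact ⟨j, -t, n, Or.inl ⟨rfl, rfl⟩, hw0, rfl, hn⟩
    · rw [hcn] at hi
      obtain ⟨n, hn⟩ := hc1.exists_add hi
      exact ⟨k, t, n, Or.inr (Or.inr (Or.inr ⟨t, ht, rfl, rfl, hk⟩)), by simp, by simp, hn⟩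

theorem CornerRel.proj_eq (hρ : ∀ j, 2 * ρ < (corner b j).room) {j k : ℕ} {w w' : ℂ}
    (hw : ‖w‖ ≤ ρ) (h : CornerRel b j w k w') :
    G.proj (G.emb (corner b j).side ((corner b j).loc + w)) =
      G.proj (G.emb (corner b k).side ((corner b k).loc + w')) := by
  have step : ∀ (j : ℕ) (t : ℝ), 0 < t → t ≤ ρ →
      G.proj (G.emb (corner b j).side ((corner b j).loc + t)) =
      G.proj (G.emb (corner b (j + 1)).side ((corner b (j + 1)).loc + -t)) := by
    intro j t ht htρ
    obtain ⟨c, hc, hc1, hc2⟩ := corner_lift_right hρ ht htρ j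
    rw [sub_eq_add_neg] at hc2
    exact (proj_eq_iff hc1.mem_strip hc2.mem_strip).2 (Or.inr ⟨c, 1, hc1, hc2⟩)
  rcases h with ⟨h, rfl⟩ | ⟨rfl, rfl⟩ | ⟨t, ht, rfl, rfl, h⟩ | ⟨t, ht, rfl, rfl, h⟩
  · rw [h]
  · rw [add_zero, add_zero]
    have key : ∀ j, G.proj (G.emb (corner b j).side (corner b j).loc) =
        G.proj (G.emb b.side b.loc) := fun j =>
      ((proj_eq_iff (lift_self _).mem_strip (lift_self _).mem_strip).2
        (Or.inr ⟨b, j, lift_self _, lift_self _⟩)).symm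
    rw [key, key]
  · rw [h]
    exact step j t ht (by simpa [abs_of_pos ht] using hw)
  · rw [h]
    exact (step k t ht (by simpa [abs_of_pos ht] using hw)).symm

theorem corner_proj_eq_iff (hρ : ∀ j, 2 * ρ < (corner b j).room) (hρ' : 2 * ρ < G.c.im) {j k : ℕ}
    {w w' : ℂ} (hw : ‖w‖ ≤ ρ) (hw0 : 0 ≤ w.im) (hw' : ‖w'‖ ≤ ρ) (hw0' : 0 ≤ w'.im) :
    G.proj (G.emb (corner b j).side ((corner b j).loc + w)) =
      G.proj (G.emb (corner b k).side ((corner b k).loc + w')) ↔ CornerRel b j w k w' := by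
  refine ⟨fun h => ?_, fun h => h.proj_eq hρ hw⟩
  obtain ⟨i, w₂, n, h1, h2, h3, h4⟩ := corner_sat hρ hρ' hw hw0
    (emb_mem_strip.2 ((loc_add_mem_strip hρ' hw').2 hw0')) h.symm
  obtain ⟨h5, rfl⟩ := emb_corner_eq hρ hρ' hw' (h3.le.trans hw) n h4
  unfold CornerRel at h1 ⊢
  rw [h5]
  rcases h1 with h1 | h1 | h1 | ⟨t, h6, h7, h8, h9⟩
  · exact Or.inl h1
  · exact Or.inr (Or.inl h1)
  · exact Or.inr (Or.inr (Or.inl h1))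
  · refine Or.inr (Or.inr (Or.inr ⟨t, h6, h7, h8, ?_⟩))
    rw [h9, corner_succ, corner_succ, h5]

/-- The `m`-th power of the coordinate is `w ^ 2`, so equal coordinates force `w' = w` or `w' = -w`.
In the second case both points lie in the closed upper half-plane, hence on its real boundary, where
`sectorRoot.neg` matches adjacent sectors. Moreover `ζ` has exact order `m`, so its powers
distinguish the corners. The inverse occurs because `next` turns clockwise. -/
theorem sectorRoot_cornerRel_iff {m : ℕ} (hm : m = Function.minimalPeriod next b) {j k : ℕ}
    {w w' : ℂ} (hw0 : 0 ≤ w.im) (hw0' : 0 ≤ w'.im) {ζ : ℂ}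
    (hζ : ζ = (Complex.exp (2 * Real.pi * Complex.I / m))⁻¹) :
    ζ ^ j * sectorRoot m w = ζ ^ k * sectorRoot m w' ↔ CornerRel b j w k w' := by
  have hm0 : 0 < m := hm ▸ b.minimalPeriod_pos
  have hprim : IsPrimitiveRoot ζ m := hζ ▸ (Complex.isPrimitiveRoot_exp m hm0.ne').inv
  have hζ0 : ζ ≠ 0 := hprim.ne_zero hm0.ne'
  have hpow : ∀ j k, ζ ^ j = ζ ^ k ↔ corner b j = corner b k := by
    have hmod : ∀ i, ζ ^ (i % m) = ζ ^ i := fun i => by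
      conv_rhs => rw [← Nat.div_add_mod i m, pow_add, pow_mul, hprim.pow_eq_one, one_pow, one_mul]
    intro j k
    rw [corner_eq_iff, ← hm]
    refine ⟨fun h => ?_, fun h => ?_⟩
    · exact hprim.pow_inj (Nat.mod_lt _ hm0) (Nat.mod_lt _ hm0) (by rw [hmod, hmod, h])
    · rw [← hmod j, ← hmod k, h]
  have hneg : ∀ t : ℝ, 0 < t → ζ * sectorRoot m (-t) = sectorRoot m t := fun t ht => by
    rw [sectorRoot.neg (by simpa using ht), hζ, inv_mul_cancel_left₀ (Complex.exp_ne_zero _)]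
  have hr0 : ∀ t : ℝ, 0 < t → sectorRoot m t ≠ 0 := fun t ht h => by
    rw [sectorRoot.eq_zero_iff hm0] at h
    exact ht.ne' (by exact_mod_cast h)
  have hstep : ∀ (j : ℕ) (t : ℝ), 0 < t →
      ζ ^ j * sectorRoot m t = ζ ^ (j + 1) * sectorRoot m (-t) := fun j t ht => by
    rw [pow_succ, mul_assoc, hneg t ht]
  constructor
  · intro h
    have hsq : w ^ 2 = w' ^ 2 := by
      have := congrArg (· ^ m) h
      simpa [mul_pow, sectorRoot.pow_eq hm0, ← pow_mul, mul_comm _ m, pow_mul ζ m,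
        hprim.pow_eq_one] using this
    by_cases h0 : w = 0
    · subst h0
      exact Or.inr (Or.inl ⟨rfl, by simpa using hsq.symm⟩)
    rcases sq_eq_sq_iff_eq_or_eq_neg.1 hsq with rfl | hw
    · left
      refine ⟨(hpow j k).1 (mul_right_cancel₀ ?_ h), rfl⟩
      rwa [Ne, sectorRoot.eq_zero_iff hm0]
    · have him : w.im = 0 := by
        rw [hw] at hw0 ⊢
        simp at hw0 ⊢; linarith
      rcases eq_real_cases him h0 with ⟨t, ht, rfl⟩ | ⟨t, ht, rfl⟩
      · have hw' : w' = -t := by rw [hw, neg_neg]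
        subst hw'
        refine Or.inr (Or.inr (Or.inl ⟨t, ht, rfl, rfl, ?_⟩))
        rw [hstep j t ht] at h
        exact ((hpow _ _).1 (mul_right_cancel₀ (fun h' => hr0 t ht
          (by rw [← hneg t ht, h', mul_zero])) h)).symm
      · have hw' : w' = t := (neg_inj.1 hw).symm
        subst hw'
        refine Or.inr (Or.inr (Or.inr ⟨t, ht, rfl, rfl, ?_⟩))
        rw [hstep k t ht] at h
        exact (hpow _ _).1 (mul_right_cancel₀ (fun h' => hr0 t ht
          (by rw [← hneg t ht, h', mul_zero])) h)
  · rintro (⟨h, rfl⟩ | ⟨rfl, rfl⟩ | ⟨t, ht, rfl, rfl, h⟩ | ⟨t, ht, rfl, rfl, h⟩)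
    · rw [(hpow _ _).2 h]
    · simp [sectorRoot.zero hm0]
    · rw [hstep j t ht, (hpow _ _).2 h]
    · rw [hstep k t ht, (hpow _ _).2 h]

/-- With `m` half-discs and `u ^ m = w ^ 2` one gets `m u ^ (m - 1) du = 2 w dw`, hence `(dw)² = (m²
/ 4) u ^ (m - 2) (du)²`. This is the source of the order `m - 2`. -/
theorem exists_boundary_star (b : G.Bd) : ∃ S : G.Star,
    S.center = G.proj (G.emb b.side b.loc) ∧ S.ord = (Function.minimalPeriod next b : ℤ) - 2 := by
  obtain ⟨m, hm⟩ : ∃ m, m = Function.minimalPeriod next b := ⟨_, rfl⟩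
  have hm0 : 0 < m := hm ▸ b.minimalPeriod_pos
  obtain ⟨ρ, hρ0, hρ, hρ'⟩ : ∃ ρ > 0, (∀ j, 2 * ρ < (corner b j).room) ∧ 2 * ρ < G.c.im := by
    obtain ⟨ε, hε, h⟩ := exists_pos_le_of_finite fun j : Fin m => (corner b j).room_pos
    refine ⟨min ε G.c.im / 3, by have := lt_min hε G.c_pos; linarith, fun j => ?_, ?_⟩
    · rw [← corner_mod, ← hm]
      have h1 := h ⟨j % m, Nat.mod_lt _ hm0⟩
      have h2 := min_le_left ε G.c.im
      have h3 := lt_min hε G.c_pos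
      simp only at h1
      linarith
    · have h2 := min_le_right ε G.c.im
      have h3 := lt_min hε G.c_pos
      linarith
  obtain ⟨ζ, hζ⟩ : ∃ ζ, ζ = (Complex.exp (2 * Real.pi * Complex.I / m))⁻¹ := ⟨_, rfl⟩
  have hprim : IsPrimitiveRoot ζ m := hζ ▸ (Complex.isPrimitiveRoot_exp m hm0.ne').inv
  have hζ0 : ζ ≠ 0 := hprim.ne_zero hm0.ne'
  have hζn : ∀ j : ℕ, ‖ζ ^ j‖ = 1 := fun j => by
    rw [norm_pow, hprim.norm'_eq_one hm0.ne', one_pow]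
  have hmC : (m : ℂ) ≠ 0 := by exact_mod_cast hm0.ne'
  have hpowζ : ∀ j : ℕ, (ζ ^ j) ^ m = 1 := fun j => by
    rw [← pow_mul, mul_comm, pow_mul, hprim.pow_eq_one, one_pow]
  have hRpow : ((ρ ^ 2) ^ ((m : ℝ)⁻¹)) ^ m = ρ ^ 2 :=
    Real.rpow_inv_natCast_pow (by positivity) hm0.ne'
  have hR0 : 0 ≤ (ρ ^ 2) ^ ((m : ℝ)⁻¹) := by positivity
  have hstrip : ∀ (j : Fin m) (w : ℂ), ‖w‖ ≤ ρ →
      (((corner b j).loc : ℂ) + w ∈ G.strip ↔ 0 ≤ w.im) := fun j w hw => loc_add_mem_strip hρ' hw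
  refine ⟨{
    m := m
    s := fun j => (corner b j).side
    x := fun j => (corner b j).loc
    rot := fun j => ζ ^ (j : ℕ)
    ρ := ρ
    R := (ρ ^ 2) ^ ((m : ℝ)⁻¹)
    g := sectorRoot m
    coef := fun u => (m ^ 2 / 4 : ℂ) * u ^ ((m : ℤ) - 2)
    base := ⟨0, hm0⟩
    ord := (m : ℤ) - 2
    ρ_pos := hρ0
    center_mem := fun j => by
      have := (hstrip j 0 (by simpa using hρ0.le)).2 (by simp)
      simpa using this
    center_proj := fun j => by
      have : CornerRel b j 0 0 0 := Or.inr (Or.inl ⟨rfl, rfl⟩)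
      simpa using this.proj_eq hρ (by simpa using hρ0.le)
    sat := ?_
    key := ?_
    g_cont := fun j w hw hw' => sectorRoot.continuousAt hm0 ((hstrip j w hw).1 hw')
    g_norm := ?_
    g_zero := sectorRoot.zero hm0
    surj := ?_
    rot_ne := fun j => pow_ne_zero _ hζ0
    analytic := ?_
    coef_eq := ?_
    coef_mero := fun u => (MeromorphicAt.const _ u).mul ((MeromorphicAt.id u).zpow _)
    coef_ord := meromorphicOrderAt_const_mul_zpow (by simp [hm0.ne']) _
    nonvertex := ?_ }, rfl, by rw [← hm]⟩
  · intro j w hw hw' z hz h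
    obtain ⟨k, w', n, h1, h2, h3, h4⟩ := corner_sat hρ hρ' hw ((hstrip j w hw).1 hw') hz h
    have hk : corner b (k % m) = corner b k := by rw [hm]; exact corner_mod b k
    refine ⟨⟨k % m, Nat.mod_lt _ hm0⟩, w', n, ?_, h3, ?_⟩
    · exact (loc_add_mem_strip hρ' (h3.le.trans hw)).2 h2
    · simp only [hk]
      exact h4
  · intro j w k w' hw hws hw' hws'
    rw [corner_proj_eq_iff hρ hρ' hw ((hstrip j w hw).1 hws) hw' ((hstrip k w' hw').1 hws'),
      sectorRoot_cornerRel_iff hm ((hstrip j w hw).1 hws) ((hstrip k w' hw').1 hws') hζ]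
  · intro j w hw hws
    rw [norm_mul, hζn, one_mul, ← pow_lt_pow_iff_left₀ (norm_nonneg _) hR0 hm0.ne', hRpow,
      sectorRoot.norm_pow hm0, pow_lt_pow_iff_left₀ (norm_nonneg _) hρ0.le two_ne_zero]
  · intro u hu
    -- A square root of `u ^ m` in the closed upper half-plane gives the position inside a
    -- half-disc; the remaining quotient is an `m`-th root of unity and selects the corner.
    obtain ⟨w, hw, hw0⟩ : ∃ w : ℂ, w ^ 2 = u ^ m ∧ 0 ≤ w.im := by
      obtain ⟨w, hw⟩ := IsAlgClosed.exists_pow_nat_eq (u ^ m) (n := 2) two_pos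
      rcases le_total 0 w.im with h | h
      · exact ⟨w, hw, h⟩
      · exact ⟨-w, by rw [neg_sq, hw], by simpa using h⟩
    have hwρ : ‖w‖ ≤ ρ := by
      have h1 : ‖w‖ ^ 2 = ‖u‖ ^ m := by rw [← norm_pow, hw, norm_pow]
      have h2 : ‖u‖ ^ m ≤ ρ ^ 2 := by
        rw [← hRpow]
        exact pow_le_pow_left₀ (norm_nonneg _) hu.le _
      exact (pow_le_pow_iff_left₀ (norm_nonneg _) hρ0.le two_ne_zero).1 (h1 ▸ h2)
    by_cases hu0 : u = 0
    · subst hu0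
      have : w = 0 := by simpa [hm0.ne'] using hw
      subst this
      exact ⟨⟨0, hm0⟩, 0, hwρ, (hstrip ⟨0, hm0⟩ 0 hwρ).2 hw0, by simp [sectorRoot.zero hm0]⟩
    · have hg0 : sectorRoot m w ≠ 0 := by
        rw [Ne, sectorRoot.eq_zero_iff hm0]
        rintro rfl
        have : u ^ m = 0 := by rw [← hw]; simp
        exact hu0 (pow_eq_zero_iff hm0.ne' |>.1 this)
      have h1 : (u / sectorRoot m w) ^ m = 1 := by
        rw [div_pow, sectorRoot.pow_eq hm0, hw, div_self (pow_ne_zero _ hu0)]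
      have : NeZero m := ⟨hm0.ne'⟩
      obtain ⟨i, hi, h2⟩ := hprim.eq_pow_of_pow_eq_one h1
      refine ⟨⟨i, hi⟩, w, hwρ, (hstrip ⟨i, hi⟩ w hwρ).2 hw0, ?_⟩
      simp only [h2]
      exact div_mul_cancel₀ _ hg0
  · intro j w hw hws h
    have hw0 := (hstrip j w hw).1 hws
    have hne : w ≠ 0 := by
      rcases h with h | h
      · exact h
      · rintro rfl
        have := (loc_add_mem_interior (b := b) (j := j) hρ' hw).1 h
        simp at this
    exact ⟨sectorRoot.analyticAt hne hw0, sectorRoot.deriv_ne_zero hm0 hne hw0⟩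
  · intro j w hw hwi
    have hw0 := (loc_add_mem_interior (b := b) (j := j) hρ' hw).1 hwi
    have hne : w ≠ 0 := by rintro rfl; simp at hw0
    have hg0 : sectorRoot m w ≠ 0 := by rwa [Ne, sectorRoot.eq_zero_iff hm0]
    have hd : m * w * deriv (sectorRoot m) w = 2 * sectorRoot m w := by
      have h1 := sectorRoot.deriv_mul hm0 hne hw0.le
      have h2 := sectorRoot.pow_eq hm0 w
      have h3 : sectorRoot m w ^ (m - 1) * sectorRoot m w = w ^ 2 := by
        rw [← pow_succ, Nat.sub_add_cancel hm0, h2]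
      apply mul_left_cancel₀ hne
      linear_combination sectorRoot m w * h1 - m * deriv (sectorRoot m) w * h3
    have hu0 : ζ ^ (j : ℕ) * sectorRoot m w ≠ 0 := mul_ne_zero (pow_ne_zero _ hζ0) hg0
    rw [zpow_sub₀ hu0, zpow_natCast, mul_pow, hpowζ, sectorRoot.pow_eq hm0, one_mul]
    have h2 : (ζ ^ (j : ℕ) * sectorRoot m w) ^ (2 : ℤ) = (ζ ^ (j : ℕ) * sectorRoot m w) ^ 2 := by
      norm_cast
    rw [h2]
    have hζj : ζ ^ (j : ℕ) ≠ 0 := pow_ne_zero _ hζ0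
    have h4 : (m : ℂ) ^ 2 * w ^ 2 * deriv (sectorRoot m) w ^ 2 = 4 * sectorRoot m w ^ 2 := by
      linear_combination (m * w * deriv (sectorRoot m) w + 2 * sectorRoot m w) * hd
    rw [mul_pow, mul_pow]
    field_simp
    linear_combination h4
  · intro j w hw hws hne c hc
    have hw0 := (hstrip j w hw).1 hws
    rcases hw0.lt_or_eq with hpos | hzero
    · have := (loc_add_mem_interior (b := b) (j := j) hρ' hw).2 hpos
      refine absurd hc fun hc => hc.notMem_interior ?_
      cases (corner b j).side
      · simpa [emb] using this
      · simp only [interiorStrip, Set.mem_ofPred_eq, emb, if_true, Complex.sub_im] at this ⊢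
        constructor <;> linarith [this.1, this.2]
    rcases eq_real_cases hzero.symm hne with ⟨t, ht, rfl⟩ | ⟨t, ht, rfl⟩
    · have htρ : t ≤ ρ := by simpa [abs_of_pos ht] using hw
      obtain ⟨c', h1, h2, _⟩ := corner_lift_right hρ ht htρ j
      rwa [hc.eq h2]
    · have htρ : t ≤ ρ := by simpa [abs_of_pos ht] using hw
      obtain ⟨k, hk⟩ := corner_pred (b := b) j
      obtain ⟨c', h1, _, h2⟩ := corner_lift_right hρ ht htρ k
      rw [← hk, sub_eq_add_neg] at h2
      rw [hc.eq h2]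
      exact next_pos_ne h1

end boundary

theorem proj_eq_of_lift {b : G.Bd} {z : ℂ} (h : b.Lift G z) :
    G.proj z = G.proj (G.emb b.side b.loc) :=
  (proj_eq_iff h.mem_strip (lift_self _).mem_strip).2 (Or.inr ⟨b, 0, h, lift_self _⟩)

/-- The order is stated for every representative of `q`, so that it can be read off from any lift:
corners of the same point lie on one orbit and share the minimal period. -/
theorem exists_star (q : G.Surface) : ∃ S : G.Star, S.center = q ∧
    (∀ z ∈ G.interiorStrip, G.proj z = q → S.ord = 0) ∧
    ∀ (b : G.Bd) (z : ℂ), b.Lift G z → G.proj z = q →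
      S.ord = (Function.minimalPeriod next b : ℤ) - 2 := by
  obtain ⟨z, hz, rfl⟩ := exists_proj q
  by_cases hi : z ∈ G.interiorStrip
  · obtain ⟨S, h1, h2⟩ := exists_interior_star hi
    refine ⟨S, h1, fun _ _ _ => h2, fun b z' hb h => ?_⟩
    obtain ⟨n, rfl⟩ := rel_of_interior hi ((proj_eq_iff hz hb.mem_strip).1 h.symm)
    have := hb.add (-n)
    refine absurd hi (Bd.Lift.notMem_interior (b := b) ?_)
    simpa using this
  · obtain ⟨b, hb⟩ := exists_lift_of_notMem hz hi
    obtain ⟨S, h1, h2⟩ := exists_boundary_star b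
    refine ⟨S, h1.trans (proj_eq_of_lift hb).symm, fun z' hz' h => ?_, fun b' z' hb' h => ?_⟩
    · obtain ⟨n, rfl⟩ := rel_of_interior hz' ((proj_eq_iff (interiorStrip_subset hz') hz).1 h)
      have := hb.add (-n)
      refine absurd hz' (Bd.Lift.notMem_interior (b := b) ?_)
      simpa using this
    · obtain ⟨k, hk⟩ := rel_of_lift hb ((proj_eq_iff hz hb'.mem_strip).1 h.symm)
      rw [h2, hb'.eq hk, Function.minimalPeriod_apply_iterate b.mem_periodicPts]

end GluedCylinder

/-! ### The Riemann surface structure. -/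

theorem eventually_ne_punctured (u a : ℂ) : ∀ᶠ w in 𝓝[≠] u, w ≠ a := by
  by_cases h : u = a
  · subst h; exact self_mem_nhdsWithin
  · exact (eventually_ne_nhds h).filter_mono nhdsWithin_le_nhds

namespace GluedCylinder

variable {G : GluedCylinder}

open Bd

instance : T2Space G.Surface := t2Space_of_star fun q => ⟨_, (exists_star q).choose_spec.1⟩

theorem proj_surjective : Function.Surjective G.proj := fun q =>
  let ⟨z, _, h⟩ := exists_proj q
  ⟨z, h⟩

instance : ConnectedSpace G.Surface := proj_surjective.connectedSpace continuous_proj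

theorem exists_int_re (G : GluedCylinder) (x : ℝ) : ∃ n : ℤ, 0 ≤ x + n * G.L ∧ x + n * G.L < G.L := by
  have hL := G.L_pos
  refine ⟨-⌊x / G.L⌋, ?_, ?_⟩
  · have := (le_div_iff₀ hL).1 (Int.floor_le (x / G.L))
    push_cast; linarith
  · have := (div_lt_iff₀ hL).1 (Int.lt_floor_add_one (x / G.L))
    push_cast; linarith

instance : CompactSpace G.Surface := by
  have hK : IsCompact (Set.Icc 0 G.L ×ℂ Set.Icc 0 G.c.im) :=
    isCompact_Icc.reProdIm isCompact_Icc
  have : G.proj '' (Set.Icc 0 G.L ×ℂ Set.Icc 0 G.c.im) = Set.univ := by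
    refine Set.eq_univ_of_forall fun q => ?_
    obtain ⟨z, hz, rfl⟩ := exists_proj q
    obtain ⟨n, h1, h2⟩ := G.exists_int_re z.re
    refine ⟨z + n * G.L, ?_, proj_add_int z n⟩
    rw [Complex.mem_reProdIm]
    simp only [Complex.add_re, Complex.add_im, Complex.mul_re, Complex.mul_im, Complex.intCast_re,
      Complex.intCast_im, Complex.ofReal_re, Complex.ofReal_im]
    exact ⟨⟨by linarith, by linarith⟩, ⟨by linarith [hz.1], by linarith [hz.2]⟩⟩
  exact ⟨this ▸ hK.image continuous_proj⟩

/-- A star centred at a given point. -/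
noncomputable def star (q : G.Surface) : G.Star := (exists_star q).choose

theorem center_star (q : G.Surface) : (star q).center = q := (exists_star q).choose_spec.1

theorem ord_star_interior {z : ℂ} (h : z ∈ G.interiorStrip) : (star (G.proj z)).ord = 0 :=
  (exists_star (G.proj z)).choose_spec.2.1 z h rfl

theorem ord_star_lift {b : G.Bd} {z : ℂ} (h : b.Lift G z) :
    (star (G.proj z)).ord = (Function.minimalPeriod next b : ℤ) - 2 :=
  (exists_star (G.proj z)).choose_spec.2.2 b z h rfl

noncomputable instance : ChartedSpace ℂ G.Surface where
  atlas := Set.range fun q => (star q).chart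
  chartAt q := (star q).chart
  mem_chart_source q := by
    have := (star q).center_mem_source
    rwa [center_star] at this
  chart_mem_atlas q := ⟨q, rfl⟩

theorem interiorStrip_mem_nhds {z : ℂ} (h : z ∈ G.interiorStrip) : G.strip ∈ 𝓝 z :=
  Filter.mem_of_superset (isOpen_interiorStrip.mem_nhds h) interiorStrip_subset

theorem Star.exists_analytic_interior (S : G.Star) {z : ℂ} (hz : z ∈ G.interiorStrip)
    (hs : G.proj z ∈ S.chart.source) : AnalyticAt ℂ (fun w => S.chart (G.proj w)) z ∧
      deriv (fun w => S.chart (G.proj w)) z ≠ 0 ∧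
      S.coef (S.chart (G.proj z)) * deriv (fun w => S.chart (G.proj w)) z ^ 2 = 1 := by
  obtain ⟨k, h1, h2, h3, h4⟩ := S.exists_analytic (interiorStrip_subset hz) hs (Or.inr hz)
  have h5 : (fun w => S.chart (G.proj w)) =ᶠ[𝓝 z] k := by
    filter_upwards [h3, interiorStrip_mem_nhds hz] with w hw hw'
    exact hw hw'
  exact ⟨h1.congr h5.symm, by rwa [h5.deriv_eq], by rw [h5.deriv_eq]; exact h4 hz⟩

/-- The half-disc above a boundary point inside an edge. -/
noncomputable def upper (b : G.Bd) (w : ℂ) : ℂ := G.emb b.side (b.loc + w)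

/-- The half-disc glued to `upper b`, rotated by `π`. -/
noncomputable def lower (b : G.Bd) (w : ℂ) : ℂ := G.emb b.next.side (b.next.loc - w)

theorem continuous_upper (b : G.Bd) : Continuous (upper b) :=
  (continuous_emb _).comp (by fun_prop)

theorem continuous_lower (b : G.Bd) : Continuous (lower b) :=
  (continuous_emb _).comp (by fun_prop)

theorem hasDerivAt_emb (s : Bool) (v : ℂ) : HasDerivAt (G.emb s) (if s then -1 else 1) v := by
  cases s
  · exact hasDerivAt_id v
  · exact (hasDerivAt_id v).const_sub G.c

theorem hasDerivAt_upper (b : G.Bd) (w : ℂ) :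
    HasDerivAt (upper b) (if b.side then -1 else 1) w := by
  have := (hasDerivAt_emb (G := G) b.side (b.loc + w)).comp w
    ((hasDerivAt_id w).const_add (b.loc : ℂ))
  rw [mul_one] at this
  exact this

theorem hasDerivAt_lower (b : G.Bd) (w : ℂ) :
    HasDerivAt (lower b) (-if b.next.side then -1 else 1) w := by
  have := (hasDerivAt_emb (G := G) b.next.side (b.next.loc - w)).comp w
    ((hasDerivAt_id w).const_sub (b.next.loc : ℂ))
  rw [mul_neg_one] at this
  exact this

theorem lift_upper_zero (b : G.Bd) : b.Lift G (upper b 0) := by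
  have := lift_self b
  simpa [upper] using this

theorem lift_lower_zero (b : G.Bd) : b.next.Lift G (lower b 0) := by
  have := lift_self b.next
  simpa [lower] using this

theorem proj_upper_zero (b : G.Bd) : G.proj (upper b 0) = G.proj (lower b 0) :=
  (proj_eq_iff (lift_upper_zero b).mem_strip (lift_lower_zero b).mem_strip).2
    (Or.inr ⟨b, 1, lift_upper_zero b, lift_lower_zero b⟩)

theorem eventually_proj_upper {b : G.Bd} (hb : b.pos ≠ 0) :
    ∀ᶠ t : ℝ in 𝓝 0, G.proj (upper b t) = G.proj (lower b t) := by
  have hpos : 0 < b.pos := lt_of_le_of_ne b.nonneg (Ne.symm hb)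
  filter_upwards [lt_mem_nhds (neg_lt_zero.2 hpos), gt_mem_nhds b.room_pos] with t h1 h2
  set b' : G.Bd := ⟨b.edge, b.pos + t, by linarith, by unfold room at h2; linarith⟩ with hb'
  have hb'0 : b'.pos ≠ 0 := by simp only [hb']; linarith
  have hu : b'.Lift G (upper b t) := by
    refine ⟨0, ?_⟩
    simp only [hb', upper, loc, Bd.side]
    congr 1; push_cast; ring
  have hl : b'.next.Lift G (lower b t) := by
    refine ⟨0, ?_⟩
    have h3 := next_of_pos_ne hb
    have h4 := next_of_pos_ne hb'0
    simp only [lower, loc, Bd.side, h3.1, h4.1, h3.2, h4.2]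
    congr 1; push_cast; simp only [hb']; push_cast; ring
  exact (proj_eq_iff hu.mem_strip hl.mem_strip).2 (Or.inr ⟨b', 1, hu, hl⟩)

theorem emb_mem_interior {s : Bool} {v : ℂ} : G.emb s v ∈ G.interiorStrip ↔ v ∈ G.interiorStrip := by
  cases s
  · simp [emb]
  · simp only [emb, interiorStrip, Set.mem_ofPred_eq, if_true, Complex.sub_im]
    constructor <;> rintro ⟨h1, h2⟩ <;> constructor <;> linarith

theorem eventually_im_lt (G : GluedCylinder) : ∀ᶠ w : ℂ in 𝓝 0, |w.im| < G.c.im :=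
  (Complex.continuous_im.abs.continuousAt (x := 0)).eventually
    (gt_mem_nhds (by simpa using G.c_pos))

theorem eventually_upper_mem (b : G.Bd) : ∀ᶠ w in 𝓝 (0 : ℂ),
    (0 ≤ w.im → upper b w ∈ G.strip) ∧ (0 < w.im → upper b w ∈ G.interiorStrip) := by
  filter_upwards [G.eventually_im_lt] with w hw
  have := abs_lt.1 hw
  rw [upper, emb_mem_strip, emb_mem_interior]
  simp only [strip, interiorStrip, Set.mem_ofPred_eq, Complex.add_im, Complex.ofReal_im, zero_add]
  exact ⟨fun h => ⟨h, this.2.le⟩, fun h => ⟨h, this.2⟩⟩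

theorem eventually_lower_mem (b : G.Bd) : ∀ᶠ w in 𝓝 (0 : ℂ),
    (w.im ≤ 0 → lower b w ∈ G.strip) ∧ (w.im < 0 → lower b w ∈ G.interiorStrip) := by
  filter_upwards [G.eventually_im_lt] with w hw
  have := abs_lt.1 hw
  rw [lower, emb_mem_strip, emb_mem_interior]
  simp only [strip, interiorStrip, Set.mem_ofPred_eq, Complex.sub_im, Complex.ofReal_im, zero_sub]
  exact ⟨fun h => ⟨by linarith, by linarith⟩, fun h => ⟨by linarith, by linarith⟩⟩

/-- The chart extends analytically from each of the two half-discs glued along an edge. The two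
extensions agree on a real interval, hence near `0` by the identity theorem. -/
theorem Star.exists_analytic_boundary (S : G.Star) {b : G.Bd} (hb : b.pos ≠ 0)
    (hs : G.proj (upper b 0) ∈ S.chart.source) (h0 : S.chart (G.proj (upper b 0)) ≠ 0) :
    ∃ K : ℂ → ℂ, AnalyticAt ℂ K 0 ∧ deriv K 0 ≠ 0 ∧
      (∀ᶠ w in 𝓝 (0 : ℂ), 0 ≤ w.im → S.chart (G.proj (upper b w)) = K w) ∧
      (∀ᶠ w in 𝓝 (0 : ℂ), w.im ≤ 0 → S.chart (G.proj (lower b w)) = K w) := by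
  obtain ⟨k, hk1, hk2, hk3, -⟩ := S.exists_analytic (lift_upper_zero b).mem_strip hs (Or.inl h0)
  rw [proj_upper_zero] at hs h0
  obtain ⟨l, hl1, -, hl3, -⟩ := S.exists_analytic (lift_lower_zero b).mem_strip hs (Or.inl h0)
  have hAu : AnalyticAt ℂ (upper b) 0 :=
    (show Differentiable ℂ (upper b) from fun w => (hasDerivAt_upper b w).differentiableAt).analyticAt 0
  have hAl : AnalyticAt ℂ (lower b) 0 :=
    (show Differentiable ℂ (lower b) from fun w => (hasDerivAt_lower b w).differentiableAt).analyticAt 0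
  have hK : AnalyticAt ℂ (fun w => k (upper b w)) 0 := hk1.comp hAu
  have hL : AnalyticAt ℂ (fun w => l (lower b w)) 0 := hl1.comp hAl
  have hku : ∀ᶠ w in 𝓝 (0 : ℂ), 0 ≤ w.im → S.chart (G.proj (upper b w)) = k (upper b w) := by
    filter_upwards [(continuous_upper b).continuousAt.eventually hk3, eventually_upper_mem b]
      with w h1 h2 h3 using h1 (h2.1 h3)
  have hll : ∀ᶠ w in 𝓝 (0 : ℂ), w.im ≤ 0 → S.chart (G.proj (lower b w)) = l (lower b w) := by
    filter_upwards [(continuous_lower b).continuousAt.eventually hl3, eventually_lower_mem b]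
      with w h1 h2 h3 using h1 (h2.1 h3)
  have hreal : Filter.Tendsto (fun t : ℝ => (t : ℂ)) (𝓝 0) (𝓝 0) := by
    have := Complex.continuous_ofReal.tendsto 0
    simpa using this
  have heq : ∀ᶠ t : ℝ in 𝓝 0, k (upper b t) = l (lower b t) := by
    filter_upwards [hreal.eventually hku, hreal.eventually hll, eventually_proj_upper hb]
      with t h1 h2 h3
    rw [← h1 (by simp), ← h2 (by simp), h3]
  have hfreq : ∃ᶠ w in 𝓝[≠] (0 : ℂ), k (upper b w) = l (lower b w) := by
    have h1 : Filter.Tendsto (fun t : ℝ => (t : ℂ)) (𝓝[≠] 0) (𝓝[≠] 0) := by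
      refine tendsto_nhdsWithin_of_tendsto_nhds_of_eventually_within _
        (hreal.mono_left nhdsWithin_le_nhds) ?_
      filter_upwards [self_mem_nhdsWithin] with t ht
      simpa using ht
    exact h1.frequently (heq.filter_mono nhdsWithin_le_nhds).frequently
  have hKL := (hK.frequently_eq_iff_eventually_eq hL).1 hfreq
  refine ⟨fun w => k (upper b w), hK, ?_, hku, ?_⟩
  · have := hk1.differentiableAt.hasDerivAt.comp 0 (hasDerivAt_upper b 0)
    rw [show (fun w => k (upper b w)) = k ∘ upper b from rfl, this.deriv]
    refine mul_ne_zero hk2 ?_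
    split_ifs <;> simp
  · filter_upwards [hll, hKL] with w h1 h2 h3
    rw [h1 h3]; exact h2.symm

/-- A parametrization of a neighbourhood of a point which is not a vertex, in which all charts are
analytic. -/
theorem exists_uniformizer {z : ℂ} (h : z ∈ G.interiorStrip ∨ ∃ b : G.Bd, b.Lift G z ∧ b.pos ≠ 0) :
    ∃ δ : ℂ → G.Surface, δ 0 = G.proj z ∧ ContinuousAt δ 0 ∧ ∀ S : G.Star,
      G.proj z ∈ S.chart.source → S.chart (G.proj z) ≠ 0 →
      ∃ K : ℂ → ℂ, AnalyticAt ℂ K 0 ∧ deriv K 0 ≠ 0 ∧ ∀ᶠ w in 𝓝 0, S.chart (δ w) = K w := by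
  rcases h with h | ⟨b, hb, hb0⟩
  · refine ⟨fun w => G.proj (z + w), by simp,
      (continuous_proj.comp (continuous_const.add continuous_id)).continuousAt,
      fun S hs _ => ⟨fun w => S.chart (G.proj (z + w)), ?_, ?_, Filter.Eventually.of_forall fun _ => rfl⟩⟩
    · have := (S.exists_analytic_interior h hs).1
      refine AnalyticAt.fun_comp (g := fun w => S.chart (G.proj w)) (by simpa using this) (by fun_prop)
    · have := (S.exists_analytic_interior h hs).2.1
      rw [deriv_comp_const_add (fun w => S.chart (G.proj w)) z 0]
      simpa using this
  · have hz : G.proj z = G.proj (upper b 0) := by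
      rw [proj_eq_of_lift hb, proj_eq_of_lift (lift_upper_zero b)]
    rw [hz]
    refine ⟨fun w => if 0 ≤ w.im then G.proj (upper b w) else G.proj (lower b w), by simp, ?_, ?_⟩
    · have h1 := ((continuous_proj (G := G)).comp (continuous_upper b)).continuousAt (x := 0)
      have h2 := ((continuous_proj (G := G)).comp (continuous_lower b)).continuousAt (x := 0)
      unfold ContinuousAt at h1 h2 ⊢
      simp only [Complex.zero_im, le_refl, if_true]
      refine Filter.Tendsto.if' h1 ?_
      rw [proj_upper_zero]
      exact h2
    · intro S hs h0
      obtain ⟨K, h1, h2, h3, h4⟩ := S.exists_analytic_boundary hb0 hs h0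
      refine ⟨K, h1, h2, ?_⟩
      filter_upwards [h3, h4] with w h3 h4
      split_ifs with h
      · exact h3 h
      · exact h4 (not_le.1 h).le

/-- Away from the two centres both charts are analytic in a common parameter, and the first one has
nonzero derivative; the transition map is the second one composed with a local inverse of the first.
-/
theorem Star.differentiableAt_transition_aux (S S' : G.Star) {u : ℂ}
    (hu : u ∈ (S.chart.symm.trans S'.chart).source) (h0 : u ≠ 0)
    (h0' : S'.chart (S.chart.symm u) ≠ 0) :
    DifferentiableAt ℂ (S'.chart ∘ S.chart.symm) u := by
  rw [OpenPartialHomeomorph.trans_source, OpenPartialHomeomorph.symm_source] at hu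
  have hut : u ∈ S.chart.target := hu.1
  have hus' : S.chart.symm u ∈ S'.chart.source := hu.2
  have hus := S.chart.map_target hut
  have hSu := S.chart.right_inv hut
  obtain ⟨z, hz, hzq⟩ := exists_proj (S.chart.symm u)
  rw [← hzq] at hus' hus hSu h0'
  have hcase : z ∈ G.interiorStrip ∨ ∃ b : G.Bd, b.Lift G z ∧ b.pos ≠ 0 := by
    by_cases hi : z ∈ G.interiorStrip
    · exact Or.inl hi
    · obtain ⟨b, hb⟩ := exists_lift_of_notMem hz hi
      refine Or.inr ⟨b, hb, fun hb0 => h0 ?_⟩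
      rw [← hSu, S.chart_vertex hb hb0 hus]
  obtain ⟨δ, hδ0, hδc, hδ⟩ := exists_uniformizer hcase
  obtain ⟨K, hK1, hK2, hK3⟩ := hδ S hus (by rwa [hSu])
  obtain ⟨K', hK1', -, hK3'⟩ := hδ S' hus' h0'
  have hK0 : K 0 = u := by rw [← hK3.self_of_nhds, hδ0, hSu]
  have hTK : ∀ᶠ w in 𝓝 0, (S'.chart ∘ S.chart.symm) (K w) = K' w := by
    have : ∀ᶠ w in 𝓝 0, δ w ∈ S.chart.source :=
      hδc.eventually (S.chart.open_source.mem_nhds (by rwa [hδ0]))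
    filter_upwards [hK3, hK3', this] with w h1 h2 h3
    rw [← h1, Function.comp_apply, S.chart.left_inv h3, h2]
  have hstrict := hK1.hasStrictDerivAt
  have hinv := hstrict.to_localInverse hK2
  have hright := hstrict.eventually_right_inverse hK2
  set I := hstrict.localInverse K (deriv K 0) 0 hK2 with hI
  have hI0 : I (K 0) = 0 := HasStrictFDerivAt.localInverse_apply_image _
  rw [← hK0]
  have hTI : (S'.chart ∘ S.chart.symm) =ᶠ[𝓝 (K 0)] fun v => K' (I v) := by
    have hIc : Filter.Tendsto I (𝓝 (K 0)) (𝓝 0) := by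
      have := hinv.hasDerivAt.continuousAt
      unfold ContinuousAt at this
      rwa [hI0] at this
    filter_upwards [hright, hIc.eventually hTK] with v h1 h2
    rw [← h2, h1]
  refine DifferentiableAt.congr_of_eventuallyEq ?_ hTI
  refine DifferentiableAt.comp (K 0) ?_ hinv.hasDerivAt.differentiableAt
  rw [hI0]
  exact hK1'.differentiableAt

/-- The points to be avoided are `0` and the image of the other centre; they are isolated and the
transition map is continuous, so they are removable singularities. -/
theorem Star.analyticAt_transition (S S' : G.Star) {u : ℂ}
    (hu : u ∈ (S.chart.symm.trans S'.chart).source) :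
    AnalyticAt ℂ (S'.chart ∘ S.chart.symm) u := by
  apply Complex.analyticAt_of_differentiable_on_punctured_nhds_of_continuousAt
  · have h1 : ∀ᶠ w in 𝓝[≠] u, w ∈ (S.chart.symm.trans S'.chart).source :=
      ((S.chart.symm.trans S'.chart).open_source.mem_nhds hu |> Filter.Eventually.filter_mono
        nhdsWithin_le_nhds)
    filter_upwards [h1, eventually_ne_punctured u 0,
      eventually_ne_punctured u (S.chart (S'.chart.symm 0))] with w h1 h2 h3
    refine S.differentiableAt_transition_aux S' h1 h2 fun h => h3 ?_
    rw [OpenPartialHomeomorph.trans_source, OpenPartialHomeomorph.symm_source] at h1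
    rw [← h, S'.chart.left_inv h1.2, S.chart.right_inv h1.1]
  · exact (S.chart.symm.trans S'.chart).continuousAt hu

instance : IsManifold 𝓘(ℂ) ω G.Surface := by
  apply isManifold_of_contDiffOn
  rintro _ _ ⟨q, rfl⟩ ⟨q', rfl⟩
  simp only [modelWithCornersSelf_coe, modelWithCornersSelf_coe_symm, Function.comp_id,
    Function.id_comp, Set.range_id, Set.inter_univ, Set.preimage_id]
  intro u hu
  have := (star q).analyticAt_transition (star q') (u := u) hu
  exact this.contDiffAt.contDiffWithinAt

end GluedCylinder

/-! ### The quadratic differential on the glued surface. -/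

namespace GluedCylinder

variable {G : GluedCylinder}

open Bd

/-- Every point is reached along a vertical segment from the open cylinder, where the charts can be
compared with `z`. By `rel_of_interior` the segment never meets the limit point. -/
theorem Star.tendsto_interior (S : G.Star) {q : G.Surface} (hq : q ∈ S.chart.source) :
    ∃ y : ℝ → ℂ, (∀ᶠ t in 𝓝[>] 0, y t ∈ G.interiorStrip) ∧
      Filter.Tendsto (fun t => G.proj (y t)) (𝓝[>] 0) (𝓝 q) ∧
      Filter.Tendsto (fun t => S.chart (G.proj (y t))) (𝓝[>] 0) (𝓝[≠] (S.chart q)) := by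
  obtain ⟨z, hz, rfl⟩ := exists_proj q
  obtain ⟨σ, hσ, hσ'⟩ : ∃ σ : ℝ, σ ≠ 0 ∧ ∀ᶠ t : ℝ in 𝓝[>] 0,
      z + (t * σ : ℝ) * Complex.I ∈ G.interiorStrip := by
    have hc := G.c_pos
    have hsmall : ∀ᶠ t : ℝ in 𝓝[>] 0, t < G.c.im / 2 :=
      (gt_mem_nhds (half_pos hc) : ∀ᶠ t : ℝ in 𝓝 0, _).filter_mono nhdsWithin_le_nhds
    rcases le_total z.im (G.c.im / 2) with h | h
    · refine ⟨1, one_ne_zero, ?_⟩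
      filter_upwards [hsmall, self_mem_nhdsWithin] with t ht ht0
      have ht0 : 0 < t := ht0
      constructor <;> simp <;> linarith [hz.1, hz.2]
    · refine ⟨-1, by norm_num, ?_⟩
      filter_upwards [hsmall, self_mem_nhdsWithin] with t ht ht0
      have ht0 : 0 < t := ht0
      constructor <;> simp <;> linarith [hz.1, hz.2]
  set y : ℝ → ℂ := fun t => z + (t * σ : ℝ) * Complex.I with hy
  have hyc : Continuous y := by fun_prop
  have hy0 : y 0 = z := by simp [hy]
  have hpc : Filter.Tendsto (fun t => G.proj (y t)) (𝓝[>] 0) (𝓝 (G.proj z)) := by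
    have := ((continuous_proj (G := G)).comp hyc).tendsto 0
    simp only [Function.comp_apply, hy0] at this
    exact this.mono_left nhdsWithin_le_nhds
  refine ⟨y, hσ', hpc, ?_⟩
  refine tendsto_nhdsWithin_of_tendsto_nhds_of_eventually_within _
    ((S.chart.continuousAt hq).tendsto.comp hpc) ?_
  filter_upwards [hσ', self_mem_nhdsWithin, hpc.eventually (S.chart.open_source.mem_nhds hq)]
    with t h1 h2 h3 h4
  have h5 := S.chart.injOn h3 hq h4
  obtain ⟨n, hn⟩ := rel_of_interior h1 ((proj_eq_iff (interiorStrip_subset h1) hz).1 h5)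
  have h6 := congrArg Complex.im hn
  have h7 : 0 < t := h2
  simp [h7.ne', hσ] at h6

theorem star_chart_symm_zero (q : G.Surface) : star ((star q).chart.symm 0) = star q := by
  rw [Star.chart_symm_zero, center_star]

/-- Both sides are meromorphic, so it suffices that they agree frequently near `u`. They do along a
path in the open cylinder, because there both coefficients express `(dz)²`. -/
theorem Star.transform (S S' : G.Star) {u : ℂ}
    (hu : u ∈ (S.chart.symm.trans S'.chart).source) :
    ∀ᶠ w in 𝓝[≠] u, S.coef w =
      S'.coef (S'.chart (S.chart.symm w)) * deriv (S'.chart ∘ S.chart.symm) w ^ 2 := by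
  have hT := S.analyticAt_transition S' hu
  have hm : MeromorphicAt (fun w => S'.coef (S'.chart (S.chart.symm w)) *
      deriv (S'.chart ∘ S.chart.symm) w ^ 2) u :=
    ((S'.coef_mero _).comp_analyticAt (f := S'.coef) hT).mul (hT.deriv.meromorphicAt.pow 2)
  rw [← Filter.EventuallyEq, ← (S.coef_mero u).frequently_eq_iff_eventuallyEq hm]
  have hus : u ∈ S.chart.target ∩ S.chart.symm ⁻¹' S'.chart.source := by
    rwa [OpenPartialHomeomorph.trans_source, OpenPartialHomeomorph.symm_source] at hu
  have hq := S.chart.map_target hus.1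
  obtain ⟨y, hy1, hy2, hy3⟩ := S.tendsto_interior hq
  rw [S.chart.right_inv hus.1] at hy3
  refine hy3.frequently (Filter.Eventually.frequently ?_)
  filter_upwards [hy1, hy2.eventually (S.chart.open_source.mem_nhds hq),
    hy2.eventually (S'.chart.open_source.mem_nhds hus.2)] with t h1 h2 h3
  obtain ⟨ha, -, hc⟩ := S.exists_analytic_interior h1 h2
  obtain ⟨ha', hd', hc'⟩ := S'.exists_analytic_interior h1 h3
  set v := S.chart (G.proj (y t)) with hv
  have hvs : S.chart.symm v = G.proj (y t) := S.chart.left_inv h2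
  have hT' : AnalyticAt ℂ (S'.chart ∘ S.chart.symm) v := by
    apply S.analyticAt_transition S'
    rw [OpenPartialHomeomorph.trans_source, OpenPartialHomeomorph.symm_source]
    exact ⟨S.chart.map_source h2, by rw [Set.mem_preimage, hvs]; exact h3⟩
  have hchain : deriv (S'.chart ∘ S.chart.symm) v * deriv (fun w => S.chart (G.proj w)) (y t) =
      deriv (fun w => S'.chart (G.proj w)) (y t) := by
    have h4 : (fun w => S'.chart (G.proj w)) =ᶠ[𝓝 (y t)]
        (S'.chart ∘ S.chart.symm) ∘ fun w => S.chart (G.proj w) := by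
      filter_upwards [(continuous_proj (G := G)).continuousAt.eventually
        (S.chart.open_source.mem_nhds h2)] with w hw
      simp [S.chart.left_inv hw]
    rw [h4.deriv_eq]
    exact (HasDerivAt.comp (y t) hT'.differentiableAt.hasDerivAt
      ha.differentiableAt.hasDerivAt).deriv.symm
  rw [hvs]
  have h5 : deriv (fun w => S.chart (G.proj w)) (y t) ≠ 0 := by
    intro h; rw [h] at hc; simp at hc
  apply mul_right_cancel₀ (pow_ne_zero 2 h5)
  rw [hc, mul_assoc, ← mul_pow, hchain, hc']

variable (G) in
/-- The quadratic differential induced by `(dz)²` on the glued surface. -/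
noncomputable def differential : MeromorphicQuadraticDifferential G.Surface where
  -- A chart of the atlas is centred: the point with coordinate `0` recovers its star.
  coeff e := (star (e.symm 0)).coef
  meromorphicOn := fun _ _ u _ => Star.coef_mero _ u
  transform := by
    rintro _ ⟨q, rfl⟩ _ ⟨q', rfl⟩ u hu
    rw [star_chart_symm_zero, star_chart_symm_zero]
    exact (star q).transform (star q') hu

theorem coeff_star (q : G.Surface) : G.differential.coeff (star q).chart = (star q).coef := by
  show (star _).coef = _
  rw [star_chart_symm_zero]

variable (G) in
/-- The glued surface with its quadratic differential. -/
noncomputable def quadraticSurface : QuadraticSurface where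
  carrier := G.Surface
  differential := G.differential

theorem order_eq (q : G.Surface) : G.differential.order q = ((star q).ord : WithTop ℤ) := by
  unfold MeromorphicQuadraticDifferential.order
  show meromorphicOrderAt (G.differential.coeff (star q).chart) ((star q).chart q) = _
  have : (star q).chart q = 0 := by
    have := (star q).chart_center
    rwa [center_star] at this
  rw [coeff_star, this, Star.coef_ord]

theorem order_interior {z : ℂ} (h : z ∈ G.interiorStrip) : G.differential.order (G.proj z) = 0 := by
  rw [order_eq, ord_star_interior h]; rfl

theorem order_lift {b : G.Bd} {z : ℂ} (h : b.Lift G z) : G.differential.order (G.proj z) =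
    (((Function.minimalPeriod next b : ℤ) - 2 : ℤ) : WithTop ℤ) := by
  rw [order_eq, ord_star_lift h]

theorem order_edge {b : G.Bd} {z : ℂ} (h : b.Lift G z) (hb : b.pos ≠ 0) :
    G.differential.order (G.proj z) = 0 := by
  rw [order_lift h, minimalPeriod_of_pos_ne hb]; rfl

theorem pullback {z : ℂ} (hz : z ∈ G.interiorStrip) {e : OpenPartialHomeomorph G.Surface ℂ}
    (he : e ∈ atlas ℂ G.Surface) (hs : G.proj z ∈ e.source) :
    G.differential.coeff e (e (G.proj z)) * deriv (fun w => e (G.proj w)) z ^ 2 = 1 := by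
  obtain ⟨q, rfl⟩ := he
  rw [coeff_star]
  exact ((star q).exists_analytic_interior hz hs).2.2

/-! ### The obstruction to being a global square. -/

section square

variable (η : AbelianDifferential G.Surface)

/-- The pull-back of an Abelian differential to the strip. -/
noncomputable def pullbackAbelian (z : ℂ) : ℂ :=
  η.coeff (star (G.proj z)).chart ((star (G.proj z)).chart (G.proj z)) *
    deriv (fun w => (star (G.proj z)).chart (G.proj w)) z

variable {η}

theorem mem_star_source (q : G.Surface) : q ∈ (star q).chart.source := by
  have := (star q).center_mem_source
  rwa [center_star] at this

theorem pullbackAbelian_eq {z : ℂ} (hz : z ∈ G.interiorStrip) {q : G.Surface}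
    (hs : G.proj z ∈ (star q).chart.source) :
    η.coeff (star q).chart ((star q).chart (G.proj z)) *
      deriv (fun w => (star q).chart (G.proj w)) z = pullbackAbelian η z := by
  unfold pullbackAbelian
  set S := star q
  set S' := star (G.proj z)
  have hs' : G.proj z ∈ S'.chart.source := mem_star_source _
  set v := S.chart (G.proj z) with hv
  have hvs : S.chart.symm v = G.proj z := S.chart.left_inv hs
  have hmem : v ∈ (S.chart.symm.trans S'.chart).source := by
    rw [OpenPartialHomeomorph.trans_source, OpenPartialHomeomorph.symm_source]
    exact ⟨S.chart.map_source hs, by rw [Set.mem_preimage, hvs]; exact hs'⟩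
  have ht := η.transform S.chart ⟨q, rfl⟩ S'.chart ⟨G.proj z, rfl⟩ v hmem
  have hT' := S.analyticAt_transition S' hmem
  have hchain : deriv (S'.chart ∘ S.chart.symm) v * deriv (fun w => S.chart (G.proj w)) z =
      deriv (fun w => S'.chart (G.proj w)) z := by
    have h4 : (fun w => S'.chart (G.proj w)) =ᶠ[𝓝 z]
        (S'.chart ∘ S.chart.symm) ∘ fun w => S.chart (G.proj w) := by
      filter_upwards [(continuous_proj (G := G)).continuousAt.eventually
        (S.chart.open_source.mem_nhds hs)] with w hw
      simp [S.chart.left_inv hw]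
    rw [h4.deriv_eq]
    exact (HasDerivAt.comp z hT'.differentiableAt.hasDerivAt
      (S.exists_analytic_interior hz hs).1.differentiableAt.hasDerivAt).deriv.symm
  rw [ht, hvs, mul_assoc, hchain]

theorem continuousAt_coeff {q x : G.Surface} (hs : x ∈ (star q).chart.source) :
    ContinuousAt (η.coeff (star q).chart) ((star q).chart x) :=
  ((η.holomorphicOn _ ⟨q, rfl⟩).differentiableAt
    ((star q).chart.open_target.mem_nhds ((star q).chart.map_source hs))).continuousAt

theorem continuousOn_pullbackAbelian : ContinuousOn (pullbackAbelian η) G.interiorStrip := by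
  intro z hz
  apply ContinuousAt.continuousWithinAt
  have hs := mem_star_source (G.proj z)
  set S := star (G.proj z)
  have h1 : pullbackAbelian η =ᶠ[𝓝 z] fun w => η.coeff S.chart (S.chart (G.proj w)) *
      deriv (fun w => S.chart (G.proj w)) w := by
    filter_upwards [isOpen_interiorStrip.mem_nhds hz,
      (continuous_proj (G := G)).continuousAt.eventually
        (S.chart.open_source.mem_nhds hs)] with w hw hw'
    exact (pullbackAbelian_eq hw hw').symm
  refine ContinuousAt.congr ?_ h1.symm
  have h2 := (S.exists_analytic_interior hz hs).1
  exact (ContinuousAt.comp (f := fun w => S.chart (G.proj w)) (continuousAt_coeff hs)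
    h2.continuousAt).mul h2.deriv.continuousAt

/-- The equation for the square is only given off isolated points; continuity of the pulled-back
form extends it to all of the open strip. -/
theorem pullbackAbelian_sq (hη : ∀ e ∈ atlas ℂ G.Surface, ∀ z ∈ e.target,
    ∀ᶠ w in 𝓝[≠] z, G.differential.coeff e w = η.coeff e w ^ 2) {z : ℂ} (hz : z ∈ G.interiorStrip) :
    pullbackAbelian η z ^ 2 = 1 := by
  have hs := mem_star_source (G.proj z)
  set S := star (G.proj z) with hS
  obtain ⟨ha, hd, -⟩ := S.exists_analytic_interior hz hs
  have h1 := hη S.chart ⟨G.proj z, rfl⟩ _ (S.chart.map_source hs)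
  have h2 : Filter.Tendsto (fun w => S.chart (G.proj w)) (𝓝[≠] z) (𝓝[≠] (S.chart (G.proj z))) :=
    ha.differentiableAt.hasDerivAt.tendsto_nhdsNE hd
  have h3 : ∀ᶠ w in 𝓝[≠] z, pullbackAbelian η w ^ 2 = 1 := by
    filter_upwards [h2.eventually h1, (isOpen_interiorStrip.mem_nhds hz |>
        Filter.Eventually.filter_mono nhdsWithin_le_nhds),
      ((continuous_proj (G := G)).continuousAt.eventually
        (S.chart.open_source.mem_nhds hs)).filter_mono nhdsWithin_le_nhds] with w h4 h5 h6
    rw [← pullbackAbelian_eq h5 h6, mul_pow, ← h4]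
    exact pullback h5 ⟨G.proj z, rfl⟩ h6
  have h4 := (continuousOn_pullbackAbelian (η := η)).continuousAt (isOpen_interiorStrip.mem_nhds hz)
  have h5 : Filter.Tendsto (fun w => pullbackAbelian η w ^ 2) (𝓝[≠] z)
      (𝓝 (pullbackAbelian η z ^ 2)) := (h4.pow 2).tendsto.mono_left nhdsWithin_le_nhds
  exact tendsto_nhds_unique h5 ((Filter.tendsto_congr' h3).2 tendsto_const_nhds)

theorem isPreconnected_interiorStrip : IsPreconnected G.interiorStrip := by
  have : Convex ℝ G.interiorStrip := by
    have h1 := (convex_Ioo (0 : ℝ) G.c.im).linear_preimage Complex.imLm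
    exact h1
  exact this.isPreconnected

end square

/-- If an edge is glued to an edge of the same boundary component, then the quadratic differential
is not the square of an Abelian differential. -/
theorem not_isGlobalSquare {e : G.E} (he : G.side (G.twin e) = G.side e) :
    ¬ G.differential.IsGlobalSquare := by
  rintro ⟨η, hη⟩
  have hsq : ∀ z ∈ G.interiorStrip, pullbackAbelian η z ^ 2 = 1 := fun z hz =>
    pullbackAbelian_sq hη hz
  -- The open strip is connected, so the continuous function with square `1` is constantly `1` or
  -- `-1`.
  obtain ⟨κ, hκ0, hκ⟩ : ∃ κ : ℂ, κ ≠ 0 ∧ ∀ z ∈ G.interiorStrip, pullbackAbelian η z = κ := by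
    rcases isPreconnected_interiorStrip.eq_one_or_eq_neg_one_of_sq_eq
      continuousOn_pullbackAbelian (fun z hz => by simpa using hsq z hz) with h | h
    · exact ⟨1, one_ne_zero, fun z hz => h hz⟩
    · exact ⟨-1, by norm_num, fun z hz => h hz⟩
  have hlen := G.len_pos e
  set b₀ : G.Bd := ⟨e, G.len e / 2, by linarith, by linarith⟩ with hb₀
  set S := star (G.proj (upper b₀ 0)) with hS
  have hs₀ : G.proj (upper b₀ 0) ∈ S.chart.source := mem_star_source _
  have hroom : b₀.room = G.len e / 2 := by simp [room, hb₀]; ring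
  -- The point is moved slightly along the edge, off the centre of the star, where the analytic
  -- extension across the edge applies.
  obtain ⟨t, ht0, htr, hts⟩ : ∃ t : ℝ, 0 < t ∧ t < b₀.room ∧
      G.proj (upper b₀ t) ∈ S.chart.source := by
    have h1 : ∀ᶠ t : ℝ in 𝓝 0, G.proj (upper b₀ t) ∈ S.chart.source := by
      have : Continuous fun t : ℝ => G.proj (upper b₀ t) :=
        continuous_proj.comp ((continuous_upper b₀).comp Complex.continuous_ofReal)
      refine this.continuousAt.eventually (S.chart.open_source.mem_nhds ?_)
      simpa using hs₀
    have h2 : ∀ᶠ t : ℝ in 𝓝[>] 0, 0 < t ∧ t < b₀.room ∧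
        G.proj (upper b₀ t) ∈ S.chart.source := by
      filter_upwards [self_mem_nhdsWithin, (h1.and (gt_mem_nhds b₀.room_pos)).filter_mono
        nhdsWithin_le_nhds] with t h3 h4 using ⟨h3, h4.2, h4.1⟩
    exact h2.exists
  set b := b₀.right t ht0.le htr with hb
  have hb0 : b.pos ≠ 0 := right_pos_ne _ ht0 htr
  have hbl : b.Lift G (upper b₀ t) := lift_right _ ht0.le htr
  have hproj : G.proj (upper b 0) = G.proj (upper b₀ t) := by
    rw [proj_eq_of_lift hbl, proj_eq_of_lift (lift_upper_zero b)]
  have hs : G.proj (upper b 0) ∈ S.chart.source := hproj ▸ hts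
  have hne : S.chart (G.proj (upper b 0)) ≠ 0 := by
    intro h
    have h0 : S.chart (G.proj (upper b₀ 0)) = 0 := by
      have := S.chart_center
      rwa [hS, center_star] at this
    have h1 := S.chart.injOn hs₀ hs (h0.trans h.symm)
    obtain ⟨i, hi⟩ := rel_of_lift (lift_upper_zero b₀) ((proj_eq_iff (lift_upper_zero b₀).mem_strip
      (lift_upper_zero b).mem_strip).1 h1)
    have h2 := hi.eq (lift_upper_zero b)
    have hb₀0 : b₀.pos ≠ 0 := by simp only [hb₀]; linarith
    rcases iterate_of_pos_ne hb₀0 i with h' | h' <;> rw [h'] at h2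
    · have := congrArg Bd.pos h2
      simp [hb, right] at this
      exact ht0.ne' this
    · have := congrArg Bd.edge h2
      rw [(next_of_pos_ne hb₀0).1] at this
      exact G.twin_ne e this
  obtain ⟨K, hK, -, hKu, hKl⟩ := S.exists_analytic_boundary hb0 hs hne
  have hside : b.next.side = b.side := by rw [side_next]; exact he
  obtain ⟨σ, hσ0, hσ⟩ : ∃ σ : ℂ, σ ≠ 0 ∧ σ = if b.side then -1 else 1 :=
    ⟨_, by split_ifs <;> norm_num, rfl⟩
  have hK0 : K 0 = S.chart (G.proj (upper b 0)) := (hKu.self_of_nhds (by simp)).symm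
  have hcont : ContinuousAt (fun w => η.coeff S.chart (K w) * deriv K w) 0 := by
    refine ContinuousAt.mul ?_ hK.deriv.continuousAt
    refine ContinuousAt.comp (f := K) ?_ hK.continuousAt
    rw [hK0]
    exact continuousAt_coeff hs
  -- the pulled back form along an affine parametrization of a half-disc
  have key : ∀ (A : ℂ → ℂ) (τ : ℂ) (w : ℂ), HasDerivAt A τ w → A w ∈ G.interiorStrip →
      G.proj (A w) ∈ S.chart.source → (∀ᶠ v in 𝓝 w, S.chart (G.proj (A v)) = K v) →
      η.coeff S.chart (K w) * deriv K w = κ * τ := by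
    intro A τ w hA hAi hAs hAK
    rw [← hκ _ hAi, ← pullbackAbelian_eq hAi hAs, ← Filter.EventuallyEq.deriv_eq hAK,
      ← hAK.self_of_nhds]
    have h1 := (S.exists_analytic_interior hAi hAs).1.differentiableAt.hasDerivAt.comp w hA
    have h2 : deriv (fun v => S.chart (G.proj (A v))) w =
      deriv (fun w => S.chart (G.proj w)) (A w) * τ := h1.deriv
    rw [h2]; ring
  have hI : Filter.Tendsto (fun t : ℝ => (t : ℂ) * Complex.I) (𝓝[>] 0) (𝓝 0) := by
    have : Continuous fun t : ℝ => (t : ℂ) * Complex.I := by fun_prop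
    have := this.tendsto 0
    simp only [Complex.ofReal_zero, zero_mul] at this
    exact this.mono_left nhdsWithin_le_nhds
  have hup : Filter.Tendsto (fun t : ℝ => η.coeff S.chart (K (t * Complex.I)) *
      deriv K (t * Complex.I)) (𝓝[>] 0) (𝓝 (κ * σ)) := by
    refine (Filter.tendsto_congr' ?_).2 tendsto_const_nhds
    have h1 := hI.eventually hKu.eventually_nhds
    have h2 := hI.eventually (eventually_upper_mem b)
    have h3 := hI.eventually ((continuous_proj.comp (continuous_upper b)).continuousAt.eventually
      (S.chart.open_source.mem_nhds hs))
    filter_upwards [h1, h2, h3, self_mem_nhdsWithin] with t h1 h2 h3 ht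
    have ht' : 0 < ((t : ℂ) * Complex.I).im := by simpa using ht
    refine key (upper b) σ _ (hσ ▸ hasDerivAt_upper b _) (h2.2 ht') h3 ?_
    filter_upwards [h1, Complex.continuous_im.continuousAt.eventually (lt_mem_nhds ht')]
      with v h4 h5 using h4 h5.le
  have hIn : Filter.Tendsto (fun t : ℝ => -((t : ℂ) * Complex.I)) (𝓝[>] 0) (𝓝 0) := by
    simpa using hI.neg
  have hlow : Filter.Tendsto (fun t : ℝ => η.coeff S.chart (K (-(t * Complex.I))) *
      deriv K (-(t * Complex.I))) (𝓝[>] 0) (𝓝 (κ * -σ)) := by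
    refine (Filter.tendsto_congr' ?_).2 tendsto_const_nhds
    have h1 := hIn.eventually hKl.eventually_nhds
    have h2 := hIn.eventually (eventually_lower_mem b)
    have h3 := hIn.eventually ((continuous_proj.comp (continuous_lower b)).continuousAt.eventually
      (S.chart.open_source.mem_nhds (by rw [Function.comp_apply, ← proj_upper_zero]; exact hs)))
    filter_upwards [h1, h2, h3, self_mem_nhdsWithin] with t h1 h2 h3 ht
    have ht' : (-((t : ℂ) * Complex.I)).im < 0 := by simpa using ht
    refine key (lower b) (-σ) _ ?_ (h2.2 ht') h3 ?_
    · have := hasDerivAt_lower b (-((t : ℂ) * Complex.I))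
      rwa [hside, ← hσ] at this
    · filter_upwards [h1, Complex.continuous_im.continuousAt.eventually (gt_mem_nhds ht')]
        with v h4 h5 using h4 h5.le
  have e1 := tendsto_nhds_unique hup (hcont.tendsto.comp hI)
  have e2 := tendsto_nhds_unique hlow (hcont.tendsto.comp hIn)
  -- On twins of the same side the affine parametrizations of the two half-discs have opposite
  -- derivatives, while the form on the surface is continuous across the edge.
  have e3 : κ * σ = κ * -σ := e1.trans e2.symm
  have e4 : κ * σ = 0 := by linear_combination e3 / 2
  exact mul_ne_zero hκ0 hσ0 e4

end GluedCylinder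

/-! ### Partial sums along a word and the cyclic order. -/

namespace List

variable {E : Type} (f : E → ℝ)

/-- The sum of the weights of the first `i` entries. -/
def partialSum (l : List E) (i : ℕ) : ℝ := ((l.take i).map f).sum

variable {f} {l : List E}

theorem partialSum_zero : l.partialSum f 0 = 0 := by simp [partialSum]

theorem partialSum_length : l.partialSum f l.length = (l.map f).sum := by simp [partialSum]

theorem partialSum_succ {i : ℕ} (hi : i < l.length) :
    l.partialSum f (i + 1) = l.partialSum f i + f l[i] := by
  rw [partialSum, partialSum, List.take_succ_eq_append_getElem hi, List.map_append,
    List.sum_append]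
  simp

theorem partialSum_mono (hf : ∀ e, 0 < f e) {i j : ℕ} (h : i ≤ j) :
    l.partialSum f i ≤ l.partialSum f j := by
  induction j, h using Nat.le_induction with
  | base => exact le_rfl
  | succ j _ ih =>
    refine ih.trans ?_
    by_cases hj : j < l.length
    · rw [partialSum_succ hj]; linarith [hf l[j]]
    · push Not at hj
      rw [partialSum, partialSum, List.take_of_length_le hj, List.take_of_length_le (by omega)]

theorem exists_partialSum_le_lt {x : ℝ} (h0 : 0 ≤ x) (hx : x < (l.map f).sum) :
    ∃ i, i < l.length ∧ l.partialSum f i ≤ x ∧ x < l.partialSum f (i + 1) := by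
  by_contra! hc
  have : ∀ i ≤ l.length, l.partialSum f i ≤ x := by
    intro i
    induction i with
    | zero => intro _; rwa [partialSum_zero]
    | succ i ih => intro hi; exact hc i hi (ih (by omega))
  have := this _ le_rfl
  rw [partialSum_length] at this
  linarith

theorem eq_of_partialSum (hf : ∀ e, 0 < f e) {x : ℝ} {i j : ℕ} (hi : l.partialSum f i ≤ x)
    (hi' : x < l.partialSum f (i + 1)) (hj : l.partialSum f j ≤ x)
    (hj' : x < l.partialSum f (j + 1)) : i = j := by
  rcases lt_trichotomy i j with h | h | h
  · have := partialSum_mono (l := l) hf (show i + 1 ≤ j from h); linarith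
  · exact h
  · have := partialSum_mono (l := l) hf (show j + 1 ≤ i from h); linarith

theorem partialSum_nonneg (hf : ∀ e, 0 < f e) (i : ℕ) : 0 ≤ l.partialSum f i := by
  rw [← partialSum_zero (f := f) (l := l)]
  exact partialSum_mono hf (Nat.zero_le _)

theorem partialSum_le (hf : ∀ e, 0 < f e) {i : ℕ} (hi : i ≤ l.length) :
    l.partialSum f i ≤ (l.map f).sum := by
  rw [← partialSum_length]
  exact partialSum_mono hf hi

theorem partialSum_reverse (i : ℕ) :
    l.reverse.partialSum f i = (l.map f).sum - l.partialSum f (l.length - i) := by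
  have h : ((l.take (l.length - i)).map f).sum + ((l.drop (l.length - i)).map f).sum =
      (l.map f).sum := by
    rw [← List.sum_append, ← List.map_append, List.take_append_drop]
  rw [partialSum, List.take_reverse, List.map_reverse, List.sum_reverse, partialSum]
  linarith

variable [DecidableEq E]

theorem exists_start_formPerm (hl : l.Nodup) {e : E} (he : e ∈ l) :
    ∃ n : ℤ, l.partialSum f (l.idxOf (l.formPerm e)) =
      l.partialSum f (l.idxOf e) + f e + n * (l.map f).sum := by
  obtain ⟨i, hi, rfl⟩ := List.getElem_of_mem he
  rw [List.formPerm_apply_getElem _ hl, hl.idxOf_getElem, hl.idxOf_getElem, ← partialSum_succ hi]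
  by_cases h : i + 1 < l.length
  · rw [Nat.mod_eq_of_lt h]
    exact ⟨0, by simp⟩
  · have h' : i + 1 = l.length := by omega
    rw [h', Nat.mod_self, partialSum_zero, partialSum_length]
    -- After the last entry the coordinate returns to `0`, which costs one full turn.
    exact ⟨-1, by simp⟩

end List

/-! ### Oriented edges of a generalized permutation and the associated cylinder. -/

namespace TwoLines

/-- A presentation of a generalized permutation, whose top line starts and whose bottom line ends
with `a`, by means of words `B`, `T` without repetitions in an alphabet `E` of oriented edges; the
top line is read from right to left. -/
structure Tagging (π : TwoLines) (a : ℕ) where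
  E : Type
  [fintypeE : Fintype E]
  [decEqE : DecidableEq E]
  B : List E
  T : List E
  sym : E → ℕ
  twin : E → E
  nodup : (B ++ T).Nodup
  mem : ∀ e, e ∈ B ∨ e ∈ T
  bot_eq : π.bot = B.map sym ++ [a]
  top_eq : π.top = a :: T.reverse.map sym
  sym_ne : ∀ e, sym e ≠ a
  sym_eq_iff : ∀ e e', sym e = sym e' ↔ e' = e ∨ e' = twin e
  twin_ne : ∀ e, twin e ≠ e
  B_ne : B ≠ []

attribute [instance] Tagging.fintypeE Tagging.decEqE

namespace Tagging

variable {π : TwoLines} {a : ℕ} (τ : π.Tagging a)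

/-- The cyclic successor of an edge on its boundary component. -/
def succ : Equiv.Perm τ.E := τ.B.formPerm * τ.T.formPerm

variable {τ}

theorem sym_twin (e : τ.E) : τ.sym (τ.twin e) = τ.sym e :=
  ((τ.sym_eq_iff e _).2 (Or.inr rfl)).symm

theorem twin_twin (e : τ.E) : τ.twin (τ.twin e) = e := by
  rcases (τ.sym_eq_iff (τ.twin e) e).1 (sym_twin e) with h | h
  · exact absurd h.symm (τ.twin_ne e)
  · exact h.symm

theorem nodup_B : τ.B.Nodup := τ.nodup.of_append_left

theorem nodup_T : τ.T.Nodup := τ.nodup.of_append_right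

theorem notMem_T {e : τ.E} (h : e ∈ τ.B) : e ∉ τ.T := fun h' =>
  List.disjoint_of_nodup_append τ.nodup h h'

theorem mem_T_iff {e : τ.E} : e ∈ τ.T ↔ e ∉ τ.B :=
  ⟨fun h h' => notMem_T h' h, fun h => (τ.mem e).resolve_left h⟩

theorem succ_of_mem_B {e : τ.E} (h : e ∈ τ.B) : τ.succ e = τ.B.formPerm e := by
  rw [succ, Equiv.Perm.mul_apply, List.formPerm_apply_of_notMem (notMem_T h)]

theorem succ_of_mem_T {e : τ.E} (h : e ∈ τ.T) : τ.succ e = τ.T.formPerm e := by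
  rw [succ, Equiv.Perm.mul_apply, List.formPerm_apply_of_notMem]
  exact mem_T_iff.1 (List.formPerm_mem_iff_mem.2 h)

variable (τ) in
/-- The boundary component of an edge. -/
def side (e : τ.E) : Bool := decide (e ∉ τ.B)

variable (τ) in
/-- The word of a boundary component. -/
def word (s : Bool) : List τ.E := if s then τ.T else τ.B

theorem mem_word {e : τ.E} {s : Bool} : e ∈ τ.word s ↔ τ.side e = s := by
  cases s
  · simp [word, side]
  · simp [word, side, mem_T_iff]

theorem nodup_word (s : Bool) : (τ.word s).Nodup := by
  cases s
  · exact nodup_B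
  · exact nodup_T

theorem succ_eq (e : τ.E) : τ.succ e = (τ.word (τ.side e)).formPerm e := by
  have h : e ∈ τ.word (τ.side e) := mem_word.2 rfl
  cases hs : τ.side e <;> rw [hs] at h
  · exact succ_of_mem_B h
  · exact succ_of_mem_T h

theorem side_succ (e : τ.E) : τ.side (τ.succ e) = τ.side e := by
  rw [← mem_word, succ_eq, List.formPerm_mem_iff_mem, mem_word]

variable (τ) in
/-- The length of an edge. -/
def len (ζ : ℕ → ℂ) (e : τ.E) : ℝ := (ζ (τ.sym e)).re

variable (τ) in
/-- The initial coordinate of an edge on its boundary component. -/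
def start (ζ : ℕ → ℂ) (e : τ.E) : ℝ :=
  (τ.word (τ.side e)).partialSum (τ.len ζ) ((τ.word (τ.side e)).idxOf e)

variable (τ) in
/-- The circumference of the cylinder. -/
def circ (ζ : ℕ → ℂ) : ℝ := (τ.B.map (τ.len ζ)).sum

variable {ζ : ℕ → ℂ}

theorem sym_mem (e : τ.E) : τ.sym e ∈ π.top ++ π.bot := by
  rw [τ.top_eq, τ.bot_eq]
  rcases τ.mem e with h | h
  · simp only [List.mem_append, List.mem_map]
    exact Or.inr (Or.inl ⟨e, h, rfl⟩)
  · simp only [List.mem_append, List.mem_cons, List.mem_map, List.mem_reverse]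
    exact Or.inl (Or.inr ⟨e, h, rfl⟩)

theorem len_pos (h : π.IsSuspensionDatum a ζ) (e : τ.E) : 0 < τ.len ζ e :=
  (h.horizontal _ (sym_mem e) (τ.sym_ne e)).1

theorem ofReal_len (h : π.IsSuspensionDatum a ζ) (e : τ.E) : (τ.len ζ e : ℂ) = ζ (τ.sym e) :=
  Complex.ext (by simp [len]) (by simp [(h.horizontal _ (sym_mem e) (τ.sym_ne e)).2])

theorem sum_map (h : π.IsSuspensionDatum a ζ) (l : List τ.E) :
    ((l.map τ.sym).map ζ).sum = ((l.map (τ.len ζ)).sum : ℝ) := by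
  induction l with
  | nil => simp
  | cons e l ih =>
    simp only [List.map_cons, List.sum_cons, ih, Complex.ofReal_add, ofReal_len h]

theorem sum_bot (h : π.IsSuspensionDatum a ζ) : (π.bot.map ζ).sum = τ.circ ζ + ζ a := by
  rw [τ.bot_eq, List.map_append, List.sum_append, sum_map h]
  simp [circ]

theorem sum_word (h : π.IsSuspensionDatum a ζ) (s : Bool) :
    ((τ.word s).map (τ.len ζ)).sum = τ.circ ζ := by
  cases s
  · rfl
  · have h1 := h.closing
    rw [sum_bot h, τ.top_eq, List.map_cons, List.sum_cons, sum_map h, List.map_reverse,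
      List.sum_reverse, add_comm] at h1
    exact_mod_cast add_right_cancel h1

theorem circ_pos (h : π.IsSuspensionDatum a ζ) : 0 < τ.circ ζ := by
  apply List.sum_pos
  · intro x hx
    obtain ⟨e, _, rfl⟩ := List.mem_map.1 hx
    exact len_pos h e
  · simpa using τ.B_ne

theorem start_getElem {s : Bool} {i : ℕ} (hi : i < (τ.word s).length) :
    τ.start ζ (τ.word s)[i] = (τ.word s).partialSum (τ.len ζ) i := by
  have : τ.side (τ.word s)[i] = s := mem_word.1 (List.getElem_mem hi)
  unfold start
  rw [this, (nodup_word s).idxOf_getElem]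

theorem start_add_len {s : Bool} {i : ℕ} (hi : i < (τ.word s).length) :
    τ.start ζ (τ.word s)[i] + τ.len ζ (τ.word s)[i] =
      (τ.word s).partialSum (τ.len ζ) (i + 1) := by
  rw [start_getElem, List.partialSum_succ hi]

theorem exists_getElem (e : τ.E) : ∃ i, ∃ hi : i < (τ.word (τ.side e)).length,
    (τ.word (τ.side e))[i] = e := List.getElem_of_mem (mem_word.2 rfl)

theorem start_nonneg (h : π.IsSuspensionDatum a ζ) (e : τ.E) : 0 ≤ τ.start ζ e :=
  List.partialSum_nonneg (len_pos h) _

theorem start_add_len_le (h : π.IsSuspensionDatum a ζ) (e : τ.E) :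
    τ.start ζ e + τ.len ζ e ≤ τ.circ ζ := by
  obtain ⟨i, hi, hie⟩ := exists_getElem e
  have := start_add_len (ζ := ζ) hi
  rw [hie] at this
  rw [this, ← sum_word h (τ.side e)]
  exact List.partialSum_le (len_pos h) hi

theorem int_eq_of_mem_Ico {L x : ℝ} {n n' : ℤ} (h1 : 0 ≤ x + n * L) (h2 : x + n * L < L)
    (h3 : 0 ≤ x + n' * L) (h4 : x + n' * L < L) : n = n' := by
  have hL : 0 < L := h1.trans_lt h2
  by_contra hne
  rcases lt_or_gt_of_ne hne with h | h
  · have : (n : ℝ) + 1 ≤ n' := by exact_mod_cast h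
    nlinarith
  · have : (n' : ℝ) + 1 ≤ n := by exact_mod_cast h
    nlinarith

variable (τ) in
/-- The glued cylinder of a suspension datum. -/
noncomputable def cylinder (h : π.IsSuspensionDatum a ζ) : GluedCylinder where
  E := τ.E
  side := τ.side
  start := τ.start ζ
  len := τ.len ζ
  twin := τ.twin
  succ := τ.succ
  L := τ.circ ζ
  -- The common right endpoint of the two broken lines; from here the upper boundary runs to the
  -- left.
  c := τ.circ ζ + ζ a
  L_pos := circ_pos h
  c_pos := by simpa using h.im_pos
  len_pos := len_pos h
  twin_twin := twin_twin
  twin_ne := τ.twin_ne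
  len_twin e := by unfold len; rw [sym_twin]
  side_succ := side_succ
  start_succ e := by
    have h1 := List.exists_start_formPerm (f := τ.len ζ) (nodup_word (τ.side e))
      (mem_word.2 rfl : e ∈ τ.word (τ.side e))
    rw [sum_word h, ← succ_eq] at h1
    unfold start
    rw [side_succ]
    exact h1
  cover s x := by
    have hL := circ_pos (τ := τ) h
    obtain ⟨n, h1, h2⟩ : ∃ n : ℤ, 0 ≤ x + n * τ.circ ζ ∧ x + n * τ.circ ζ < τ.circ ζ := by
      refine ⟨-⌊x / τ.circ ζ⌋, ?_, ?_⟩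
      · have := (le_div_iff₀ hL).1 (Int.floor_le (x / τ.circ ζ))
        push_cast; linarith
      · have := (div_lt_iff₀ hL).1 (Int.lt_floor_add_one (x / τ.circ ζ))
        push_cast; linarith
    obtain ⟨i, hi, h3, h4⟩ := List.exists_partialSum_le_lt (l := τ.word s) (f := τ.len ζ) h1
      (by rwa [sum_word h])
    refine ⟨(τ.word s)[i], n, mem_word.1 (List.getElem_mem hi), ?_, ?_⟩
    · rwa [start_getElem]
    · rwa [start_add_len]
  unique e e' x n n' hs h1 h2 h3 h4 := by
    have hn : n = n' := int_eq_of_mem_Ico ((start_nonneg h e).trans h1)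
      (h2.trans_le (start_add_len_le h e)) ((start_nonneg h e').trans h3)
      (h4.trans_le (start_add_len_le h e'))
    subst hn
    obtain ⟨i, hi, hie⟩ := exists_getElem e
    obtain ⟨j, hj, hje⟩ := exists_getElem e'
    generalize hse : τ.side e = s at hi hie
    generalize hse' : τ.side e' = s' at hj hje
    obtain rfl : s = s' := hse.symm.trans (hs.trans hse')
    subst hie hje
    rw [start_getElem] at h1 h3
    rw [start_add_len] at h2 h4
    have := List.eq_of_partialSum (len_pos h) h1 h2 h3 h4
    subst this
    exact ⟨rfl, rfl⟩

end Tagging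

end TwoLines

/-! ### Comparison of the glued cylinder with the glued parallelogram. -/

namespace TwoLines.Tagging

open GluedCylinder GluedCylinder.Bd

variable {π : TwoLines} {a : ℕ} {τ : π.Tagging a} {ζ : ℕ → ℂ}

/-- The point dividing an edge in the ratio `t : 1 - t`. -/
noncomputable def edgePt (h : π.IsSuspensionDatum a ζ) (e : τ.E) (t : ℝ) : ℂ :=
  (τ.cylinder h).emb (τ.side e) ((τ.start ζ e + t * τ.len ζ e : ℝ) : ℂ)

theorem bot_getElem {j k : ℕ} (hj : π.bot[j]? = some k) :
    (j = τ.B.length ∧ k = a) ∨ ∃ hj : j < τ.B.length, τ.sym τ.B[j] = k := by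
  rw [τ.bot_eq, List.getElem?_append] at hj
  split_ifs at hj with h
  · rw [List.length_map] at h
    right
    refine ⟨h, ?_⟩
    simpa [h] using hj
  · rw [List.length_map] at h hj
    left
    rw [List.getElem?_eq_some_iff] at hj
    obtain ⟨h1, h2⟩ := hj
    simp at h1
    refine ⟨by omega, ?_⟩
    rw [← h2]; simp

theorem top_getElem {i k : ℕ} (hi : π.top[i]? = some k) :
    (i = 0 ∧ k = a) ∨ ∃ i', i = i' + 1 ∧ ∃ hi : τ.T.length - 1 - i' < τ.T.length, i' < τ.T.length ∧
      τ.sym τ.T[τ.T.length - 1 - i'] = k := by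
  rw [τ.top_eq] at hi
  cases i with
  | zero => left; simpa [eq_comm] using hi
  | succ i' =>
    right
    refine ⟨i', rfl, ?_⟩
    rw [List.getElem?_cons_succ, List.getElem?_map, Option.map_eq_some_iff] at hi
    obtain ⟨e, h1, h2⟩ := hi
    obtain ⟨h3, h4⟩ := List.getElem?_eq_some_iff.1 h1
    rw [List.length_reverse] at h3
    rw [List.getElem_reverse] at h4
    exact ⟨by omega, h3, by rw [h4, h2]⟩

theorem sum_map_take (h : π.IsSuspensionDatum a ζ) (l : List τ.E) (j : ℕ) :
    (((l.map τ.sym).take j).map ζ).sum = (l.partialSum (τ.len ζ) j : ℝ) := by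
  rw [← List.map_take, sum_map h]; rfl

theorem vertex_bot (h : π.IsSuspensionDatum a ζ) {j : ℕ} (hj : j ≤ τ.B.length) :
    vertex π.bot ζ j = (τ.B.partialSum (τ.len ζ) j : ℝ) := by
  rw [vertex, τ.bot_eq, List.take_append_of_le_length (by simpa using hj), sum_map_take h]

theorem vertex_top (h : π.IsSuspensionDatum a ζ) (i : ℕ) :
    vertex π.top ζ (i + 1) =
      τ.circ ζ + ζ a - (τ.T.partialSum (τ.len ζ) (τ.T.length - i) : ℝ) := by
  rw [vertex, τ.top_eq, List.take_succ_cons, List.map_cons, List.sum_cons, sum_map_take h,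
    List.partialSum_reverse, ← sum_word h true]
  simp only [word, if_true, Complex.ofReal_sub]
  ring

theorem vertex_bot_add (h : π.IsSuspensionDatum a ζ) {j : ℕ} (hj : j < τ.B.length) (t : ℝ) :
    vertex π.bot ζ j + t * ζ (τ.sym τ.B[j]) = edgePt h τ.B[j] t := by
  have hs : τ.side τ.B[j] = false := mem_word.1 (List.getElem_mem hj : τ.B[j] ∈ τ.word false)
  rw [vertex_bot h hj.le, edgePt, hs, ← ofReal_len h]
  have : τ.start ζ τ.B[j] = τ.B.partialSum (τ.len ζ) j := start_getElem (s := false) hj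
  rw [this]
  simp [emb]

/-- The top broken line is traversed against the orientation of the upper boundary, hence the
parameter `1 - t` and the reversed index. -/
theorem vertex_top_add (h : π.IsSuspensionDatum a ζ) {i : ℕ} (hi : τ.T.length - 1 - i < τ.T.length)
    (hi' : i < τ.T.length) (t : ℝ) :
    vertex π.top ζ (i + 1) + t * ζ (τ.sym τ.T[τ.T.length - 1 - i]) =
      edgePt h τ.T[τ.T.length - 1 - i] (1 - t) := by
  have hs : τ.side τ.T[τ.T.length - 1 - i] = true :=
    mem_word.1 (List.getElem_mem hi : τ.T[τ.T.length - 1 - i] ∈ τ.word true)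
  have h1 := start_add_len (ζ := ζ) (s := true) hi
  rw [show τ.T.length - 1 - i + 1 = τ.T.length - i by omega] at h1
  rw [vertex_top h, edgePt, hs, ← ofReal_len h]
  simp only [word, if_true] at h1
  rw [← h1]
  simp only [emb, if_true]
  push_cast
  show _ = (τ.circ ζ + ζ a : ℂ) - _
  ring

theorem getElem_eq_twin {e e' : τ.E} (hs : τ.sym e = τ.sym e') (h : e ≠ e') : e' = τ.twin e :=
  ((τ.sym_eq_iff e e').1 hs).resolve_left (Ne.symm h)

theorem vertex_top_zero : vertex π.top ζ 0 = 0 := by simp [vertex]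

theorem vertex_bot_last (h : π.IsSuspensionDatum a ζ) :
    vertex π.bot ζ τ.B.length = τ.circ ζ := by
  rw [vertex_bot h le_rfl, List.partialSum_length]; rfl

/-- The symbol `a` closes the cylinder; for every other symbol, translations and central symmetries
both become `s ↦ 1 - s` from an edge to its twin. -/
theorem glued_cases (h : π.IsSuspensionDatum a ζ) {z w : ℂ} (hg : Glued π ζ z w) :
    (∃ t ∈ Set.Icc (0 : ℝ) 1, z = t * ζ a ∧ w = τ.circ ζ + t * ζ a) ∨
    ∃ (e : τ.E), ∃ s ∈ Set.Icc (0 : ℝ) 1, z = edgePt h e s ∧ w = edgePt h (τ.twin e) (1 - s) := by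
  have hsymm : ∀ {t : ℝ}, t ∈ Set.Icc (0 : ℝ) 1 → 1 - t ∈ Set.Icc (0 : ℝ) 1 := fun ht =>
    ⟨by linarith [ht.2], by linarith [ht.1]⟩
  cases hg with
  | translation i j k hi hj t ht =>
    rcases top_getElem (τ := τ) hi with ⟨rfl, rfl⟩ | ⟨i', rfl, hi1, hi2, rfl⟩
    · left
      rcases bot_getElem (τ := τ) hj with ⟨rfl, -⟩ | ⟨h1, h2⟩
      · exact ⟨t, ht, by rw [vertex_top_zero, zero_add], by rw [vertex_bot_last h]⟩
      · exact absurd h2 (τ.sym_ne _)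
    · right
      rcases bot_getElem (τ := τ) hj with ⟨rfl, h2⟩ | ⟨h1, h2⟩
      · exact absurd h2 (τ.sym_ne _)
      · refine ⟨_, 1 - t, hsymm ht, vertex_top_add h hi1 hi2 t, ?_⟩
        rw [← h2, vertex_bot_add h h1, sub_sub_cancel]
        congr 1
        refine getElem_eq_twin h2.symm fun he => ?_
        exact notMem_T (List.getElem_mem h1) (he ▸ List.getElem_mem hi1)
  | symmetryTop i j k hij hi hj t ht =>
    right
    rcases top_getElem (τ := τ) hi with ⟨rfl, rfl⟩ | ⟨i', rfl, hi1, hi2, rfl⟩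
    · rcases top_getElem (τ := τ) hj with ⟨rfl, -⟩ | ⟨j', rfl, hj1, hj2, h2⟩
      · exact absurd rfl hij
      · exact absurd h2 (τ.sym_ne _)
    · rcases top_getElem (τ := τ) hj with ⟨rfl, h2⟩ | ⟨j', rfl, hj1, hj2, h2⟩
      · exact absurd h2 (τ.sym_ne _)
      · refine ⟨_, 1 - t, hsymm ht, vertex_top_add h hi1 hi2 t, ?_⟩
        have := vertex_top_add h hj1 hj2 (1 - t)
        rw [h2] at this
        push_cast at this
        rw [this]
        congr 1
        refine getElem_eq_twin h2.symm fun he => hij ?_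
        have := (nodup_T.getElem_inj_iff).1 he
        omega
  | symmetryBot i j k hij hi hj t ht =>
    right
    rcases bot_getElem (τ := τ) hi with ⟨rfl, rfl⟩ | ⟨hi1, rfl⟩
    · rcases bot_getElem (τ := τ) hj with ⟨rfl, -⟩ | ⟨hj1, h2⟩
      · exact absurd rfl hij
      · exact absurd h2 (τ.sym_ne _)
    · rcases bot_getElem (τ := τ) hj with ⟨rfl, h2⟩ | ⟨hj1, h2⟩
      · exact absurd h2 (τ.sym_ne _)
      · refine ⟨_, t, ht, vertex_bot_add h hi1 t, ?_⟩
        have := vertex_bot_add h hj1 (1 - t)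
        rw [h2] at this
        push_cast at this
        rw [this]
        congr 1
        refine getElem_eq_twin h2.symm fun he => hij ?_
        exact (nodup_B.getElem_inj_iff).1 he

theorem bot_getElem_eq {j : ℕ} (hj : j < τ.B.length) : π.bot[j]? = some (τ.sym τ.B[j]) := by
  rw [τ.bot_eq, List.getElem?_append_left (by simpa using hj)]
  simp [hj]

theorem top_getElem_eq {i : ℕ} (hi : i < τ.T.length) :
    π.top[τ.T.length - 1 - i + 1]? = some (τ.sym τ.T[i]) := by
  rw [τ.top_eq, List.getElem?_cons_succ, List.getElem?_map,
    List.getElem?_reverse (by omega), show τ.T.length - 1 - (τ.T.length - 1 - i) = i by omega]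
  simp [hi]

theorem eqvGen_edge (h : π.IsSuspensionDatum a ζ) (e : τ.E) {s : ℝ} (hs : s ∈ Set.Icc (0 : ℝ) 1) :
    Relation.EqvGen (Glued π ζ) (edgePt h e s) (edgePt h (τ.twin e) (1 - s)) := by
  have hs' : 1 - s ∈ Set.Icc (0 : ℝ) 1 := ⟨by linarith [hs.2], by linarith [hs.1]⟩
  have htop : ∀ (i : ℕ) (hi : i < τ.T.length) (t : ℝ),
      vertex π.top ζ (τ.T.length - 1 - i + 1) + t * ζ (τ.sym τ.T[i]) = edgePt h τ.T[i] (1 - t) := by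
    intro i hi t
    have e1 : τ.T.length - 1 - (τ.T.length - 1 - i) = i := by omega
    have := vertex_top_add (τ := τ) h (i := τ.T.length - 1 - i) (by omega) (by omega) t
    simpa only [e1] using this
  have mixed : ∀ (e : τ.E), e ∈ τ.T → τ.twin e ∈ τ.B → ∀ s ∈ Set.Icc (0 : ℝ) 1,
      Relation.EqvGen (Glued π ζ) (edgePt h e s) (edgePt h (τ.twin e) (1 - s)) := by
    intro e he he' s hs
    have hs' : 1 - s ∈ Set.Icc (0 : ℝ) 1 := ⟨by linarith [hs.2], by linarith [hs.1]⟩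
    obtain ⟨i, hi, rfl⟩ := List.getElem_of_mem he
    obtain ⟨j, hj, hje⟩ := List.getElem_of_mem he'
    have h1 := bot_getElem_eq hj
    rw [hje, sym_twin] at h1
    have := Glued.translation (π := π) (ζ := ζ) _ j _ (top_getElem_eq hi) h1 (1 - s) hs'
    rw [htop i hi, sub_sub_cancel, ← sym_twin, ← hje, vertex_bot_add h hj, hje] at this
    exact Relation.EqvGen.rel _ _ this
  rcases τ.mem e with he | he <;> rcases τ.mem (τ.twin e) with he' | he'
  · obtain ⟨i, hi, rfl⟩ := List.getElem_of_mem he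
    obtain ⟨j, hj, hje⟩ := List.getElem_of_mem he'
    have h1 := bot_getElem_eq hj
    rw [hje, sym_twin] at h1
    have hij : i ≠ j := by
      rintro rfl
      exact τ.twin_ne _ hje.symm
    have := Glued.symmetryBot (π := π) (ζ := ζ) i j _ hij (bot_getElem_eq hi) h1 s hs
    have h2 := vertex_bot_add h hj (1 - s)
    rw [hje, sym_twin] at h2
    push_cast at h2
    rw [vertex_bot_add h hi, h2] at this
    exact Relation.EqvGen.rel _ _ this
  · have := mixed (τ.twin e) he' (by rwa [twin_twin]) (1 - s) hs'
    rw [twin_twin, sub_sub_cancel] at this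
    exact this.symm
  · exact mixed e he he' s hs
  · obtain ⟨i, hi, rfl⟩ := List.getElem_of_mem he
    obtain ⟨j, hj, hje⟩ := List.getElem_of_mem he'
    have h1 := top_getElem_eq hj
    rw [hje, sym_twin] at h1
    have hij : τ.T.length - 1 - i + 1 ≠ τ.T.length - 1 - j + 1 := by
      intro h'
      have : i = j := by omega
      subst this
      exact τ.twin_ne _ hje.symm
    have := Glued.symmetryTop (π := π) (ζ := ζ) _ _ _ hij (top_getElem_eq hi) h1 (1 - s) hs'
    have h2 := htop j hj (1 - (1 - s : ℝ))
    rw [hje, sym_twin] at h2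
    push_cast at h2
    push_cast at this
    have h3 := htop i hi (1 - s)
    push_cast at h3
    rw [h3, h2, sub_sub_cancel] at this
    exact Relation.EqvGen.rel _ _ this

theorem eqvGen_side (h : π.IsSuspensionDatum a ζ) {t : ℝ} (ht : t ∈ Set.Icc (0 : ℝ) 1) :
    Relation.EqvGen (Glued π ζ) (t * ζ a) (τ.circ ζ + t * ζ a) := by
  have h1 : π.top[0]? = some a := by rw [τ.top_eq]; rfl
  have h2 : π.bot[τ.B.length]? = some a := by
    rw [τ.bot_eq, List.getElem?_append_right (by simp)]; simp
  have := Glued.translation (π := π) (ζ := ζ) 0 τ.B.length a h1 h2 t ht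
  rw [vertex_top_zero, vertex_bot_last h, zero_add] at this
  exact Relation.EqvGen.rel _ _ this

theorem mem_pattern (h : π.IsSuspensionDatum a ζ) {z : ℂ} : z ∈ π.pattern a ζ ↔
    ∃ s ∈ Set.Icc (0 : ℝ) 1, ∃ t ∈ Set.Icc (0 : ℝ) 1, z = s * ζ a + (t * τ.circ ζ : ℝ) := by
  unfold pattern
  rw [sum_bot (τ := τ) h, add_sub_cancel_right]
  push_cast
  rfl

theorem pattern_subset (h : π.IsSuspensionDatum a ζ) : π.pattern a ζ ⊆ (τ.cylinder h).strip := by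
  intro z hz
  obtain ⟨s, hs, t, ht, rfl⟩ := (mem_pattern (τ := τ) h).1 hz
  have hi := h.im_pos
  have hc : (τ.cylinder h).c.im = (ζ a).im := by simp [cylinder]
  constructor
  · simp only [Complex.add_im, Complex.im_ofReal_mul, Complex.ofReal_im]
    nlinarith [hs.1]
  · rw [hc]
    simp only [Complex.add_im, Complex.im_ofReal_mul, Complex.ofReal_im]
    nlinarith [hs.2]

theorem interior_pattern_subset (h : π.IsSuspensionDatum a ζ) :
    interior (π.pattern a ζ) ⊆ (τ.cylinder h).interiorStrip := by
  refine (interior_mono (pattern_subset (τ := τ) h)).trans ?_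
  have : (τ.cylinder h).strip = {z | 0 ≤ z.im} ∩ {z | z.im ≤ (τ.cylinder h).c.im} := rfl
  rw [this, interior_inter, Complex.interior_setOfPred_le_im, Complex.interior_setOfPred_im_le]
  exact fun z hz => hz

/-- Two points of the parallelogram at distance `n` periods have `n = 0`, or `n` is `1` or `-1` and
they are opposite points of the two slanted sides. -/
theorem eqvGen_of_add (h : π.IsSuspensionDatum a ζ) {z : ℂ} {n : ℤ} (hz : z ∈ π.pattern a ζ)
    (hz' : z + n * τ.circ ζ ∈ π.pattern a ζ) :
    Relation.EqvGen (Glued π ζ) z (z + n * τ.circ ζ) := by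
  have hL := circ_pos (τ := τ) h
  obtain ⟨s, hs, t, ht, rfl⟩ := (mem_pattern (τ := τ) h).1 hz
  obtain ⟨s', hs', t', ht', he⟩ := (mem_pattern (τ := τ) h).1 hz'
  have him : s = s' := by
    have := congrArg Complex.im he
    simp at this
    rcases this with h1 | h1
    · exact h1
    · exact absurd h1 h.im_pos.ne'
  subst him
  have hre : t + n = t' := by
    have h1 : (((t + n) * τ.circ ζ : ℝ) : ℂ) = ((t' * τ.circ ζ : ℝ) : ℂ) := by
      push_cast at he ⊢
      linear_combination he
    have h2 : (t + n) * τ.circ ζ = t' * τ.circ ζ := by exact_mod_cast h1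
    exact mul_right_cancel₀ hL.ne' h2
  have hn : n = 0 ∨ n = 1 ∨ n = -1 := by
    have h1 : (n : ℝ) ≤ 1 := by linarith [ht'.2, ht.1]
    have h2 : -1 ≤ (n : ℝ) := by linarith [ht'.1, ht.2]
    have h1' : n ≤ 1 := by exact_mod_cast h1
    have h2' : -1 ≤ n := by exact_mod_cast h2
    omega
  have hside := eqvGen_side (τ := τ) h hs
  rcases hn with rfl | rfl | rfl
  · simp only [Int.cast_zero, zero_mul, add_zero]
    exact Relation.EqvGen.refl _
  · have h0 : t = 0 := by push_cast at hre; linarith [ht'.2, ht.1]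
    subst h0
    convert hside using 1
    · simp
    · simp; ring
  · have h0 : t = 1 := by push_cast at hre; linarith [ht'.1, ht.2]
    subst h0
    convert hside.symm using 1
    · simp; ring
    · simp

theorem proj_edgePt (h : π.IsSuspensionDatum a ζ) (e : τ.E) {s : ℝ} (hs : s ∈ Set.Icc (0 : ℝ) 1) :
    (τ.cylinder h).proj (edgePt h e s) = (τ.cylinder h).proj (edgePt h (τ.twin e) (1 - s)) := by
  have key : ∀ (e : τ.E) (s : ℝ), 0 ≤ s → s < 1 →
      (τ.cylinder h).proj (edgePt h e s) = (τ.cylinder h).proj (edgePt h (τ.twin e) (1 - s)) := by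
    intro e s h0 h1
    have hl := len_pos h e
    set b : (τ.cylinder h).Bd := ⟨e, s * τ.len ζ e, by positivity,
      show s * τ.len ζ e < τ.len ζ e by nlinarith⟩ with hb
    have hl1 : Lift (τ.cylinder h) b (edgePt h e s) := lift_self b
    have hl2 : Lift (τ.cylinder h) b.next (edgePt h (τ.twin e) (1 - s)) := by
      obtain ⟨n, hn⟩ := b.loc_next
      refine ⟨-n, ?_⟩
      rw [side_next, hn]
      unfold edgePt
      congr 2
      show τ.start ζ (τ.twin e) + (1 - s) * τ.len ζ (τ.twin e) =
        τ.start ζ (τ.twin e) + τ.len ζ e - s * τ.len ζ e + n * τ.circ ζ + (-n : ℤ) * τ.circ ζ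
      have : τ.len ζ (τ.twin e) = τ.len ζ e := (τ.cylinder h).len_twin e
      rw [this]; push_cast; ring
    exact (proj_eq_iff hl1.mem_strip hl2.mem_strip).2 (Or.inr ⟨b, 1, hl1, hl2⟩)
  -- The end `s = 1` is not in the half-open edge; it is treated as the initial point of the twin.
  rcases hs.2.lt_or_eq with h1 | rfl
  · exact key e s hs.1 h1
  · have := key (τ.twin e) 0 le_rfl one_pos
    rw [twin_twin, sub_zero] at this
    rw [sub_self]; exact this.symm

theorem proj_of_eqvGen (h : π.IsSuspensionDatum a ζ) {z w : ℂ}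
    (hg : Relation.EqvGen (Glued π ζ) z w) :
    (τ.cylinder h).proj z = (τ.cylinder h).proj w := by
  induction hg with
  | rel z w hg =>
    rcases glued_cases (τ := τ) h hg with ⟨t, _, rfl, rfl⟩ | ⟨e, s, hs, rfl, rfl⟩
    · have := proj_add_int (G := τ.cylinder h) (t * ζ a) 1
      rw [← this, Int.cast_one, one_mul, add_comm]; rfl
    · exact proj_edgePt h e hs
  | refl z => rfl
  | symm _ _ _ ih => exact ih.symm
  | trans _ _ _ _ _ ih1 ih2 => exact ih1.trans ih2

theorem edgePt_mem (h : π.IsSuspensionDatum a ζ) (e : τ.E) {s : ℝ} (hs : s ∈ Set.Icc (0 : ℝ) 1) :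
    edgePt h e s ∈ π.pattern a ζ := by
  have hL := circ_pos (τ := τ) h
  have hl := len_pos h e
  have h1 := start_nonneg h e
  have h2 := start_add_len_le h e
  have h3 : 0 ≤ τ.start ζ e + s * τ.len ζ e := by nlinarith [hs.1]
  have h4 : τ.start ζ e + s * τ.len ζ e ≤ τ.circ ζ := by nlinarith [hs.2]
  rw [mem_pattern (τ := τ) h]
  unfold edgePt
  have hc : (τ.cylinder h).c = τ.circ ζ + ζ a := rfl
  cases τ.side e
  · refine ⟨0, ⟨le_rfl, zero_le_one⟩, (τ.start ζ e + s * τ.len ζ e) / τ.circ ζ,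
      ⟨by positivity, (div_le_one hL).2 h4⟩, ?_⟩
    rw [div_mul_cancel₀ _ hL.ne']
    simp [emb]
  · refine ⟨1, ⟨zero_le_one, le_rfl⟩, (τ.circ ζ - (τ.start ζ e + s * τ.len ζ e)) / τ.circ ζ,
      ⟨div_nonneg (by linarith) hL.le, (div_le_one hL).2 (by linarith)⟩, ?_⟩
    rw [div_mul_cancel₀ _ hL.ne']
    simp only [emb, if_true, hc]
    push_cast; ring

theorem eqvGen_of_lift (h : π.IsSuspensionDatum a ζ) {b : (τ.cylinder h).Bd} {z w : ℂ}
    (hz : Lift _ b z) (hw : Lift _ b w) (hz' : z ∈ π.pattern a ζ) (hw' : w ∈ π.pattern a ζ) :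
    Relation.EqvGen (Glued π ζ) z w := by
  obtain ⟨n, rfl⟩ := hz.exists_add hw
  exact eqvGen_of_add h hz' hw'

/-- Each application of `next` is realized by one edge gluing inside the parallelogram; the
discrepancy between lifts of the same boundary point is absorbed by `eqvGen_of_lift`. -/
theorem eqvGen_of_iterate (h : π.IsSuspensionDatum a ζ) (b : (τ.cylinder h).Bd) (k : ℕ) {z w : ℂ}
    (hz : Lift _ b z) (hw : Lift _ (next^[k] b) w) (hz' : z ∈ π.pattern a ζ)
    (hw' : w ∈ π.pattern a ζ) : Relation.EqvGen (Glued π ζ) z w := by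
  induction k generalizing w with
  | zero => exact eqvGen_of_lift h hz hw hz' hw'
  | succ k ih =>
    set c := next^[k] b with hc
    have hl := len_pos h (c.edge : τ.E)
    have hs : c.pos / τ.len ζ c.edge ∈ Set.Icc (0 : ℝ) 1 :=
      ⟨div_nonneg c.nonneg hl.le, (div_le_one hl).2 c.lt.le⟩
    have h1 : Lift _ c (edgePt h c.edge (c.pos / τ.len ζ c.edge)) := by
      unfold edgePt
      rw [div_mul_cancel₀ _ hl.ne']
      exact lift_self c
    have h2 : Lift _ c.next (edgePt h (τ.twin c.edge) (1 - c.pos / τ.len ζ c.edge)) := by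
      obtain ⟨n, hn⟩ := c.loc_next
      refine ⟨-n, ?_⟩
      rw [side_next, hn]
      unfold edgePt
      congr 2
      show τ.start ζ (τ.twin c.edge) + (1 - c.pos / τ.len ζ c.edge) * τ.len ζ (τ.twin c.edge) =
        τ.start ζ (τ.twin c.edge) + τ.len ζ c.edge - c.pos + n * τ.circ ζ + (-n : ℤ) * τ.circ ζ
      have : τ.len ζ (τ.twin c.edge) = τ.len ζ c.edge := (τ.cylinder h).len_twin c.edge
      rw [this]; field_simp; push_cast; ring
    have hs' : 1 - c.pos / τ.len ζ c.edge ∈ Set.Icc (0 : ℝ) 1 :=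
      ⟨by linarith [hs.2], by linarith [hs.1]⟩
    rw [Function.iterate_succ_apply', ← hc] at hw
    exact ((ih h1 (edgePt_mem h _ hs)).trans _ _ _ (eqvGen_edge h c.edge hs)).trans _ _ _
      (eqvGen_of_lift h h2 hw (edgePt_mem h _ hs') hw')

theorem isGluing (h : π.IsSuspensionDatum a ζ) :
    π.IsGluing a ζ (τ.cylinder h).quadraticSurface (τ.cylinder h).proj where
  continuousOn := (continuous_proj (G := τ.cylinder h)).continuousOn
  surjOn := by
    intro q _
    obtain ⟨z, hz, rfl⟩ := exists_proj (G := τ.cylinder h) q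
    have hi := h.im_pos
    have hL := circ_pos (τ := τ) h
    have hc : (τ.cylinder h).c.im = (ζ a).im := by simp [cylinder]
    -- The real part is corrected by the shear of the slanted sides, so that a translate lands in
    -- the parallelogram and not merely in a rectangle.
    obtain ⟨n, h1, h2⟩ := (τ.cylinder h).exists_int_re (z - (z.im / (ζ a).im : ℝ) * ζ a).re
    change 0 ≤ _ + n * τ.circ ζ at h1
    change _ + n * τ.circ ζ < τ.circ ζ at h2
    refine ⟨z + n * τ.circ ζ, ?_, proj_add_int (G := τ.cylinder h) z n⟩
    refine (mem_pattern (τ := τ) h).2 ⟨z.im / (ζ a).im, ⟨div_nonneg hz.1 hi.le,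
      (div_le_one hi).2 (hc ▸ hz.2)⟩, ((z - (z.im / (ζ a).im : ℝ) * ζ a).re + n * τ.circ ζ) / τ.circ ζ,
      ⟨by positivity, (div_le_one hL).2 h2.le⟩, ?_⟩
    rw [div_mul_cancel₀ _ hL.ne']
    apply Complex.ext
    · simp; ring
    · simp [hi.ne']
  fiber := by
    intro z hz w hw
    refine ⟨fun he => ?_, fun hg => proj_of_eqvGen h hg⟩
    rcases (proj_eq_iff (pattern_subset (τ := τ) h hz) (pattern_subset (τ := τ) h hw)).1 he
      with ⟨n, rfl⟩ | ⟨b, k, hb, hb'⟩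
    · exact eqvGen_of_add (τ := τ) h hz hw
    · exact eqvGen_of_iterate h b k hb hb' hz hw
  pullback := by
    intro z hz e he hs
    exact pullback (interior_pattern_subset h hz) he hs

/-- The initial point of an edge. -/
noncomputable def startPt (h : π.IsSuspensionDatum a ζ) (e : τ.E) : (τ.cylinder h).Bd :=
  Bd.vertex (G := τ.cylinder h) e

theorem lift_startPt (h : π.IsSuspensionDatum a ζ) (e : τ.E) :
    Lift (τ.cylinder h) (startPt h e) (edgePt h e 0) := by
  have := lift_self (startPt h e)
  convert this using 1
  unfold edgePt
  rw [zero_mul]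
  rfl

theorem iterate_startPt (h : π.IsSuspensionDatum a ζ) (e : τ.E) (k : ℕ) :
    next^[k] (startPt h e) = startPt h ((fun e => τ.succ (τ.twin e))^[k] e) :=
  iterate_vertex (G := τ.cylinder h) e k

theorem minimalPeriod_startPt (h : π.IsSuspensionDatum a ζ) (e : τ.E) :
    Function.minimalPeriod next (startPt h e) =
      Function.minimalPeriod (fun e => τ.succ (τ.twin e)) e :=
  minimalPeriod_vertex (G := τ.cylinder h) e

/-- A criterion for a generalized permutation to represent a stratum, in terms of the cycles of
`succ ∘ twin`. -/
theorem represents (τ : π.Tagging a) (hcyl : π.IsCylindrical) (hex : ∃ ζ, π.IsSuspensionDatum a ζ)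
    {n p : ℕ} {d : Fin (n + 1) → ℕ} (lab : τ.E → Fin (n + 1) ⊕ Fin p)
    (hlab : ∀ e e', lab e = lab e' ↔ ∃ k, (fun e => τ.succ (τ.twin e))^[k] e = e')
    (hsurj : Function.Surjective lab)
    (hzero : ∀ e j, lab e = Sum.inl j →
      Function.minimalPeriod (fun e => τ.succ (τ.twin e)) e = d j + 2)
    (hpole : ∀ e j, lab e = Sum.inr j →
      Function.minimalPeriod (fun e => τ.succ (τ.twin e)) e = 1)
    (hfirst : lab (τ.B.head τ.B_ne) = Sum.inl 0)
    (hside : ∃ e, τ.side (τ.twin e) = τ.side e) : π.Represents d p := by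
  refine ⟨hcyl, ⟨a, hex⟩, fun a' ζ h => ?_⟩
  obtain rfl : a = a' := by
    have := h.head_top
    rw [τ.top_eq] at this
    simpa using this
  set G := τ.cylinder h with hG
  set pt : τ.E → G.Surface := fun e => G.proj (edgePt h e 0) with hpt
  have hlift : ∀ e : τ.E, Lift G (startPt h e) (edgePt h e 0) := lift_startPt h
  have hord : ∀ e : τ.E, G.differential.order (pt e) =
      (((Function.minimalPeriod (fun e => τ.succ (τ.twin e)) e : ℤ) - 2 : ℤ) : WithTop ℤ) := by
    intro e
    rw [hpt, order_lift (hlift e), minimalPeriod_startPt]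
  have hpt_eq : ∀ e e', pt e = pt e' ↔ lab e = lab e' := by
    intro e e'
    rw [hlab, hpt, proj_eq_iff (hlift e).mem_strip (hlift e').mem_strip]
    constructor
    · intro hr
      obtain ⟨k, hk⟩ := rel_of_lift (hlift e) hr
      refine ⟨k, ?_⟩
      have := hk.eq (hlift e')
      rw [iterate_startPt] at this
      exact vertex_injective (G := G) this
    · rintro ⟨k, hk⟩
      refine Or.inr ⟨_, k, hlift e, ?_⟩
      rw [iterate_startPt, hk]
      exact hlift e'
  choose r hr using hsurj
  have h2 : ∀ k : ℕ, ((k + 2 : ℕ) : ℤ) - 2 = k := fun k => by push_cast; ring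
  refine ⟨G.quadraticSurface, ⟨?_, fun x => pt (r x), ?_, ?_, ?_, ?_⟩, G.proj, isGluing h, ?_⟩
  · obtain ⟨e, he⟩ := hside
    exact not_isGlobalSquare (G := G) (e := e) he
  · intro x y hxy
    have := (hpt_eq _ _).1 hxy
    rwa [hr, hr] at this
  · intro j
    refine (hord _).trans ?_
    rw [hzero _ j (hr _), h2]
  · intro j
    refine (hord _).trans ?_
    rw [hpole _ j (hr _)]; rfl
  -- Points off the vertices are regular: they are interior to the strip or to an edge.
  · intro q hq
    obtain ⟨z, hz, rfl⟩ := exists_proj (G := G) q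
    by_cases hi : z ∈ G.interiorStrip
    · exact order_interior hi
    obtain ⟨b, hb⟩ := exists_lift_of_notMem hz hi
    by_cases hb0 : b.pos = 0
    · refine absurd ⟨lab b.edge, ?_⟩ hq
      have h3 : pt (r (lab b.edge)) = pt b.edge := (hpt_eq _ _).2 (hr _)
      refine h3.trans ?_
      have hb' : Lift G (startPt h b.edge) z := by
        rw [eq_vertex hb0] at hb; exact hb
      exact (proj_eq_of_lift (hlift b.edge)).trans (proj_eq_of_lift hb').symm
    · exact order_edge hb hb0
  -- The origin is the initial point of the first bottom edge.
  · have h3 : edgePt h (τ.B.head τ.B_ne) 0 = 0 := by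
      have hlen := List.length_pos_iff.2 τ.B_ne
      have := vertex_bot_add h hlen 0
      rw [List.head_eq_getElem, ← this, vertex_bot h hlen.le, List.partialSum_zero]
      simp
    have h4 := hord (τ.B.head τ.B_ne)
    simp only [hpt, h3] at h4
    refine h4.trans ?_
    rw [hzero _ 0 hfirst, h2]

end TwoLines.Tagging

/-! ### Cycle lengths and first returns of cyclic permutations. -/

theorem card_iterate_eq_minimalPeriod {E : Type} [Fintype E] [DecidableEq E] {f : E → E} {e : E}
    {s : Finset E} (he : e ∈ Function.periodicPts f) (hs : ∀ e', e' ∈ s ↔ ∃ k, f^[k] e = e') :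
    Function.minimalPeriod f e = s.card := by
  have : s = (Finset.range (Function.minimalPeriod f e)).image fun k => f^[k] e := by
    ext e'
    rw [hs, Finset.mem_image]
    constructor
    · rintro ⟨k, rfl⟩
      exact ⟨k % Function.minimalPeriod f e, Finset.mem_range.2
        (Nat.mod_lt _ (Function.minimalPeriod_pos_iff_mem_periodicPts.2 he)),
        Function.iterate_mod_minimalPeriod_eq⟩
    · rintro ⟨k, _, rfl⟩
      exact ⟨k, rfl⟩
  rw [this, Finset.card_image_of_injOn, Finset.card_range]
  intro i hi j hj h
  have hi' := Finset.mem_range.1 (Finset.mem_coe.1 hi)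
  have hj' := Finset.mem_range.1 (Finset.mem_coe.1 hj)
  exact (Function.iterate_eq_iterate_iff_of_lt_minimalPeriod hi' hj').1 h

namespace List

variable {E : Type} [DecidableEq E]

theorem formPerm_of_adjacent {A C : List E} {x y : E} (h : (A ++ x :: y :: C).Nodup) :
    (A ++ x :: y :: C).formPerm x = y := by
  have := List.formPerm_apply_lt_getElem _ h A.length (by simp)
  simpa using this

/-- The cyclic successor in a filtered list is the first return of the cyclic successor. -/
theorem formPerm_filter_induction {l : List E} (hl : l.Nodup) {q : E → Bool} {x : E} (hx : x ∈ l)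
    (hqx : q x) {Q : E → Prop} (h1 : Q (l.formPerm x))
    (h2 : ∀ y ∈ l, ¬ q y → Q y → Q (l.formPerm y)) : Q ((l.filter q).formPerm x) := by
  obtain ⟨A, c, rfl⟩ := List.append_of_mem hx
  -- The cyclic word is rotated so that `x` comes first; neither cyclic permutation changes.
  have hrot : (A ++ x :: c) ~r (x :: (c ++ A)) := by
    have := List.isRotated_append (l := A) (l' := x :: c)
    simpa using this
  have hrot' : (A ++ x :: c).filter q ~r (x :: (c ++ A)).filter q := by
    have := List.isRotated_append (l := A.filter q) (l' := (x :: c).filter q)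
    rw [← List.filter_append, ← List.filter_append] at this
    simpa using this
  have hl' : (x :: (c ++ A)).Nodup := hrot.nodup_iff.1 hl
  rw [List.formPerm_eq_of_isRotated (hl.filter _) hrot']
  rw [List.formPerm_eq_of_isRotated hl hrot] at h1 h2
  have h2' : ∀ y ∈ x :: (c ++ A), ¬ q y → Q y → Q ((x :: (c ++ A)).formPerm y) :=
    fun y hy => h2 y (hrot.mem_iff.2 hy)
  generalize c ++ A = m at *
  -- Along a prefix of erased letters the property propagates to the first letter after the prefix.
  have key : ∀ (M r : List E), m = M ++ r → (∀ y ∈ M, ¬ q y) → ∀ y, r.head? = some y → Q y := by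
    intro M
    induction M using List.reverseRecOn with
    | nil =>
      intro r hr _ y hy
      obtain ⟨r', rfl⟩ := List.head?_eq_some_iff.1 hy
      simp only [List.nil_append] at hr
      subst hr
      have := List.formPerm_of_adjacent (A := []) hl'
      rw [List.nil_append] at this
      rwa [this] at h1
    | append_singleton M z ih =>
      intro r hr hM y hy
      obtain ⟨r', rfl⟩ := List.head?_eq_some_iff.1 hy
      have hz : Q z := ih (z :: y :: r') (by simpa using hr)
        (fun y hy => hM y (List.mem_append_left _ hy)) z rfl
      have e : x :: m = (x :: M) ++ z :: y :: r' := by simp [hr]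
      have h3 := h2' z (by rw [e]; simp) (hM z (by simp)) hz
      rw [e, List.formPerm_of_adjacent (e ▸ hl')] at h3
      exact h3
  -- If no other letter survives, the walk goes once around and returns to `x`.
  have hnil : (∀ y ∈ m, ¬ q y) → Q x := by
    intro hm
    rcases List.eq_nil_or_concat' m with rfl | ⟨M, z, rfl⟩
    · simpa using h1
    · have hz := key M [z] rfl (fun y hy => hm y (by simp [hy])) z rfl
      have h3 := h2' z (by simp) (hm z (by simp)) hz
      have h4 := List.formPerm_apply_getLast x (M ++ [z])
      rw [show (x :: (M ++ [z])).getLast (by simp) = z by simp] at h4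
      rwa [h4] at h3
  rw [List.filter_cons_of_pos hqx]
  by_cases hm : ∀ y ∈ m, ¬ q y
  · rw [List.filter_eq_nil_iff.2 hm]
    simpa using hnil hm
  · obtain ⟨M, y, C, e1, e2, e3⟩ : ∃ M y C, m = M ++ y :: C ∧ (∀ y ∈ M, ¬ q y) ∧ q y := by
      clear * - hm
      induction m with
      | nil => simp at hm
      | cons z m ih =>
        by_cases hz : q z
        · exact ⟨[], z, m, rfl, by simp, hz⟩
        · have : ¬ ∀ y ∈ m, ¬ q y := fun h => hm fun y hy => by
            rcases List.mem_cons.1 hy with rfl | hy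
            · exact hz
            · exact h y hy
          obtain ⟨M, y, C, e1, e2, e3⟩ := ih this
          exact ⟨z :: M, y, C, by simp [e1], fun y hy => by
            rcases List.mem_cons.1 hy with rfl | hy
            · exact hz
            · exact e2 y hy, e3⟩
    have hQ := key M (y :: C) e1 e2 y rfl
    have e4 : x :: m.filter q = [] ++ x :: y :: C.filter q := by
      rw [e1, List.filter_append, List.filter_eq_nil_iff.2 e2, List.filter_cons_of_pos e3]; rfl
    have hn : (x :: m.filter q).Nodup := by
      have := hl'.filter q
      rwa [List.filter_cons_of_pos hqx] at this
    rw [e4] at hn ⊢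
    rwa [List.formPerm_of_adjacent hn]

theorem formPerm_map_of_injective {F : Type} [DecidableEq F] {f : F → E}
    (hf : Function.Injective f) {l : List F} (hl : l.Nodup) {x : F} (hx : x ∈ l) :
    f (l.formPerm x) = (l.map f).formPerm (f x) := by
  obtain ⟨i, hi, rfl⟩ := List.getElem_of_mem hx
  have h := List.formPerm_apply_getElem (l.map f) (hl.map hf) i (by simpa using hi)
  rw [List.getElem_map] at h
  rw [h, List.formPerm_apply_getElem _ hl, List.getElem_map]
  simp

end List

/-! ### Cylindricity and existence of suspensions. -/

namespace TwoLines.Tagging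

variable {π : TwoLines} {a : ℕ} (τ : π.Tagging a)

theorem countP_sym (e : τ.E) : (τ.B ++ τ.T).countP (fun e' => τ.sym e' = τ.sym e) = 2 := by
  rw [List.countP_eq_length_filter, ← List.toFinset_card_of_nodup (τ.nodup.filter _)]
  have : ((τ.B ++ τ.T).filter fun e' => τ.sym e' = τ.sym e).toFinset = {e, τ.twin e} := by
    ext e'
    have h := τ.mem e'
    have h' := τ.sym_eq_iff e e'
    rw [eq_comm (a := τ.sym e)] at h'
    simp only [List.mem_toFinset, List.mem_filter, List.mem_append, decide_eq_true_eq,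
      Finset.mem_insert, Finset.mem_singleton]
    tauto
  rw [this, Finset.card_pair (τ.twin_ne e).symm]

theorem count_lines (k : ℕ) : (π.top ++ π.bot).count k =
    (τ.B ++ τ.T).countP (fun e' => τ.sym e' = k) + if k = a then 2 else 0 := by
  rw [τ.top_eq, τ.bot_eq]
  have h : ∀ l : List τ.E, (l.map τ.sym).count k = l.countP (fun e' => τ.sym e' = k) := fun l => by
    rw [List.count, List.countP_map]
    rfl
  simp only [List.count_append, List.count_cons, h, List.countP_reverse, List.countP_append,
    List.count_nil, beq_iff_eq, eq_comm (a := a)]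
  split_ifs <;> omega

/-- A symbol occurring twice on one line is absent from the other; one such symbol on each line
excludes both inclusions. -/
theorem isCylindrical (hT : ∃ e ∈ τ.T, τ.twin e ∈ τ.T) (hB : ∃ e ∈ τ.B, τ.twin e ∈ τ.B) :
    π.IsCylindrical := by
  refine ⟨⟨?_, ?_, ?_⟩, Or.inl ?_, ?_, ?_⟩
  · rw [τ.top_eq]; simp
  · rw [τ.bot_eq]; simp
  · intro k hk
    rw [τ.count_lines]
    split_ifs with h
    · subst h
      rw [List.countP_eq_zero.2]
      intro e _
      simpa using τ.sym_ne e
    · obtain ⟨e, rfl⟩ : ∃ e, τ.sym e = k := by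
        rw [τ.top_eq, τ.bot_eq] at hk
        simp [h] at hk
        rcases hk with ⟨e, _, he⟩ | ⟨e, _, he⟩ <;> exact ⟨e, he⟩
      rw [countP_sym]
  · rw [τ.top_eq, τ.bot_eq]; simp
  · obtain ⟨e, he, he'⟩ := hT
    refine fun hsub => ?_
    have h1 : τ.sym e ∈ π.bot.toFinset := hsub.1 (by rw [τ.top_eq]; simp; exact Or.inr ⟨e, he, rfl⟩)
    rw [τ.bot_eq] at h1
    simp [τ.sym_ne] at h1
    obtain ⟨e', h2, h3⟩ := h1
    rcases (τ.sym_eq_iff e e').1 h3.symm with rfl | rfl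
    · exact mem_T_iff.1 he h2
    · exact mem_T_iff.1 he' h2
  · obtain ⟨e, he, he'⟩ := hB
    refine fun hsub => ?_
    have h1 : τ.sym e ∈ π.top.toFinset := hsub.1 (by rw [τ.bot_eq]; simp; exact Or.inr ⟨e, he, rfl⟩)
    rw [τ.top_eq] at h1
    simp [τ.sym_ne] at h1
    obtain ⟨e', h2, h3⟩ := h1
    rcases (τ.sym_eq_iff e e').1 h3.symm with rfl | rfl
    · exact notMem_T he h2
    · exact notMem_T he' h2

/-- Let `t` and `b` count the edges whose twin is on the same line, for the top and the bottom
respectively. Those edges get length `b` on top and `t` at the bottom, all others length `1`. The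
mixed edges are equally many on both lines, so both lines have that number plus `t * b` as total
length. -/
theorem exists_isSuspensionDatum (hT : ∃ e ∈ τ.T, τ.twin e ∈ τ.T)
    (hB : ∃ e ∈ τ.B, τ.twin e ∈ τ.B) : ∃ ζ, π.IsSuspensionDatum a ζ := by
  classical
  have hpos : ∀ l : List τ.E, (∃ e ∈ l, τ.twin e ∈ l) →
      0 < (l.toFinset.filter fun e => τ.twin e ∈ l).card := by
    rintro l ⟨e, he, he'⟩
    exact Finset.card_pos.2 ⟨e, by simp [he, he']⟩
  set t := (τ.T.toFinset.filter fun e => τ.twin e ∈ τ.T).card with ht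
  set b := (τ.B.toFinset.filter fun e => τ.twin e ∈ τ.B).card with hb
  have ht0 : 0 < t := hpos _ hT
  have hb0 : 0 < b := hpos _ hB
  set w : τ.E → ℕ := fun e => if e ∈ τ.T then (if τ.twin e ∈ τ.T then b else 1)
    else (if τ.twin e ∈ τ.B then t else 1) with hw
  have hw0 : ∀ e, 0 < w e := by intro e; simp only [hw]; split_ifs <;> omega
  have hwt : ∀ e, w (τ.twin e) = w e := by
    intro e
    simp only [hw, mem_T_iff, twin_twin]
    by_cases h1 : e ∈ τ.B <;> by_cases h2 : τ.twin e ∈ τ.B <;> simp [h1, h2]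
  have hTsum : (τ.T.map w).sum = (τ.T.toFinset.filter fun e => τ.twin e ∉ τ.T).card + t * b := by
    rw [← List.sum_toFinset _ nodup_T, ← Finset.sum_filter_add_sum_filter_not _
      (fun e => τ.twin e ∈ τ.T), add_comm]
    congr 1
    · rw [Finset.card_eq_sum_ones]
      refine Finset.sum_congr rfl fun e he => ?_
      rw [Finset.mem_filter, List.mem_toFinset] at he
      simp [he.1, he.2]
    · rw [ht, Finset.card_eq_sum_ones, Finset.sum_mul]
      refine Finset.sum_congr rfl fun e he => ?_
      rw [Finset.mem_filter, List.mem_toFinset] at he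
      simp [he.1, he.2]
  have hBsum : (τ.B.map w).sum = (τ.B.toFinset.filter fun e => τ.twin e ∉ τ.B).card + b * t := by
    rw [← List.sum_toFinset _ nodup_B, ← Finset.sum_filter_add_sum_filter_not _
      (fun e => τ.twin e ∈ τ.B), add_comm]
    congr 1
    · rw [Finset.card_eq_sum_ones]
      refine Finset.sum_congr rfl fun e he => ?_
      rw [Finset.mem_filter, List.mem_toFinset] at he
      simp [notMem_T he.1, he.2]
    · rw [hb, Finset.card_eq_sum_ones, Finset.sum_mul]
      refine Finset.sum_congr rfl fun e he => ?_
      rw [Finset.mem_filter, List.mem_toFinset] at he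
      simp [notMem_T he.1, he.2]
  have hmixed : (τ.T.toFinset.filter fun e => τ.twin e ∉ τ.T).card =
      (τ.B.toFinset.filter fun e => τ.twin e ∉ τ.B).card := by
    refine Finset.card_bij' (fun e _ => τ.twin e) (fun e _ => τ.twin e) ?_ ?_
      (fun e _ => twin_twin e) (fun e _ => twin_twin e)
    · intro e he
      simp only [Finset.mem_filter, List.mem_toFinset, mem_T_iff, not_not] at he ⊢
      exact ⟨he.2, by rw [twin_twin]; exact he.1⟩
    · intro e he
      simp only [Finset.mem_filter, List.mem_toFinset, mem_T_iff, not_not] at he ⊢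
      exact ⟨he.2, by rw [twin_twin]; exact he.1⟩
  have hsum : (τ.T.map w).sum = (τ.B.map w).sum := by rw [hTsum, hBsum, hmixed, mul_comm]
  set ζ : ℕ → ℂ := fun k => if k = a then Complex.I else
    if h : ∃ e, τ.sym e = k then (w h.choose : ℂ) else 1 with hζ
  have hζe : ∀ e, ζ (τ.sym e) = w e := by
    intro e
    have h : ∃ e', τ.sym e' = τ.sym e := ⟨e, rfl⟩
    simp only [hζ, τ.sym_ne e, if_false]
    rw [dif_pos h]
    rcases (τ.sym_eq_iff e h.choose).1 h.choose_spec.symm with h' | h' <;> rw [h']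
    rw [hwt]
  have hζa : ζ a = Complex.I := by simp [hζ]
  have hζsum : ∀ l : List τ.E, ((l.map τ.sym).map ζ).sum = ((l.map w).sum : ℕ) := by
    intro l
    induction l with
    | nil => simp
    | cons e l ih => simp only [List.map_cons, List.sum_cons, ih, hζe]; push_cast; rfl
  refine ⟨ζ, by rw [τ.top_eq]; rfl, by rw [τ.bot_eq]; simp, by rw [hζa]; simp, ?_, ?_⟩
  · intro k hk hka
    obtain ⟨e, rfl⟩ : ∃ e, τ.sym e = k := by
      rw [τ.top_eq, τ.bot_eq] at hk
      simp [hka] at hk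
      rcases hk with ⟨e, _, he⟩ | ⟨e, _, he⟩ <;> exact ⟨e, he⟩
    rw [hζe]
    exact ⟨by simpa using hw0 e, by simp⟩
  · rw [τ.top_eq, τ.bot_eq, List.map_cons, List.sum_cons, List.map_append, List.sum_append,
      hζsum, hζsum, List.map_reverse, List.sum_reverse, hsum]
    simp [add_comm]

end TwoLines.Tagging

/-! ### Oriented edges of the genus two family. -/

namespace GenusTwo

/-- The oriented edges of the cylinders over `genusTwoFamily p`. -/
inductive Edge
  -- When nothing is erased, `fst i`, `mid i` and `snd (i - 1)` are the edges starting at the `i`-th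
  -- zero, and `pole i` is the edge starting at a pole. The index therefore records the initial
  -- point, and is the symbol only for `fst i` and for `snd i` with `i ≠ 0`.
  | fst (i : ℕ)
  | mid (i : ℕ)
  | snd (i : ℕ)
  | pole (i : ℕ)
  deriving DecidableEq

open Edge

/-- The edges that occur for a given `p`. -/
def Valid (p : ℕ) : Edge → Prop
  | fst i => 1 ≤ i ∧ i ≤ p + 4
  | mid i => 1 ≤ i ∧ i ≤ p + 4
  | snd i => i ≤ p + 3
  | pole i => 3 ≤ i ∧ i ≤ p + 2

/-- The symbol of an edge. -/
def sym (p : ℕ) : Edge → ℕ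
  | fst i => i
  | mid i => if i = p + 4 then 2 * p + 6 else 2 * p + 7 - i
  | snd i => if i = 0 then 2 * p + 5 else i
  | pole i => 2 * p + 7 - i

/-- The edge carrying the same symbol. -/
def twin (p : ℕ) : Edge → Edge
  | fst i => if i = p + 4 then mid (p + 3) else snd i
  | mid i => if i = 1 then mid (p + 4) else if i = p + 4 then mid 1 else
      if i = p + 3 then fst (p + 4) else if i = 2 then snd 0 else pole i
  | snd i => if i = 0 then mid 2 else fst i
  | pole i => mid i

theorem valid_twin {p : ℕ} {e : Edge} (h : Valid p e) : Valid p (twin p e) := by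
  cases e <;> simp only [Valid] at h <;> simp only [twin] <;> (try split_ifs) <;>
    simp only [Valid] <;> omega

theorem twin_ne {p : ℕ} {e : Edge} (h : Valid p e) : twin p e ≠ e := by
  cases e <;> simp only [Valid] at h <;> simp only [twin] <;>
    (try split_ifs) <;> simp <;> omega

theorem sym_eq_iff {p : ℕ} {e e' : Edge} (h : Valid p e) (h' : Valid p e') :
    sym p e = sym p e' ↔ e' = e ∨ e' = twin p e := by
  cases e <;> cases e' <;> simp only [Valid] at h h' <;> simp only [sym, twin] <;>
    (try split_ifs) <;> simp <;> omega

theorem sym_ne {p : ℕ} {e : Edge} (h : Valid p e) : sym p e ≠ 0 := by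
  cases e <;> simp only [sym] <;> simp only [Valid] at h <;> (try split_ifs) <;> omega

/-- The end of the bottom line. -/
def tail : ℕ → List Edge
  | 0 => [snd 2, mid 2]
  | q + 1 => snd (q + 3) :: mid (q + 3) :: pole (q + 3) :: tail q

/-- The bottom line without its last symbol. -/
def bot (p : ℕ) : List Edge := (List.range' 1 (p + 4)).map fst ++ tail p

/-- The top line without its first symbol, from right to left. -/
def top (p : ℕ) : List Edge := [snd (p + 3), mid (p + 3), mid (p + 4), snd 0, snd 1, mid 1]

theorem mem_tail {q : ℕ} {e : Edge} : e ∈ tail q ↔ (∃ i, 2 ≤ i ∧ i ≤ q + 2 ∧ e = snd i) ∨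
    (∃ i, 2 ≤ i ∧ i ≤ q + 2 ∧ e = mid i) ∨ ∃ i, 3 ≤ i ∧ i ≤ q + 2 ∧ e = pole i := by
  induction q with
  | zero => cases e <;> simp [tail] <;> omega
  | succ q ih => cases e <;> simp [tail, ih] <;> omega

theorem nodup_tail (q : ℕ) : (tail q).Nodup := by
  induction q with
  | zero => simp [tail]
  | succ q ih => simp [tail, ih, mem_tail]

theorem nodup (p : ℕ) : (bot p ++ top p).Nodup := by
  have h1 : ((List.range' 1 (p + 4)).map fst).Nodup :=
    List.Nodup.map (fun i j h => by simpa using h) List.nodup_range'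
  refine List.Nodup.append (h1.append (nodup_tail p) ?_) (by simp [top]) ?_
  · intro e he he'
    rw [mem_tail] at he'
    obtain ⟨i, _, rfl⟩ := List.mem_map.1 he
    simp at he'
  · intro e he he'
    simp only [bot, List.mem_append, List.mem_map, mem_tail] at he
    simp only [top, List.mem_cons, List.not_mem_nil, or_false] at he'
    cases e <;> simp at he he' <;> omega

theorem mem_bot {p : ℕ} {e : Edge} : e ∈ bot p ↔ (∃ i, 1 ≤ i ∧ i ≤ p + 4 ∧ e = fst i) ∨
    e ∈ tail p := by
  simp only [bot, List.mem_append, List.mem_map, List.mem_range'_1]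
  refine or_congr_left ⟨?_, ?_⟩
  · rintro ⟨i, hi, rfl⟩
    exact ⟨i, by omega, by omega, rfl⟩
  · rintro ⟨i, h1, h2, rfl⟩
    exact ⟨i, by omega, rfl⟩

theorem mem_iff_valid {p : ℕ} {e : Edge} : e ∈ bot p ++ top p ↔ Valid p e := by
  simp only [List.mem_append, mem_bot, mem_tail, top, List.mem_cons, List.not_mem_nil, or_false]
  cases e <;> simp [Valid] <;> omega

theorem nodup_bot (p : ℕ) : (bot p).Nodup := (nodup p).of_append_left

theorem nodup_top (p : ℕ) : (top p).Nodup := (nodup p).of_append_right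

theorem tail_eq_cons (q : ℕ) : ∃ l, tail q = snd (q + 2) :: l := by
  cases q with
  | zero => exact ⟨_, rfl⟩
  | succ q => exact ⟨_, rfl⟩

theorem exists_tail_eq {q i : ℕ} (h : 3 ≤ i) (h' : i ≤ q + 2) :
    ∃ A C, tail q = A ++ snd i :: mid i :: pole i :: snd (i - 1) :: C := by
  induction q with
  | zero => omega
  | succ q ih =>
    rcases Nat.lt_or_ge i (q + 3) with hi | hi
    · obtain ⟨A, C, hAC⟩ := ih (by omega)
      exact ⟨snd (q + 3) :: mid (q + 3) :: pole (q + 3) :: A, C, by simp [tail, hAC]⟩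
    · obtain rfl : i = q + 3 := by omega
      obtain ⟨l, hl⟩ := tail_eq_cons q
      exact ⟨[], l, by simp [tail, hl]⟩

theorem exists_tail_eq_append (q : ℕ) : ∃ A, tail q = A ++ [snd 2, mid 2] := by
  induction q with
  | zero => exact ⟨[], rfl⟩
  | succ q ih =>
    obtain ⟨A, hA⟩ := ih
    exact ⟨snd (q + 3) :: mid (q + 3) :: pole (q + 3) :: A, by simp [tail, hA]⟩

/-- The induction runs over the last `q` blocks of the bottom line; the shift by `q` in the symbols
`2 * p + 5 + k - q` disappears from the statement at `q = p`. -/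
theorem map_sym_tail {p q : ℕ} (h : q ≤ p) : (tail q).map (sym p) =
    (List.range q).flatMap (fun k => [q + 2 - k, 2 * p + 5 + k - q, 2 * p + 5 + k - q]) ++
      [2, 2 * p + 5] := by
  induction q with
  | zero => simp [tail, sym]
  | succ q ih =>
    rw [List.range_succ_eq_map, List.flatMap_cons, List.flatMap_map, List.append_assoc]
    have e : ∀ k, [q + 1 + 2 - (k + 1), 2 * p + 5 + (k + 1) - (q + 1),
        2 * p + 5 + (k + 1) - (q + 1)] = [q + 2 - k, 2 * p + 5 + k - q, 2 * p + 5 + k - q] := by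
      intro k
      simp only [List.cons.injEq, and_true]
      omega
    simp only [Nat.succ_eq_add_one, e]
    rw [← ih (by omega)]
    simp only [tail, List.map_cons, sym, List.cons_append, List.nil_append, List.cons.injEq,
      and_true, Nat.sub_zero, if_neg (show q + 3 ≠ 0 by omega), if_neg (show q + 3 ≠ p + 4 by omega)]
    exact ⟨trivial, by omega, by omega⟩

theorem genusTwoFamily_bot (p : ℕ) : (genusTwoFamily p).bot = (bot p).map (sym p) ++ [0] := by
  have e : ∀ k, 2 * p + 5 + k - p = p + 5 + k := fun k => by omega
  have e' : (sym p ∘ fst) = id := rfl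
  simp only [genusTwoFamily, bot, List.map_append, map_sym_tail le_rfl, List.map_map, e, e',
    List.map_id, List.append_assoc, List.cons_append, List.nil_append]

theorem genusTwoFamily_top (p : ℕ) :
    (genusTwoFamily p).top = 0 :: (top p).reverse.map (sym p) := by
  simp [genusTwoFamily, top, sym]
  omega

/-- The cyclic successor on the boundary components. -/
def succ (p : ℕ) : Edge → Edge
  | fst i => if i = p + 4 then snd (p + 2) else fst (i + 1)
  | mid i => if i = 1 then snd (p + 3) else if i = p + 4 then snd 0 else
      if i = p + 3 then mid (p + 4) else if i = 2 then fst 1 else pole i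
  | snd i => if i = 0 then snd 1 else mid i
  | pole i => snd (i - 1)

theorem formPerm_bot {p : ℕ} {e : Edge} (he : e ∈ bot p) : (bot p).formPerm e = succ p e := by
  have adj : ∀ {A C : List Edge} {x y : Edge}, bot p = A ++ x :: y :: C →
      (bot p).formPerm x = y := fun h => by
    have := h ▸ nodup_bot p
    rw [h, List.formPerm_of_adjacent this]
  rw [mem_bot, mem_tail] at he
  rcases he with ⟨i, h1, h2, rfl⟩ | ⟨i, h1, h2, rfl⟩ | ⟨i, h1, h2, rfl⟩ | ⟨i, h1, h2, rfl⟩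
  · simp only [succ]
    split_ifs with hi
    · subst hi
      obtain ⟨l, hl⟩ := tail_eq_cons p
      refine adj (A := (List.range' 1 (p + 3)).map fst) (C := l) ?_
      rw [bot, hl, List.range'_concat]
      simp only [List.map_append, List.map_cons, List.map_nil, List.append_assoc,
        List.cons_append, List.nil_append, one_mul, show 1 + (p + 3) = p + 4 by omega]
    · have hr : List.range' 1 (p + 4) = List.range' 1 (i - 1) ++ i :: (i + 1) ::
          List.range' (i + 2) (p + 3 - i) := by
        rw [show p + 4 = (i - 1) + (1 + (1 + (p + 3 - i))) by omega, ← List.range'_append_1,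
          ← List.range'_append_1, ← List.range'_append_1]
        have : 1 + (i - 1) = i := by omega
        simp [this]
      refine adj (A := (List.range' 1 (i - 1)).map fst)
        (C := (List.range' (i + 2) (p + 3 - i)).map fst ++ tail p) ?_
      rw [bot, hr]
      simp
  · simp only [succ, show i ≠ 0 by omega, if_false]
    rcases Nat.lt_or_ge 2 i with h | h
    · obtain ⟨A, C, hAC⟩ := exists_tail_eq (q := p) h h2
      refine adj (A := (List.range' 1 (p + 4)).map fst ++ A) (C := pole i :: snd (i - 1) :: C) ?_
      rw [bot, hAC]; simp
    · obtain rfl : i = 2 := by omega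
      obtain ⟨A, hA⟩ := exists_tail_eq_append p
      refine adj (A := (List.range' 1 (p + 4)).map fst ++ A) (C := []) ?_
      rw [bot, hA]; simp
  · simp only [succ, show i ≠ 1 by omega, show i ≠ p + 4 by omega, show i ≠ p + 3 by omega,
      if_false]
    split_ifs with hi
    · subst hi
      obtain ⟨A, hA⟩ := exists_tail_eq_append p
      -- `mid 2` is the last letter, so the cyclic successor wraps around to `fst 1`.
      have hb : bot p = fst 1 :: ((List.range' 2 (p + 3)).map fst ++ A ++ [snd 2] ++ [mid 2]) := by
        rw [bot, hA, show p + 4 = (p + 3) + 1 by omega, List.range'_succ]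
        simp
      have := List.formPerm_apply_getLast (fst 1)
        ((List.range' 2 (p + 3)).map fst ++ A ++ [snd 2] ++ [mid 2])
      simp only [← hb] at this
      rw [show mid 2 = (bot p).getLast (by simp [hb]) by simp [hb]]
      simpa [succ] using this
    · obtain ⟨A, C, hAC⟩ := exists_tail_eq (q := p) (i := i) (by omega) h2
      refine adj (A := (List.range' 1 (p + 4)).map fst ++ A ++ [snd i]) (C := snd (i - 1) :: C) ?_
      rw [bot, hAC]; simp
  · obtain ⟨A, C, hAC⟩ := exists_tail_eq (q := p) h1 h2
    refine adj (A := (List.range' 1 (p + 4)).map fst ++ A ++ [snd i, mid i]) (C := C) ?_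
    rw [bot, hAC]; simp [succ]

theorem formPerm_top {p : ℕ} {e : Edge} (he : e ∈ top p) : (top p).formPerm e = succ p e := by
  have adj : ∀ (A C : List Edge) (x y : Edge), top p = A ++ x :: y :: C →
      (top p).formPerm x = y := fun A C x y h => by
    have := h ▸ nodup_top p
    rw [h, List.formPerm_of_adjacent this]
  have h := he
  simp only [top, List.mem_cons, List.not_mem_nil, or_false] at h
  rcases h with rfl | rfl | rfl | rfl | rfl | rfl
  · rw [adj [] _ _ _ rfl]; simp [succ]
  · rw [adj [_] _ _ _ rfl]; simp [succ]
  · rw [adj [_, _] _ _ _ rfl]; simp [succ]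
  · rw [adj [_, _, _] _ _ _ rfl]; simp [succ]
  · rw [adj [_, _, _, _] _ _ _ rfl]; simp [succ]
  · exact List.formPerm_apply_getLast (snd (p + 3))
      [mid (p + 3), mid (p + 4), snd 0, snd 1, mid 1]

/-- The successor of an edge among those edges whose symbol is not in `S` satisfies every
property of the successor that is inherited along erased edges. -/
theorem formPerm_filter_induction {p : ℕ} {S : Finset ℕ} {l : List Edge}
    (hl : l = bot p ∨ l = top p) {e : Edge} (he : e ∈ l) (hS : sym p e ∉ S) {Q : Edge → Prop}
    (h1 : Q (succ p e)) (h2 : ∀ y, sym p y ∈ S → Q y → Q (succ p y)) :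
    Q ((l.filter (sym p · ∉ S)).formPerm e) := by
  have hf : ∀ y ∈ l, l.formPerm y = succ p y := by
    rcases hl with rfl | rfl
    · exact fun y => formPerm_bot
    · exact fun y => formPerm_top
  refine List.formPerm_filter_induction ?_ he (by simpa using hS) (by rwa [hf e he]) ?_
  · rcases hl with rfl | rfl
    · exact nodup_bot p
    · exact nodup_top p
  · intro y hy hq hQ
    rw [hf y hy]
    exact h2 y (by simpa using hq) hQ

/-- The tagging of `genusTwoFamily p` with erased symbols `S`. -/
def tagging (p : ℕ) (S : Finset ℕ) (hS : ∀ i ∈ S, 1 ≤ i ∧ i ≤ p + 3) :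
    ((genusTwoFamily p).erase S).Tagging 0 where
  E := {e // e ∈ (bot p ++ top p).filter (sym p · ∉ S)}
  fintypeE := inferInstance
  decEqE := inferInstance
  B := ((bot p).filter (sym p · ∉ S)).attachWith _ fun e he => by
    rw [List.filter_append]; exact List.mem_append_left _ he
  T := ((top p).filter (sym p · ∉ S)).attachWith _ fun e he => by
    rw [List.filter_append]; exact List.mem_append_right _ he
  sym e := sym p e.1
  twin e := ⟨twin p e.1, by
    have h := e.2
    rw [List.mem_filter, mem_iff_valid] at h ⊢
    refine ⟨valid_twin h.1, ?_⟩
    rw [← (sym_eq_iff h.1 (valid_twin h.1)).2 (Or.inr rfl)]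
    exact h.2⟩
  nodup := by
    refine List.Nodup.of_map Subtype.val ?_
    simp only [List.map_append, List.attachWith_map_subtype_val]
    rw [← List.filter_append]
    exact (nodup p).filter _
  mem e := by
    have h : e.1 ∈ (bot p).filter (sym p · ∉ S) ++ (top p).filter (sym p · ∉ S) := by
      rw [← List.filter_append]; exact e.2
    simpa only [List.mem_attachWith, List.mem_append] using h
  bot_eq := by
    have h0 : 0 ∉ S := fun h => by have := hS 0 h; omega
    rw [List.attachWith_map_val]
    simp [TwoLines.erase, genusTwoFamily_bot, List.filter_map, h0, Function.comp_def]
  top_eq := by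
    have h0 : 0 ∉ S := fun h => by have := hS 0 h; omega
    rw [List.map_reverse, List.attachWith_map_val]
    simp [TwoLines.erase, genusTwoFamily_top, List.filter_map, h0, Function.comp_def,
      List.filter_reverse]
  sym_ne e := sym_ne (mem_iff_valid.1 (List.mem_filter.1 e.2).1)
  sym_eq_iff e e' := by
    rw [sym_eq_iff (mem_iff_valid.1 (List.mem_filter.1 e.2).1)
      (mem_iff_valid.1 (List.mem_filter.1 e'.2).1), Subtype.ext_iff, Subtype.ext_iff]
  twin_ne e h := twin_ne (mem_iff_valid.1 (List.mem_filter.1 e.2).1) (Subtype.ext_iff.1 h)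
  B_ne h := by
    -- The edge `mid 2` carries the symbol `2 * p + 5`, which is never erased.
    have : mid 2 ∈ (bot p).filter (sym p · ∉ S) := by
      rw [List.mem_filter, mem_bot, mem_tail]
      refine ⟨by simp, ?_⟩
      refine decide_eq_true fun h => ?_
      simp only [sym] at h
      split_ifs at h <;> have := hS _ h <;> omega
    have h' := congrArg List.length h
    rw [List.length_attachWith] at h'
    rw [List.length_eq_zero_iff.1 h'] at this
    simp at this

end GenusTwo

/-! ### Blocks of erased symbols and the cycles at the vertices. -/

namespace GenusTwo

open Edge

/-- A decomposition of `{1, …, N}` into consecutive blocks `{a j + 1, …, a j + d j}`, where `S`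
consists of all elements other than the last ones of the blocks. -/
structure Blocks (N : ℕ) {n : ℕ} (d : Fin (n + 1) → ℕ) (S : Finset ℕ) where
  a : Fin (n + 1) → ℕ
  blk : ℕ → Fin (n + 1)
  d_pos : ∀ j, 0 < d j
  a_zero : a 0 = 0
  le : ∀ j, a j + d j ≤ N
  blk_eq_iff : ∀ i, 1 ≤ i → i ≤ N → ∀ j, blk i = j ↔ a j < i ∧ i ≤ a j + d j
  mem_iff : ∀ i, i ∈ S ↔ ∃ j, a j < i ∧ i < a j + d j

namespace Blocks

variable {p n : ℕ} {d : Fin (n + 1) → ℕ} {S : Finset ℕ} (β : Blocks (p + 4) d S)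

include β in
theorem bounds {i : ℕ} (h : i ∈ S) : 1 ≤ i ∧ i ≤ p + 3 := by
  obtain ⟨j, h1, h2⟩ := (β.mem_iff i).1 h
  have := β.le j
  omega

theorem blk_succ {i : ℕ} (h : i ∈ S) : β.blk (i + 1) = β.blk i := by
  have hb := β.bounds h
  obtain ⟨j, h1, h2⟩ := (β.mem_iff i).1 h
  rw [(β.blk_eq_iff (i + 1) (by omega) (by omega) j).2 ⟨by omega, by omega⟩,
    (β.blk_eq_iff i (by omega) (by omega) j).2 ⟨by omega, by omega⟩]

theorem last_notMem (j : Fin (n + 1)) : a β j + d j ∉ S := by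
  intro h
  have hd := β.d_pos j
  have h1 := (β.blk_eq_iff _ (by omega) (β.le j) j).2 ⟨by omega, le_rfl⟩
  obtain ⟨j', h2, h3⟩ := (β.mem_iff _).1 h
  have h4 := (β.blk_eq_iff _ (by omega) (β.le j) j').2 ⟨h2, h3.le⟩
  rw [h1] at h4
  subst h4
  omega

/-- An erased symbol lies in the same block as its successor, but `a j + 1` is the first element of
block `j`. The case `a j = 0` is excluded by `bounds`. -/
theorem first_notMem (j : Fin (n + 1)) : a β j ∉ S := by
  intro h
  have hd := β.d_pos j
  have hle := β.le j
  have hb := β.bounds h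
  have h1 := β.blk_succ h
  rw [(β.blk_eq_iff (a β j + 1) (by omega) (by omega) j).2 ⟨by omega, by omega⟩] at h1
  have := (β.blk_eq_iff (a β j) (by omega) (by omega) j).1 h1.symm
  omega

/-- The tagging of `genusTwoFamily p` with the symbols `S` erased. -/
abbrev tagging : ((genusTwoFamily p).erase S).Tagging 0 :=
  GenusTwo.tagging p S fun _ => β.bounds

/-- An edge whose symbol is not erased. -/
def ofEdge (e : Edge) (h : Valid p e) (h' : sym p e ∉ S) : β.tagging.E :=
  ⟨e, List.mem_filter.2 ⟨mem_iff_valid.2 h, by simpa using h'⟩⟩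

variable {β}

/-- The underlying edge. -/
def edge (e : β.tagging.E) : Edge := Subtype.val e

theorem edge_injective : Function.Injective (edge (β := β)) := Subtype.val_injective

theorem valid (e : β.tagging.E) : Valid p (edge e) := mem_iff_valid.1 (List.mem_filter.1 (Subtype.property e)).1

theorem sym_notMem (e : β.tagging.E) : sym p (edge e) ∉ S :=
  of_decide_eq_true (List.mem_filter.1 (Subtype.property e)).2

theorem mem_B {e : β.tagging.E} : e ∈ β.tagging.B ↔ (edge e) ∈ bot p := by
  have h : β.tagging.B.map edge = (bot p).filter (sym p · ∉ S) := List.attachWith_map_subtype_val _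
  rw [← List.mem_map_of_injective edge_injective, h, List.mem_filter]
  simpa using fun _ => sym_notMem e

theorem mem_T {e : β.tagging.E} : e ∈ β.tagging.T ↔ (edge e) ∈ top p := by
  have h : β.tagging.T.map edge = (top p).filter (sym p · ∉ S) := List.attachWith_map_subtype_val _
  rw [← List.mem_map_of_injective edge_injective, h, List.mem_filter]
  simpa using fun _ => sym_notMem e

/-- The successor after erasing is the first return of the explicit map `succ p`; any property
stable along erased edges is inherited. The three transitions below for `fst`, `mid` and `snd` are
instances with a suitable `Q`. -/
theorem succ_induction (e : β.tagging.E) {Q : Edge → Prop} (h1 : Q (succ p (edge e)))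
    (h2 : ∀ y, sym p y ∈ S → Q y → Q (succ p y)) : Q (edge (β.tagging.succ e)) := by
  rcases β.tagging.mem e with h | h
  · have h3 := List.formPerm_map_of_injective edge_injective
      (TwoLines.Tagging.nodup_B (τ := β.tagging)) h
    rw [TwoLines.Tagging.succ_of_mem_B h, h3]
    have h4 : β.tagging.B.map edge = (bot p).filter (sym p · ∉ S) :=
      List.attachWith_map_subtype_val _
    rw [h4]
    exact formPerm_filter_induction (Or.inl rfl) (mem_B.1 h) (sym_notMem e) h1 h2
  · have h3 := List.formPerm_map_of_injective edge_injective
      (TwoLines.Tagging.nodup_T (τ := β.tagging)) h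
    rw [TwoLines.Tagging.succ_of_mem_T h, h3]
    have h4 : β.tagging.T.map edge = (top p).filter (sym p · ∉ S) :=
      List.attachWith_map_subtype_val _
    rw [h4]
    exact formPerm_filter_induction (Or.inr rfl) (mem_T.1 h) (sym_notMem e) h1 h2

/-- Edges `mid` are never erased: their symbols are at least `p + 4`, while those of `S` are at most
`p + 3`. -/
theorem sym_mid_notMem (β : Blocks (p + 4) d S) {i : ℕ} (hi : i ≤ p + 4) :
    sym p (mid i) ∉ S := by
  intro h
  have := β.bounds h
  simp only [sym] at this
  split_ifs at this <;> omega

variable (β) in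
/-- The permutation of the edges whose cycles are the vertices of the surface. -/
def rot : Equiv.Perm β.tagging.E :=
  β.tagging.succ * Function.Involutive.toPerm β.tagging.twin fun _ => TwoLines.Tagging.twin_twin _

theorem rot_apply (e : β.tagging.E) : rot β e = β.tagging.succ (β.tagging.twin e) := rfl

theorem rot_fst {e : β.tagging.E} {i : ℕ} (h : (edge e) = fst i) : (edge (rot β e)) = mid i := by
  have hv := valid e
  rw [h] at hv
  simp only [Valid] at hv
  refine succ_induction (Q := fun y => y = mid i) _ ?_ ?_
  · change succ p (twin p (edge e)) = mid i
    rw [h]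
    simp only [twin]
    split_ifs with hi
    · simp [succ, hi]
    · simp only [succ]
      rw [if_neg (by omega)]
  · rintro y hy rfl
    exact absurd hy (sym_mid_notMem β hv.2)

theorem rot_pole {e : β.tagging.E} {i : ℕ} (h : (edge e) = pole i) : rot β e = e := by
  have hv := valid e
  rw [h] at hv
  simp only [Valid] at hv
  refine edge_injective ?_
  rw [h]
  refine succ_induction (Q := fun y => y = pole i) _ ?_ ?_
  · change succ p (twin p (edge e)) = pole i
    rw [h]
    simp only [twin, succ]
    rw [if_neg (by omega), if_neg (by omega), if_neg (by omega), if_neg (by omega)]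
  · rintro y hy rfl
    have := sym_notMem e
    rw [h] at this
    contradiction

/-- The twin of `mid (i + 1)` is followed by `snd i`. If `i` is erased, so is `snd i`, and the next
edge is `mid i`: this descent merges the cycles of `i` and `i + 1`. -/
theorem rot_mid {e : β.tagging.E} {i : ℕ} (h : (edge e) = mid (i + 1)) :
    (i ∉ S ∧ (edge (rot β e)) = snd i) ∨ (i ∈ S ∧ (edge (rot β e)) = mid i) := by
  have hv := valid e
  rw [h] at hv
  simp only [Valid] at hv
  have key := succ_induction (β.tagging.twin e)
    (Q := fun y => y = snd i ∨ (i ∈ S ∧ y = mid i)) ?_ ?_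
  · rcases key with h1 | h1
    · refine Or.inl ⟨?_, h1⟩
      have h2 := sym_notMem (rot β e)
      rw [rot_apply, h1] at h2
      simp only [sym] at h2
      split_ifs at h2 with hi
      · subst hi
        intro h3
        have := β.bounds h3
        omega
      · exact h2
    · exact Or.inr h1
  · left
    change succ p (twin p (edge e)) = snd i
    rw [h]
    simp only [twin]
    split_ifs with h1 h2 h3 h4
    · obtain rfl : i = 0 := by omega
      simp [succ]
    · obtain rfl : i = p + 3 := by omega
      simp [succ]
    · obtain rfl : i = p + 2 := by omega
      simp [succ]
    · obtain rfl : i = 1 := by omega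
      simp [succ]
    · simp [succ]
  · rintro y hy (rfl | ⟨-, rfl⟩)
    · have hi : i ∈ S ∧ i ≠ 0 := by
        simp only [sym] at hy
        have := β.bounds hy
        split_ifs at hy this with hi
        · omega
        · exact ⟨hy, hi⟩
      right
      simp [succ, hi]
    · exact absurd hy (sym_mid_notMem β (by omega))

/-- The walk reaches `fst (i + 1)` and skips erased edges `fst`; each skip stays inside the block.
-/
theorem rot_snd {e : β.tagging.E} {i : ℕ} (h : (edge e) = snd i) :
    ∃ j, (edge (rot β e)) = fst j ∧ β.blk j = β.blk (i + 1) := by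
  have hv := valid e
  rw [h] at hv
  simp only [Valid] at hv
  refine succ_induction (Q := fun y => ∃ j, y = fst j ∧ β.blk j = β.blk (i + 1)) _
    ⟨i + 1, ?_, rfl⟩ ?_
  · change succ p (twin p (edge e)) = fst (i + 1)
    rw [h]
    simp only [twin]
    split_ifs with hi
    · simp [succ, hi]
    · simp only [succ]
      rw [if_neg (by omega)]
  · rintro y hy ⟨j, rfl, hj⟩
    simp only [sym] at hy
    have := β.bounds hy
    refine ⟨j + 1, ?_, by rw [β.blk_succ hy, hj]⟩
    simp only [succ]
    rw [if_neg (by omega)]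

variable (β) in
/-- The singularity at the initial point of an edge. -/
def label : Edge → Fin (n + 1) ⊕ Fin p
  | fst i => Sum.inl (β.blk i)
  | mid i => Sum.inl (β.blk i)
  | snd i => Sum.inl (β.blk (i + 1))
  -- The value `Sum.inl 0` is a default; valid poles have `3 ≤ i ≤ p + 2`.
  | pole i => if h : i - 3 < p then Sum.inr ⟨i - 3, h⟩ else Sum.inl 0

theorem label_rot (e : β.tagging.E) : label β (edge (rot β e)) = label β (edge e) := by
  have hv := valid e
  rcases he : (edge e) with i | i | i | i
  · rw [rot_fst he]; rfl
  · rw [he] at hv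
    obtain ⟨i, rfl⟩ : ∃ k, i = k + 1 := ⟨i - 1, by simp only [Valid] at hv; omega⟩
    rcases rot_mid he with ⟨-, h⟩ | ⟨h', h⟩
    · rw [h]; rfl
    · rw [h]; simp only [label]; rw [β.blk_succ h']
  · obtain ⟨j, h1, h2⟩ := rot_snd he
    rw [h1]; simp only [label]; rw [h2]
  · rw [rot_pole he, he]

theorem label_iterate (e : β.tagging.E) (k : ℕ) :
    label β (edge ((rot β)^[k] e)) = label β (edge e) := by
  induction k with
  | zero => rfl
  | succ k ih => rw [Function.iterate_succ_apply', label_rot, ih]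

theorem sameCycle_mid {i k : ℕ} (hi : 1 ≤ i) (hk : i + k ≤ p + 4)
    (hS : ∀ l, i ≤ l → l < i + k → l ∈ S) :
    (rot β).SameCycle (ofEdge β (mid i) ⟨hi, by omega⟩ (sym_mid_notMem β (by omega)))
      (ofEdge β (mid (i + k)) ⟨by omega, hk⟩ (sym_mid_notMem β hk)) := by
  induction k with
  | zero => exact Equiv.Perm.SameCycle.refl _ _
  | succ k ih =>
    refine (ih (by omega) fun l h1 h2 => hS l h1 (by omega)).trans ?_
    rcases rot_mid (e := ofEdge β (mid (i + k + 1)) ⟨by omega, hk⟩ (sym_mid_notMem β hk)) rfl with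
      ⟨h, -⟩ | ⟨-, h⟩
    · exact absurd (hS _ (by omega) (by omega)) h
    · refine Equiv.Perm.SameCycle.symm ⟨1, ?_⟩
      rw [zpow_one]
      exact edge_injective h

variable (β) in
/-- A representative of a zero. -/
def zero (j : Fin (n + 1)) : β.tagging.E :=
  ofEdge β (mid (a β j + d j)) ⟨by have := β.d_pos j; omega, β.le j⟩ (sym_mid_notMem β (β.le j))

/-- One step leads from `snd` to `fst` and one from `fst` to `mid`, within the block; all the edges
`mid` of a block are linked by the descent of `rot_mid` from its last index. -/
theorem sameCycle_zero (e : β.tagging.E) {j : Fin (n + 1)} (h : label β (edge e) = Sum.inl j) :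
    (rot β).SameCycle e (zero β j) := by
  have hmid : ∀ (e : β.tagging.E) (i : ℕ), (edge e) = mid i → label β (edge e) = Sum.inl j →
      (rot β).SameCycle e (zero β j) := by
    intro e i he h
    have hv := valid e
    rw [he] at h hv
    simp only [label, Sum.inl.injEq, Valid] at h hv
    obtain ⟨h1, h2⟩ := (β.blk_eq_iff i hv.1 hv.2 j).1 h
    obtain ⟨k, hk⟩ := Nat.exists_eq_add_of_le h2
    have h3 := sameCycle_mid (β := β) (i := i) (k := k) (by omega) (hk ▸ β.le j)
      fun l h3 h4 => (β.mem_iff l).2 ⟨j, by omega, by omega⟩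
    convert h3 using 1
    · exact edge_injective he
    · exact edge_injective (congrArg mid hk)
  have hfst : ∀ (e : β.tagging.E) (i : ℕ), (edge e) = fst i → label β (edge e) = Sum.inl j →
      (rot β).SameCycle e (zero β j) := by
    intro e i he h
    rw [← Equiv.Perm.sameCycle_apply_left]
    exact hmid _ i (rot_fst he) (by rw [label_rot, h])
  rcases he : (edge e) with i | i | i | i
  · exact hfst e i he h
  · exact hmid e i he h
  · rw [← Equiv.Perm.sameCycle_apply_left]
    obtain ⟨k, hk, -⟩ := rot_snd he
    exact hfst _ k hk (by rw [label_rot, h])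
  · have hv := valid e
    rw [he] at h hv
    simp only [label, Valid] at h hv
    rw [dif_pos (by omega)] at h
    cases h

theorem eq_of_label_eq_inr {e : β.tagging.E} {j : Fin p} (h : label β (edge e) = Sum.inr j) :
    (edge e) = pole (j + 3) := by
  rcases he : (edge e) with i | i | i | i <;> rw [he] at h
  · cases h
  · cases h
  · cases h
  · have hv := valid e
    rw [he] at hv
    simp only [label, Valid] at h hv
    rw [dif_pos (by omega)] at h
    have := congrArg Fin.val (Sum.inr.inj h)
    simp only at this
    congr 1
    omega

theorem label_eq_iff (e e' : β.tagging.E) :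
    label β (edge e) = label β (edge e') ↔ ∃ k, (rot β)^[k] e = e' := by
  constructor
  · intro h
    have hc : (rot β).SameCycle e e' := by
      rcases hl : label β (edge e) with j | j
      · exact (sameCycle_zero e hl).trans (sameCycle_zero e' (h ▸ hl)).symm
      · have : e = e' := edge_injective
          ((eq_of_label_eq_inr hl).trans (eq_of_label_eq_inr (h ▸ hl)).symm)
        rw [this]
    obtain ⟨k, -, hk⟩ := hc.exists_pow_eq'
    exact ⟨k, by rwa [Equiv.Perm.iterate_eq_pow]⟩
  · rintro ⟨k, rfl⟩
    exact (label_iterate e k).symm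

/-- Erasing leaves in block `j` all the `d j` edges `mid`, the single `fst` of the last index, and
the single `snd` whose index precedes the block. -/
theorem card_label (j : Fin (n + 1)) :
    (Finset.univ.filter fun e : β.tagging.E => label β (edge e) = Sum.inl j).card = d j + 2 := by
  have hd := β.d_pos j
  have hle := β.le j
  have : (Finset.univ.filter fun e : β.tagging.E => label β (edge e) = Sum.inl j).map
      ⟨edge, edge_injective⟩ = insert (fst (a β j + d j)) (insert (snd (a β j))
        ((Finset.Ioc (a β j) (a β j + d j)).image mid)) := by
    ext e
    simp only [Finset.mem_map, Finset.mem_filter, Finset.mem_univ, true_and,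
      Function.Embedding.coeFn_mk, Finset.mem_insert, Finset.mem_image, Finset.mem_Ioc]
    constructor
    · rintro ⟨e, h, rfl⟩
      have hv := valid e
      have hs := sym_notMem e
      rcases he : (edge e) with i | i | i | i <;> rw [he] at h hv hs <;>
        simp only [label, Valid, sym] at h hv hs
      · obtain ⟨h1, h2⟩ := (β.blk_eq_iff i hv.1 hv.2 j).1 (Sum.inl.inj h)
        left
        congr 1
        by_contra hne
        exact hs ((β.mem_iff i).2 ⟨j, h1, by omega⟩)
      · exact Or.inr (Or.inr ⟨i, (β.blk_eq_iff i hv.1 hv.2 j).1 (Sum.inl.inj h), rfl⟩)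
      · obtain ⟨h1, h2⟩ := (β.blk_eq_iff (i + 1) (by omega) (by omega) j).1 (Sum.inl.inj h)
        right; left
        congr 1
        by_contra hne
        rw [if_neg (by omega)] at hs
        exact hs ((β.mem_iff i).2 ⟨j, by omega, by omega⟩)
      · rw [dif_pos (by omega)] at h
        cases h
    · rintro (rfl | rfl | ⟨i, hi, rfl⟩)
      · refine ⟨ofEdge β (fst _) ⟨by omega, hle⟩ (β.last_notMem j), ?_, rfl⟩
        exact congrArg Sum.inl ((β.blk_eq_iff _ (by omega) hle j).2 ⟨by omega, le_rfl⟩)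
      · refine ⟨ofEdge β _ (by simp only [Valid]; omega) ?_, ?_, rfl⟩
        · simp only [sym]
          split_ifs
          · intro h
            have := β.bounds h
            omega
          · exact β.first_notMem j
        · exact congrArg Sum.inl ((β.blk_eq_iff _ (by omega) (by omega) j).2 ⟨by omega, by omega⟩)
      · refine ⟨ofEdge β (mid _) ⟨by omega, by omega⟩ (sym_mid_notMem β (by omega)), ?_, rfl⟩
        exact congrArg Sum.inl ((β.blk_eq_iff _ (by omega) (by omega) j).2 hi)
  rw [← Finset.card_map, this, Finset.card_insert_of_notMem (by simp),
    Finset.card_insert_of_notMem (by simp),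
    Finset.card_image_of_injective _ fun i j h => by simpa using h, Nat.card_Ioc]
  omega

/-- The first `d 0 - 1` symbols are erased, so the bottom line begins with `fst (d 0)`, in block
`0`. -/
theorem label_head : label β (edge (β.tagging.B.head β.tagging.B_ne)) = Sum.inl 0 := by
  have hd := β.d_pos 0
  have hle := β.le 0
  have ha := β.a_zero
  have hl := β.last_notMem 0
  have h4 : β.tagging.B.map edge = (bot p).filter (sym p · ∉ S) :=
    List.attachWith_map_subtype_val _
  have h5 : (bot p).filter (sym p · ∉ S) = fst (d 0) :: ((List.range' (d 0 + 1)
      (p + 4 - d 0)).map fst ++ tail p).filter (sym p · ∉ S) := by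
    have : List.range' 1 (p + 4) = List.range' 1 (d 0 - 1) ++ d 0 ::
        List.range' (d 0 + 1) (p + 4 - d 0) := by
      rw [show p + 4 = (d 0 - 1) + (1 + (p + 4 - d 0)) by omega, ← List.range'_append_1,
        ← List.range'_append_1]
      have h1 : 1 + (d 0 - 1) = d 0 := by omega
      have h2 : d 0 - 1 + (1 + (p + 4 - d 0)) - d 0 = p + 4 - d 0 := by omega
      simp [h1, h2]
    rw [bot, this, List.map_append, List.append_assoc, List.filter_append,
      List.filter_eq_nil_iff.2]
    · rw [List.nil_append, List.map_cons, List.cons_append, List.filter_cons_of_pos]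
      rw [ha, zero_add] at hl
      exact decide_eq_true hl
    · intro e he
      obtain ⟨i, hi, rfl⟩ := List.mem_map.1 he
      rw [List.mem_range'_1] at hi
      have : i ∈ S := (β.mem_iff i).2 ⟨0, by omega, by omega⟩
      simp only [sym, this, not_true_eq_false, decide_false, Bool.false_eq_true,
        not_false_eq_true]
  have h6 : (edge (β.tagging.B.head β.tagging.B_ne)) = fst (d 0) := by
    have h7 := List.head_map (f := edge) (l := β.tagging.B)
      (by simpa using β.tagging.B_ne)
    rw [← h7]
    simp only [h4, h5, List.head_cons]
  rw [h6]
  exact congrArg Sum.inl ((β.blk_eq_iff _ (by omega) (by omega) 0).2 ⟨by omega, by omega⟩)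

/-- The alternative supplies a symbol that occurs twice at the bottom: `2 * p + 4`, carried by `mid
3` and `pole 3`, if `0 < p`, and the symbol `2` if `p = 0`. On top the symbol `2 * p + 6` always
does so. -/
theorem represents (β : Blocks (p + 4) d S) (h : 0 < p ∨ 2 ∉ S) :
    ((genusTwoFamily p).erase S).Represents d p := by
  have hT : ∃ e ∈ β.tagging.T, β.tagging.twin e ∈ β.tagging.T := by
    refine ⟨ofEdge β (mid 1) ⟨le_rfl, by omega⟩ (sym_mid_notMem β (by omega)), mem_T.2 ?_,
      mem_T.2 ?_⟩
    · simp [edge, ofEdge, top]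
    · change twin p (mid 1) ∈ top p
      simp [twin, top]
  have hB : ∃ e ∈ β.tagging.B, β.tagging.twin e ∈ β.tagging.B := by
    rcases Nat.eq_zero_or_pos p with rfl | hp
    · have h2 : 2 ∉ S := by simpa using h
      refine ⟨ofEdge β (fst 2) ⟨by omega, by omega⟩ h2, mem_B.2 ?_, mem_B.2 ?_⟩
      · simp [edge, ofEdge, mem_bot]
      · change twin 0 (fst 2) ∈ bot 0
        simp [twin, mem_bot, mem_tail]
    · refine ⟨ofEdge β (mid 3) ⟨by omega, by omega⟩ (sym_mid_notMem β (by omega)), mem_B.2 ?_,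
        mem_B.2 ?_⟩
      · simp [edge, ofEdge, mem_bot, mem_tail]; omega
      · change twin p (mid 3) ∈ bot p
        simp only [twin]
        rw [if_neg (by omega), if_neg (by omega), if_neg (by omega), if_neg (by omega)]
        simp [mem_bot, mem_tail]; omega
  refine β.tagging.represents (β.tagging.isCylindrical hT hB)
    (β.tagging.exists_isSuspensionDatum hT hB) (fun e => label β (edge e)) label_eq_iff ?_ ?_ ?_
    label_head ?_
  · rintro (j | j)
    · refine ⟨zero β j, ?_⟩
      have hd := β.d_pos j
      exact congrArg Sum.inl
        ((β.blk_eq_iff _ (by omega) (β.le j) j).2 ⟨by omega, le_rfl⟩)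
    · have hj := j.2
      refine ⟨ofEdge β (pole (j + 3)) ⟨by omega, by omega⟩ ?_, ?_⟩
      · intro h'
        have := β.bounds h'
        simp only [sym] at this
        omega
      · simp [edge, ofEdge, label]
  · intro e j he
    rw [← card_label (β := β) j]
    refine card_iterate_eq_minimalPeriod ?_ ?_
    · exact (rot β).injective.mem_periodicPts e
    · intro e'
      rw [Finset.mem_filter, ← he, eq_comm (a := label β (edge e'))]
      exact (and_iff_right (Finset.mem_univ _)).trans (label_eq_iff e e')
  · intro e j he
    exact Function.minimalPeriod_eq_one_iff_isFixedPt.2 (rot_pole (eq_of_label_eq_inr he))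
  · obtain ⟨e, h1, h2⟩ := hT
    refine ⟨e, ?_⟩
    have h3 := TwoLines.Tagging.mem_word (e := e) (s := true)
    have h4 := TwoLines.Tagging.mem_word (e := β.tagging.twin e) (s := true)
    rw [h3.1 h1, h4.1 h2]

end Blocks

end GenusTwo

/-! ### Blocks of prescribed lengths and conclusion. -/

namespace GenusTwo

variable {n : ℕ} {d : Fin (n + 1) → ℕ}

theorem sum_Iic (d : Fin (n + 1) → ℕ) (j : Fin (n + 1)) :
    ∑ i ∈ Finset.Iic j, d i = ∑ i ∈ Finset.Iio j, d i + d j := by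
  rw [← Finset.Iio_insert, Finset.sum_insert (by simp), add_comm]

theorem sum_Iic_le_sum_Iio {j j' : Fin (n + 1)} (h : j < j') :
    ∑ i ∈ Finset.Iio j, d i + d j ≤ ∑ i ∈ Finset.Iio j', d i := by
  rw [← sum_Iic]
  exact Finset.sum_le_sum_of_subset fun i hi =>
    Finset.mem_Iio.2 ((Finset.mem_Iic.1 hi).trans_lt h)

theorem eq_of_mem_block {i : ℕ} {j j' : Fin (n + 1)}
    (h : ∑ k ∈ Finset.Iio j, d k < i ∧ i ≤ ∑ k ∈ Finset.Iio j, d k + d j)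
    (h' : ∑ k ∈ Finset.Iio j', d k < i ∧ i ≤ ∑ k ∈ Finset.Iio j', d k + d j') : j = j' := by
  rcases lt_trichotomy j j' with hj | hj | hj
  · have := sum_Iic_le_sum_Iio (d := d) hj; omega
  · exact hj
  · have := sum_Iic_le_sum_Iio (d := d) hj; omega

/-- If no block contained `i`, every partial sum would stay below `i` by induction, including the
total. -/
theorem exists_mem_block {i : ℕ} (h : 1 ≤ i) (h' : i ≤ ∑ k, d k) :
    ∃ j, ∑ k ∈ Finset.Iio j, d k < i ∧ i ≤ ∑ k ∈ Finset.Iio j, d k + d j := by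
  by_contra! hc
  have key : ∀ j : Fin (n + 1), ∑ k ∈ Finset.Iio j, d k < i := by
    intro j
    induction j using Fin.induction with
    | zero =>
      rw [show Finset.Iio (0 : Fin (n + 1)) = ∅ from by ext; simp]
      simpa using Nat.succ_le_iff.1 h
    | succ j ih =>
      have := hc _ ih
      rw [← sum_Iic] at this
      rwa [show Finset.Iio j.succ = Finset.Iic j.castSucc from by
        ext k; simp [Fin.lt_def, Fin.le_def]]
  have := hc _ (key (Fin.last n))
  rw [← sum_Iic, show Finset.Iic (Fin.last n) = Finset.univ from by ext k; simp [Fin.le_last]]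
    at this
  omega

open Classical in
/-- The blocks of lengths `d 0, …, d n`. -/
noncomputable def blocks {N : ℕ} (hd : ∀ k, 0 < d k) (hN : ∑ k, d k = N) :
    Blocks N d (erasedSymbols d) where
  a j := ∑ i ∈ Finset.Iio j, d i
  blk i := if h : ∃ j, ∑ k ∈ Finset.Iio j, d k < i ∧ i ≤ ∑ k ∈ Finset.Iio j, d k + d j
    then h.choose else 0
  d_pos := hd
  a_zero := by
    rw [show Finset.Iio (0 : Fin (n + 1)) = ∅ from by ext; simp, Finset.sum_empty]
  le j := by
    rw [← sum_Iic, ← hN]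
    exact Finset.sum_le_sum_of_subset (Finset.subset_univ _)
  blk_eq_iff i h1 h2 j := by
    have h := exists_mem_block h1 (hN ▸ h2)
    rw [dif_pos h]
    exact ⟨fun h' => h' ▸ h.choose_spec, eq_of_mem_block h.choose_spec⟩
  mem_iff i := by simp [erasedSymbols, sum_Iic]

theorem represents {p : ℕ} (hd : ∀ k, 0 < d k) (hN : ∑ k, d k = p + 4)
    (h : 0 < p ∨ 2 ∉ erasedSymbols d) :
    ((genusTwoFamily p).erase (erasedSymbols d)).Represents d p :=
  (blocks hd hN).represents h

end GenusTwo

theorem proposition3p3 :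
    genusTwoHolomorphic.Represents ![1, 1, 1, 1] 0 ∧
    (genusTwoHolomorphic.erase {1}).Represents ![2, 1, 1] 0 ∧
    (genusTwoHolomorphic.erase {1, 3}).Represents ![2, 2] 0 ∧
    ∀ (n p : ℕ) (d : Fin (n + 1) → ℕ), 0 < p → (∀ k, 0 < d k) → ∑ k, d k = p + 4 →
      ((genusTwoFamily p).erase (erasedSymbols d)).Represents d p := by
  -- The holomorphic case is the member `p = 0` of the family, whose bottom line has no blocks of
  -- poles.
  have h0 : genusTwoFamily 0 = genusTwoHolomorphic := rfl
  have e1 : erasedSymbols ![1, 1, 1, 1] = ∅ := by decide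
  have e2 : erasedSymbols ![2, 1, 1] = {1} := by decide
  have e3 : erasedSymbols ![2, 2] = {1, 3} := by decide
  have h1 := GenusTwo.represents (p := 0) (d := ![1, 1, 1, 1]) (by decide) (by decide)
    (Or.inr (by decide))
  have h2 := GenusTwo.represents (p := 0) (d := ![2, 1, 1]) (by decide) (by decide)
    (Or.inr (by decide))
  have h3 := GenusTwo.represents (p := 0) (d := ![2, 2]) (by decide) (by decide)
    (Or.inr (by decide))
  rw [h0, e1, show genusTwoHolomorphic.erase ∅ = genusTwoHolomorphic from rfl] at h1
  rw [h0, e2] at h2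
  rw [h0, e3] at h3
  exact ⟨h1, h2, h3, fun n p d hp hd hN => GenusTwo.represents hd hN (Or.inl hp)⟩
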